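/- **Setting.** A *vtree* $T$ is an ordered full binary tree whose leaves carry pairwise distinct Boolean variables; its nodes have the IDs $1,2,\dots$ in preorder, and $\mathtt{ID}^{-1}(k)$ is the node with ID $k$. Write $u\sim w$ if the subtrees rooted at $u$ and $w$ are isomorphic as ordered trees, and $e(w)=\min\{\mathtt{ID}(u)\mid u\sim w\}$. A *VS-SDD* for $T$ is a pair $(\alpha,k)$ of a structure and an integer offset, of one of the following forms, where $\langle\alpha,k\rangle$ is the Boolean function that it represents: * $\alpha\in\{\top,\bot\}$, representing *true* or *false* (any $k$); * $\alpha\in\{\mathbf v,\neg\mathbf v\}$, where $\mathtt{ID}^{-1}(k)$ is a leaf with variable $X$, representing $X$ or $\neg X$; * $\alpha=\{([p_i,d_i],[s_i,e_i])\}_{i=1}^n$, where $\mathtt{ID}^{-1}(k)$ is an internal node, all $(p_i,k+d_i)$ and $(s_i,k+e_i)$ are VS-SDDs, each non-constant $p_i$ (resp. $s_i$) sits at a node $\mathtt{ID}^{-1}(k+d_i)$ below or equal to the left (resp. $\mathtt{ID}^{-1}(k+e_i)$ below or equal to the right) child of $\mathtt{ID}^{-1}(k)$, and the functions $\langle p_i,k+d_i\rangle$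 are different from *false*, pairwise disjoint, with disjunction *true*; it represents $\bigvee_i\langle p_i,k+d_i\rangle\wedge\langle s_i,k+e_i\rangle$. Edges to constants carry no offset. Structures are DAGs in which identical substructures are merged, but a node is shared between offsets $k,k'$ only if $\mathtt{ID}^{-1}(k)\sim\mathtt{ID}^{-1}(k')$ (identical vtree rule). The size $|\alpha|$ is the sum of the numbers of elements of all decomposition nodes of the DAG; in a time bound, the size of a structure without decomposition nodes counts as $1$. A VS-SDD is *normalized* if in every decomposition at $\mathtt{ID}^{-1}(k)$ each non-constant prime $p_i$ (sub $s_i$) sits at the left (right) child of $\mathtt{ID}^{-1}(k)$ itself. **Algorithms.** $\circ$ is any binary Boolean operator. All caches are empty at the start. A unique table stores at most one node for each pair of an isomorphism class and a set of elements. $\mathtt{Consistent}(p)$ decides whether $p$ represents a function other than *false*: $\bot$ is inconsistent, the other terminals are consistent, and a decomposition is consistent iff for some element both prime and sub are; results are cached by node. * *Normalized.* $\mathtt{Apply}(\alpha,\beta,k,\circ)$ returns the terminal $\alpha\circ\beta$ with offset $k$ if $\alpha,\beta$ are both terminals (constants or literals). Otherwise, if $\mathtt{Cache}(\alpha,\beta,\circ)$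 is defined, it returns this structure with offset $k$. Otherwise it replaces a constant $c\in\{\top,\bot\}$ by $\{([\top,\cdot],[c,\cdot])\}$; for each pair of elements $([p_i,d],[s_i,e])$ of $\alpha$ and $([q_j,d],[r_j,e])$ of $\beta$ it computes $\mathtt{Apply}(p_i,q_j,k+d,\wedge)$ and, if the result is consistent, also $\mathtt{Apply}(s_i,r_j,k+e,\circ)$, and adds the resulting element, with offsets relative to $k$. It replaces $\{([\top,\cdot],[c,\cdot])\}$, $c\in\{\top,\bot\}$, by $c$, and any other set of elements by its unique node; it caches the result and returns it with offset $k$. * *General.* $\mathtt{Apply}(\alpha,\beta,k_\alpha,k_\beta,f_\alpha,f_\beta,\circ)$ has Boolean flags $f_\alpha,f_\beta$ (*false* at the top level) which say that the argument is negated. Negations of terminals are carried out, and constants get offset $0$. Let $w$ be the lowest common ancestor of $\mathtt{ID}^{-1}(k_\alpha)$ and $\mathtt{ID}^{-1}(k_\beta)$, where $\mathtt{ID}^{-1}(0)$ counts as a descendant of every node. If both arguments are terminals, and one is a constant or $k_\alpha=k_\beta$, the terminal $\alpha\circ\beta$ is returned, with offset $0$ if it is a constant and $\max\{k_\alpha,k_\beta\}$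 otherwise. Otherwise the result is looked up in a cache with the key $(\alpha,\beta,f_\alpha,f_\beta,\max\{k_\alpha-\mathtt{ID}(w),0\},\max\{k_\beta-\mathtt{ID}(w),0\},e(w),\circ)$ and, if found, is returned with offset $\mathtt{ID}(w)$. If it is not found, each argument is brought to $w$. If it sits at $w$, its own elements are used, the flag being passed to the subs. If it sits below the left child of $w$ or at it, $\{(\alpha,\top),(\neg\alpha,\bot)\}$ is used (with $\alpha$ and $\neg\alpha$ subject to the flag), and in the remaining case $\{(\top,\alpha)\}$. For all pairs of elements the primes are combined recursively with $\wedge$ and, if the result is consistent, the subs with $\circ$; the elements obtained, with offsets relative to $\mathtt{ID}(w)$ (and none for constants), are turned into their unique node of class $e(w)$, which is cached and returned with offset $\mathtt{ID}(w)$. **Cost.** Unit cost for arithmetic, comparison of pointers, cache access, each iteration of a loop, and queries to the preprocessed vtree (lowest common ancestors, the classes $e(w)$, IDs of children); cost $n+1$ for looking up or creating a node with $n$ elements in the unique table. **Proposition.** There is an absolute constant $C$ such that the following holds for every vtree $T$, every binary Boolean operator $\circ$, and every initial content of the unique table in which no two nodes have the same class and the same set of elements. 1. If $(\alpha,k)$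 and $(\beta,k)$ are normalized VS-SDDs for $T$, then $\mathtt{Apply}(\alpha,\beta,k,\circ)$ terminates within $C\,|\alpha||\beta|$ steps and returns a normalized VS-SDD $(\gamma,k)$ for $T$ with $\langle\gamma,k\rangle=\langle\alpha,k\rangle\circ\langle\beta,k\rangle$. 2. If $(\alpha,k)$ and $(\beta,\ell)$ are arbitrary (in particular, trimmed) VS-SDDs for $T$, then $\mathtt{Apply}(\alpha,\beta,k,\ell,\mathit{false},\mathit{false},\circ)$ terminates within $C\,|\alpha||\beta|$ steps and returns a VS-SDD $(\gamma,m)$ for $T$ with $\langle\gamma,m\rangle=\langle\alpha,k\rangle\circ\langle\beta,\ell\rangle$. In both cases the nodes of $\gamma$ and the nodes of the initial unique table are in the final unique table, in which still no two nodes have the same class and the same set of elements. The output need not be compressed. -/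

import Mathlib

universe u

namespace VSSDD

/-! ### Vtrees: ordered full binary trees whose leaves carry variables -/

inductive VTree (V : Type u) : Type u where
  | leaf (x : V) : VTree V
  | node (l r : VTree V) : VTree V

namespace VTree

variable {V : Type u}

/-- The variables at the leaves, from left to right. -/
def leaves : VTree V → List V
  | leaf x => [x]
  | node l r => l.leaves ++ r.leaves

/-- Number of nodes (leaves and internal nodes). -/
def size : VTree V → ℕ
  | leaf _ => 1
  | node l r => 1 + l.size + r.size

/-- The tree with the variables erased: two vtree nodes are isomorphic (as ordered trees)
iff the subtrees rooted at them have the same shape. -/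
def shape : VTree V → VTree Unit
  | leaf _ => leaf ()
  | node l r => node l.shape r.shape

/-- Equality of shapes is decidable. -/
def decEqShape : (s t : VTree Unit) → Decidable (s = t)
  | leaf _, leaf _ => isTrue rfl
  | leaf _, node _ _ => isFalse (by simp)
  | node _ _, leaf _ => isFalse (by simp)
  | node l r, node l' r' =>
    match decEqShape l l', decEqShape r r' with
    | isTrue h, isTrue h' => isTrue (by rw [h, h'])
    | isFalse h, _ => isFalse (by simp [h])
    | _, isFalse h => isFalse (by simp [h])

instance : DecidableEq (VTree Unit) := decEqShape

/-- The subtree rooted at the `n`-th node (counted from `0`) of the preorder traversal. -/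
def nodeAt : VTree V → ℕ → Option (VTree V)
  | t, 0 => some t
  | leaf _, _ + 1 => none
  | node l r, n + 1 => if n < l.size then l.nodeAt n else r.nodeAt (n - l.size)

/-- `ID⁻¹(k)`. The nodes have the IDs `1, 2, …, size` in preorder. So if `k` is the ID of a node
with children `l`, `r`, then the IDs of the left descendants are the `j` with
`k + 1 ≤ j < k + 1 + l.size`, and the IDs of the right descendants are the `j` with
`k + 1 + l.size ≤ j < k + 1 + l.size + r.size`. -/
def idInv (T : VTree V) (k : ℤ) : Option (VTree V) :=
  if 1 ≤ k then T.nodeAt (k - 1).toNat else none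

/-- `e(w)` for the node `w` with ID `k`: the smallest ID of a node isomorphic to `w`. -/
def cls (T : VTree V) (k : ℤ) : ℕ :=
  ((List.range (T.size + 1) : List ℕ).find? fun (i : ℕ) =>
    decide ((T.idInv (i : ℤ)).map shape = (T.idInv k).map shape)).getD 0

/-- The ID of the right child of the node with ID `k` (`0` if there is none). -/
def rightId (T : VTree V) (k : ℤ) : ℤ :=
  match T.idInv k with
  | some (node l _) => k + 1 + l.size
  | _ => 0

/-- The ID of the lowest common ancestor of the nodes with IDs `i` and `j` in a tree whose root
has ID `b`. -/
def lcaFrom : VTree V → ℤ → ℤ → ℤ → ℤ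
  | leaf _, b, _, _ => b
  | node l r, b, i, j =>
    if b < i ∧ b < j ∧ i < b + 1 + l.size ∧ j < b + 1 + l.size then l.lcaFrom (b + 1) i j
    else if b + 1 + l.size ≤ i ∧ b + 1 + l.size ≤ j then r.lcaFrom (b + 1 + l.size) i j
    else b

/-- Lowest common ancestor; the number `0`, which is the offset given to constants, counts as
a descendant of every node. -/
def lca (T : VTree V) (i j : ℤ) : ℤ :=
  if i = 0 then j else if j = 0 then i else T.lcaFrom 1 i j

end VTree

/-! ### VS-SDD structures -/

/-- An element `([prime, d], [sub, e])`. -/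
structure Elem (S : Type) where
  prime : S
  d : ℤ
  sub : S
  e : ℤ

/-- VS-SDD structures: `⊤`, `⊥`, `𝐯`, `¬𝐯` and decompositions. A decomposition node also records
the isomorphism class `c` of the vtree nodes at which it is used: structures with equal elements
are shared only within one class (identical vtree rule). -/
inductive Str where
  | top
  | bot
  | pos
  | neg
  | dec (c : ℕ) (els : List (Elem Str))

namespace Str

mutual
/-- Equality of structures is decidable. -/
def decEq : (s t : Str) → Decidable (s = t)
  | top, top | bot, bot | pos, pos | neg, neg => isTrue rfl
  | dec c l, dec c' l' =>
    match decEqList l l' with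
    | isTrue h => if hc : c = c' then isTrue (by rw [h, hc]) else isFalse (by simp [hc])
    | isFalse h => isFalse (by simp [h])
  | top, bot | top, pos | top, neg | top, dec _ _ => isFalse (by simp)
  | bot, top | bot, pos | bot, neg | bot, dec _ _ => isFalse (by simp)
  | pos, top | pos, bot | pos, neg | pos, dec _ _ => isFalse (by simp)
  | neg, top | neg, bot | neg, pos | neg, dec _ _ => isFalse (by simp)
  | dec _ _, top | dec _ _, bot | dec _ _, pos | dec _ _, neg => isFalse (by simp)
def decEqElem : (s t : Elem Str) → Decidable (s = t)
  | ⟨p, d, s, e⟩, ⟨p', d', s', e'⟩ =>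
    match decEq p p', decEq s s' with
    | isTrue hp, isTrue hs =>
      if h : d = d' ∧ e = e' then isTrue (by rw [hp, hs, h.1, h.2])
      else isFalse (fun h' => by simp only [Elem.mk.injEq] at h'; exact h ⟨h'.2.1, h'.2.2.2⟩)
    | isFalse h, _ => isFalse (by simp [h])
    | _, isFalse h => isFalse (by simp [h])
def decEqList : (s t : List (Elem Str)) → Decidable (s = t)
  | [], [] => isTrue rfl
  | [], _ :: _ | _ :: _, [] => isFalse (by simp)
  | x :: l, y :: l' =>
    match decEqElem x y, decEqList l l' with
    | isTrue h, isTrue h' => isTrue (by rw [h, h'])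
    | isFalse h, _ => isFalse (by simp [h])
    | _, isFalse h => isFalse (by simp [h])
end

instance : DecidableEq Str := decEq
instance : DecidableEq (Elem Str) := decEqElem

/-- The constants `⊤`, `⊥`. -/
def isConst : Str → Bool
  | top | bot => true
  | _ => false

/-- The terminals `⊤`, `⊥`, `𝐯`, `¬𝐯`. -/
def isTerm : Str → Bool
  | dec _ _ => false
  | _ => true

/-- The elements of a decomposition. -/
def els : Str → List (Elem Str)
  | dec _ l => l
  | _ => []

/-- All decompositions that occur in a structure, listed with repetitions. -/
def decs : Str → List Str
  | dec c l => dec c l :: l.flatMap fun x => decs x.prime ++ decs x.sub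
  | _ => []
termination_by s => sizeOf s
decreasing_by
  all_goals
    have h := List.sizeOf_lt_of_mem (by assumption)
    cases x
    simp at h ⊢
    omega

/-- The decomposition nodes of the structure, seen as a DAG in which identical substructures
are merged. -/
def nodes (α : Str) : Finset Str := α.decs.toFinset

/-- The size `|α|`: the sum of the sizes of all decompositions in the DAG. -/
def size (α : Str) : ℕ := ∑ s ∈ α.nodes, s.els.length

/-- Decompositions with the same class and the same elements up to order. -/
def Same : Str → Str → Prop
  | dec c l, dec c' l' => c = c' ∧ l.Perm l'
  | _, _ => False

instance : DecidableRel Same := fun s t => by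
  cases s <;> cases t <;> unfold Same <;> infer_instance

end Str

section Semantics

variable {V : Type u}

/-- The Boolean function `⟨α, k⟩`. -/
def eval (T : VTree V) : Str → ℤ → (V → Bool) → Bool
  | .top, _, _ => true
  | .bot, _, _ => false
  | .pos, k, ρ =>
    match T.idInv k with
    | some (.leaf x) => ρ x
    | _ => false
  | .neg, k, ρ =>
    match T.idInv k with
    | some (.leaf x) => !ρ x
    | _ => false
  | .dec _ l, k, ρ =>
    l.attach.any fun ⟨x, _⟩ => eval T x.prime (k + x.d) ρ && eval T x.sub (k + x.e) ρ
termination_by s => sizeOf s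
decreasing_by
  all_goals
    have h := List.sizeOf_lt_of_mem (by assumption)
    cases x
    simp at h ⊢
    omega

/-- `(α, k)` is a VS-SDD for the vtree `T`. The edge to a constant carries no offset; this is
encoded by the value `0`. -/
inductive IsVSSDD (T : VTree V) : Str → ℤ → Prop where
  | top (k : ℤ) : IsVSSDD T .top k
  | bot (k : ℤ) : IsVSSDD T .bot k
  | pos {k : ℤ} {x : V} (h : T.idInv k = some (.leaf x)) : IsVSSDD T .pos k
  | neg {k : ℤ} {x : V} (h : T.idInv k = some (.leaf x)) : IsVSSDD T .neg k
  | dec {k : ℤ} {l r : VTree V} {c : ℕ} {els : List (Elem Str)}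
      (hk : T.idInv k = some (.node l r))
      (identical_vtree_rule : c = T.cls k)
      (prime_valid : ∀ x ∈ els, IsVSSDD T x.prime (k + x.d))
      (sub_valid : ∀ x ∈ els, IsVSSDD T x.sub (k + x.e))
      (prime_left : ∀ x ∈ els, if x.prime.isConst then x.d = 0 else
        k + 1 ≤ k + x.d ∧ k + x.d < k + 1 + l.size)
      (sub_right : ∀ x ∈ els, if x.sub.isConst then x.e = 0 else
        k + 1 + l.size ≤ k + x.e ∧ k + x.e < k + 1 + l.size + r.size)
      (prime_disjoint : els.Pairwise fun x y => ∀ ρ : V → Bool,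
        (eval T x.prime (k + x.d) ρ && eval T y.prime (k + y.d) ρ) = false)
      (prime_cover : ∀ ρ : V → Bool, ∃ x ∈ els, eval T x.prime (k + x.d) ρ = true)
      (prime_ne_false : ∀ x ∈ els, ∃ ρ : V → Bool, eval T x.prime (k + x.d) ρ = true) :
      IsVSSDD T (.dec c els) k

/-- `(α, k)` is normalized: at each decomposition with offset `k`, the primes sit at the left
child and the subs at the right child of `ID⁻¹(k)` (constants carry no offset). -/
inductive Normalized (T : VTree V) : Str → ℤ → Prop where
  | term {α : Str} (k : ℤ) (h : α.isTerm = true) : Normalized T α k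
  | dec {k : ℤ} {c : ℕ} {els : List (Elem Str)}
      (prime_left : ∀ x ∈ els, x.prime.isConst = true ∨ k + x.d = k + 1)
      (sub_right : ∀ x ∈ els, x.sub.isConst = true ∨ k + x.e = T.rightId k)
      (prime_norm : ∀ x ∈ els, Normalized T x.prime (k + x.d))
      (sub_norm : ∀ x ∈ els, Normalized T x.sub (k + x.e)) :
      Normalized T (.dec c els) k

end Semantics

/-! ### The machine: memory with a step counter

Structures are handled as pointers into the hash-consed DAG, so comparing two of them, or hashing
a key made of a bounded number of structures, integers, flags and an operator symbol, is one step.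
Hash tables answer in unit time; looking up or creating a node with `n` elements costs `n + 1`.
The vtree is preprocessed, so `lca`, `cls` and `rightId` are answered in unit time. -/

/-- A Boolean operator. -/
abbrev BoolOp := Bool → Bool → Bool

/-- Keys `(α, β, f_α, f_β, e_α, e_β, e(w), ∘)` of the cache of the general algorithm. -/
structure ConvKey where
  α : Str
  β : Str
  fα : Bool
  fβ : Bool
  eα : ℤ
  eβ : ℤ
  c : ℕ
  op : BoolOp
deriving DecidableEq

/-- Keys `(α, β, ∘)` of the cache of the algorithm for normalized VS-SDDs. -/
structure NormKey where
  α : Str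
  β : Str
  op : BoolOp
deriving DecidableEq

structure Mem where
  /-- Number of steps made so far. -/
  time : ℕ
  /-- The unique table: the decomposition nodes that exist. -/
  uniq : List Str
  conv : ConvKey → Option Str
  norm : NormKey → Option Str
  cons : Str → Option Bool

/-- Initial memory: the caches are empty, the unique table is given. -/
def Mem.init (U : List Str) : Mem :=
  ⟨0, U, fun _ => none, fun _ => none, fun _ => none⟩

/-- Programs: they change the memory, and return `none` iff they do not terminate. -/
abbrev Prog := StateT Mem Option

/-- Make `n` steps. -/
def tick (n : ℕ) : Prog Unit := modify fun m => { m with time := m.time + n }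

def lcaQuery {V : Type u} (T : VTree V) (i j : ℤ) : Prog ℤ := do tick 1; return T.lca i j

def clsQuery {V : Type u} (T : VTree V) (k : ℤ) : Prog ℕ := do tick 1; return T.cls k

def rightQuery {V : Type u} (T : VTree V) (k : ℤ) : Prog ℤ := do tick 1; return T.rightId k

def convLookup (key : ConvKey) : Prog (Option Str) := do tick 1; return (← get).conv key

def convStore (key : ConvKey) (s : Str) : Prog Unit := do
  tick 1
  modify fun m => { m with conv := Function.update m.conv key (some s) }

def normLookup (key : NormKey) : Prog (Option Str) := do tick 1; return (← get).norm key

def normStore (key : NormKey) (s : Str) : Prog Unit := do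
  tick 1
  modify fun m => { m with norm := Function.update m.norm key (some s) }

def consLookup (α : Str) : Prog (Option Bool) := do tick 1; return (← get).cons α

def consStore (α : Str) (b : Bool) : Prog Unit := do
  tick 1
  modify fun m => { m with cons := Function.update m.cons α (some b) }

/-- The node of class `c` with the set `γ` of elements; it is created if it does not exist. -/
def uniqueNode (c : ℕ) (γ : List (Elem Str)) : Prog Str := do
  tick (γ.length + 1)
  match (← get).uniq.find? fun s => decide (Str.Same (.dec c γ) s) with
  | some s => return s
  | none =>
    modify fun m => { m with uniq := .dec c γ :: m.uniq }
    return .dec c γ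

/-- `Consistent(α)`: decides whether the function that `α` represents is not `false`. -/
def consistent (α : Str) : Prog Bool := do
  tick 1
  match α with
  | .bot => return false
  | .top | .pos | .neg => return true
  | .dec _ els =>
    match ← consLookup α with
    | some b => return b
    | none =>
      let b ← els.anyM fun x => do
        tick 1
        if ← consistent x.prime then consistent x.sub else return false
      consStore α b
      return b
  partial_fixpoint

/-! ### `Apply` on terminals -/

/-- The value of a terminal, given the value of its variable. -/
def termVal : Str → Bool → Bool
  | .top, _ => true
  | .bot, _ => false
  | .pos, b => b
  | .neg, b => !b
  | .dec _ _, _ => false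

/-- The terminal with given values at `true` and at `false`. -/
def ofVals : Bool → Bool → Str
  | true, true => .top
  | false, false => .bot
  | true, false => .pos
  | false, true => .neg

/-- `α ∘ β` for terminals on the same variable. -/
def termOp (op : BoolOp) (α β : Str) : Str :=
  ofVals (op (termVal α true) (termVal β true)) (op (termVal α false) (termVal β false))

/-- `¬α` for a terminal `α`. -/
def negTerm (α : Str) : Str := ofVals (!termVal α true) (!termVal α false)

/-! ### `Apply` for normalized VS-SDDs -/

/-- `Expand(α)`: a constant becomes the decomposition with the single prime `⊤`. -/
def expandNorm : Str → List (Elem Str)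
  | .top => [⟨.top, 0, .top, 0⟩]
  | .bot => [⟨.top, 0, .bot, 0⟩]
  | .dec _ els => els
  | _ => []

/-- `UniqueD(γ)` for a node of class `c`. -/
def uniqueD (c : ℕ) (γ : List (Elem Str)) : Prog Str := do
  tick 1
  match γ with
  | [⟨.top, _, .top, _⟩] => return .top
  | [⟨.top, _, .bot, _⟩] => return .bot
  | _ => uniqueNode c γ

/-- The offset of the edge from a node with offset `k` to a structure `p` with offset `l`;
edges to constants carry no offset. -/
def edgeOffset (p : Str) (l k : ℤ) : ℤ := if p.isConst then 0 else l - k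

/-- `Apply(α, β, k, ∘)` for normalized VS-SDDs. Primes are combined with `∧`, subs with `∘`.
The two primes (and the two subs) have a common offset unless one of them is a constant; the
common offset is then read off the other edge. -/
def applyNormalized {V : Type u} (T : VTree V) (α β : Str) (k : ℤ) (op : BoolOp) :
    Prog (Str × ℤ) := do
  tick 1
  if α.isTerm && β.isTerm then
    return (termOp op α β, k)
  else
    match ← normLookup ⟨α, β, op⟩ with
    | some s => return (s, k)
    | none =>
      let γ ← (expandNorm α).foldlM (fun γ x => do
        tick 1
        (expandNorm β).foldlM (fun γ y => do
          tick 1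
          let (p, lp) ← applyNormalized T x.prime y.prime
            (if x.prime.isConst then k + y.d else k + x.d) and
          if ← consistent p then
            let (s, ls) ← applyNormalized T x.sub y.sub
              (if x.sub.isConst then k + y.e else k + x.e) op
            return ⟨p, edgeOffset p lp k, s, edgeOffset s ls k⟩ :: γ
          else
            return γ) γ) []
      let s ← uniqueD (← clsQuery T k) γ
      normStore ⟨α, β, op⟩ s
      return (s, k)
  partial_fixpoint

/-! ### `Apply` for arbitrary VS-SDDs -/

/-- An element whose prime and sub carry a negation flag. -/
structure FlaggedElem where
  el : Elem Str
  fp : Bool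
  fs : Bool

/-- `Expand(α, f, k, w)`; here `w` is the ID of the vtree node. -/
def expand {V : Type u} (T : VTree V) (α : Str) (f : Bool) (k w : ℤ) :
    Prog (List FlaggedElem) := do
  let right ← rightQuery T w
  if k = w then
    tick α.els.length
    return α.els.map fun x => ⟨x, false, f⟩
  else if k < right ∧ k ≠ 0 then
    return [⟨⟨α, 0, .top, 0⟩, f, false⟩, ⟨⟨α, 0, .bot, 0⟩, !f, false⟩]
  else
    return [⟨⟨.top, 0, α, 0⟩, false, f⟩]

/-- `Apply(α, β, kα, kβ, fα, fβ, ∘)`: a VS-SDD of `⟨α, kα⟩ ∘ ⟨β, kβ⟩`, where `⟨α, kα⟩` is negated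
if `fα` is true, and `⟨β, kβ⟩` if `fβ` is true. The cache does not use the offsets, only their
differences to the lowest common ancestor `w`, and the isomorphism class of `w`. -/
def applyFlagged {V : Type u} (T : VTree V) (α β : Str) (kα kβ : ℤ) (fα fβ : Bool)
    (op : BoolOp) : Prog (Str × ℤ) := do
  tick 1
  let (α, fα) := if α.isTerm && fα then (negTerm α, false) else (α, fα)
  let (β, fβ) := if β.isTerm && fβ then (negTerm β, false) else (β, fβ)
  let kα := if α.isConst then 0 else kα
  let kβ := if β.isConst then 0 else kβ
  let w ← lcaQuery T kα kβ
  let eα := max (kα - w) 0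
  let eβ := max (kβ - w) 0
  if α.isTerm = true ∧ β.isTerm = true ∧ (kα = 0 ∨ kβ = 0 ∨ kα = kβ) then
    let γ := termOp op α β
    return (γ, if γ.isConst then 0 else max kα kβ)
  else
    let c ← clsQuery T w
    match ← convLookup ⟨α, β, fα, fβ, eα, eβ, c, op⟩ with
    | some s => return (s, w)
    | none =>
      let α' ← expand T α fα kα w
      let β' ← expand T β fβ kβ w
      let γ ← α'.foldlM (fun γ x => do
        tick 1
        β'.foldlM (fun γ y => do
          tick 1
          let (p, kp) ← applyFlagged T x.el.prime y.el.prime (kα + x.el.d) (kβ + y.el.d)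
            x.fp y.fp and
          if ← consistent p then
            let (s, ks) ← applyFlagged T x.el.sub y.el.sub (kα + x.el.e) (kβ + y.el.e)
              x.fs y.fs op
            return ⟨p, max (kp - w) 0, s, max (ks - w) 0⟩ :: γ
          else
            return γ) γ) []
      let s ← uniqueNode c γ
      convStore ⟨α, β, fα, fβ, eα, eβ, c, op⟩ s
      return (s, w)
  partial_fixpoint

/-- The top-level call. -/
def applyGeneral {V : Type u} (T : VTree V) (α β : Str) (kα kβ : ℤ) (op : BoolOp) :
    Prog (Str × ℤ) :=
  applyFlagged T α β kα kβ false false op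

/-- The unique table holds no two nodes with the same class and the same set of elements. -/
def Reduced (U : List Str) : Prop := ∀ s ∈ U, ∀ t ∈ U, Str.Same s t → s = t

end VSSDD

/-!
Why `Apply` is correct and needs a number of steps proportional to `|α||β|`.

*Correctness.* The elements of a decomposition form a partition (`IsVSSDD.partRep`), and so do the
elements into which `Expand` turns an argument (`normElems_expandNorm`, `expand_step`). Combining
the parts of two such partitions with `∧`, and the subs over them with `∘`, gives a partition that
represents `∘` of the two functions, provided that the empty parts are left out (`pairLoop_spec`).
The consistency test recognizes empty parts because the primes and the subs of a decomposition
depend on disjoint sets of variables (`IsVSSDD.sat_iff`). The keys of the caches do not contain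
absolute offsets; this does no harm because VS-SDDs, with the functions that they represent, can be
transported along an isomorphism of vtree nodes (`IsVSSDD.transport`), the variables at the leaves
being distinct.

*Time.* The analysis is amortized. A key for which nothing is cached carries a potential
proportional to the number of pairs of elements that a call for it combines, and a cached node
carries a potential proportional to its number of elements until its consistency is recorded
(`Ctx.potential`). Then a consistency test costs `2` steps and a call of `Apply` costs `4` steps in
addition to the potential that is released (`consistent_step`, `applyNormalized_call`,
`applyFlagged_call`). A call only stores results under keys of smaller rank until it stores its own
result, so the potential of a key is released once. It remains to bound the initial potential, that
is, the sum over all keys that can occur.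

In the normalized case a key consists of nodes of the two arguments and an operator, and the sum is
a product of two sums over nodes. In the general case, the same pair of nodes may meet in many
relative positions. The crucial fact is that a node of the vtree has at most one ancestor of a given
class, since isomorphic subtrees have the same size. Describe an argument of a call by the edge
through which it was reached, that is, by its distance to a node of a known class above the call;
an argument that sits at the lowest common ancestor itself is described by its own class and the
distance `0`. Then the descriptions of both arguments determine the key (`lca_unique`,
`KeyFrom.unique`). An argument that is described by an edge contributes at most two elements, and
one that is described as a node contributes its own elements, so that the sum over all keys is
bounded by a product of two sums, each of which is linear in the size of an argument
(`sum_tokens_le`, `sum_genCtx_le`).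
-/

namespace VSSDD

/-! ### Vtrees -/

section

namespace VTree

variable {V : Type u}

theorem size_pos (t : VTree V) : 0 < t.size := by
  cases t <;> simp [size]

@[simp] theorem size_shape (t : VTree V) : t.shape.size = t.size := by
  induction t <;> simp_all [shape, size]

theorem nodeAt_lt {t s : VTree V} {n : ℕ} (h : t.nodeAt n = some s) : n + s.size ≤ t.size := by
  induction t generalizing n with
  | leaf x => cases n <;> simp [nodeAt] at h; subst h; simp
  | node l r ihl ihr =>
    cases n with
    | zero => simp [nodeAt] at h; subst h; simp
    | succ n =>
      simp only [nodeAt] at h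
      split_ifs at h with hn
      · have := ihl h; simp only [size]; omega
      · have := ihr h; simp only [size]; omega

theorem nodeAt_isSome {t : VTree V} {n : ℕ} (h : n < t.size) : ∃ s, t.nodeAt n = some s := by
  induction t generalizing n with
  | leaf x => simp [size] at h; subst h; exact ⟨_, rfl⟩
  | node l r ihl ihr =>
    cases n with
    | zero => exact ⟨_, rfl⟩
    | succ n =>
      simp only [nodeAt, size] at h ⊢
      split_ifs with hn
      · exact ihl hn
      · exact ihr (by omega)

theorem nodeAt_add {t s : VTree V} {n j : ℕ} (h : t.nodeAt n = some s) (hj : j < s.size) :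
    t.nodeAt (n + j) = s.nodeAt j := by
  induction t generalizing n with
  | leaf x => cases n <;> simp [nodeAt] at h; subst h; simp
  | node l r ihl ihr =>
    cases n with
    | zero => simp [nodeAt] at h; subst h; simp
    | succ n =>
      simp only [nodeAt] at h
      rw [show n + 1 + j = (n + j) + 1 by omega]
      simp only [nodeAt]
      split_ifs at h with hn
      · have := nodeAt_lt h
        rw [if_pos (by omega), ihl h]
      · rw [if_neg (by omega), ← ihr h]; congr 1; omega

theorem nodeAt_shape (t : VTree V) (n : ℕ) : t.shape.nodeAt n = (t.nodeAt n).map shape := by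
  induction t generalizing n with
  | leaf x => cases n <;> rfl
  | node l r ihl ihr =>
    cases n with
    | zero => rfl
    | succ n => simp only [shape, nodeAt, size_shape, ihl, ihr]; split_ifs <;> rfl

theorem leaves_subset_of_nodeAt {t s : VTree V} {n : ℕ} (h : t.nodeAt n = some s) :
    s.leaves.Sublist t.leaves := by
  induction t generalizing n with
  | leaf x => cases n <;> simp [nodeAt] at h; subst h; simp
  | node l r ihl ihr =>
    cases n with
    | zero => simp [nodeAt] at h; subst h; simp
    | succ n =>
      simp only [nodeAt] at h
      split_ifs at h with hn
      · exact (ihl h).trans (List.sublist_append_left _ _)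
      · exact (ihr h).trans (List.sublist_append_right _ _)

/-- Assignments can be transported between trees of the same shape. -/
theorem exists_agree {t t' : VTree V} (hs : t.shape = t'.shape) (hn : t.leaves.Nodup)
    (ρ' : V → Bool) : ∃ ρ : V → Bool, ∀ n x x', t.nodeAt n = some (leaf x) →
      t'.nodeAt n = some (leaf x') → ρ x = ρ' x' := by
  classical
  induction t generalizing t' with
  | leaf x =>
    cases t' with
    | node l r => simp [shape] at hs
    | leaf x' =>
      refine ⟨fun _ => ρ' x', fun n y y' h h' => ?_⟩
      cases n <;> simp [nodeAt] at h h'; rw [h']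
  | node l r ihl ihr =>
    cases t' with
    | leaf x => simp [shape] at hs
    | node l' r' =>
      simp only [shape, node.injEq] at hs
      simp only [leaves, List.nodup_append] at hn
      obtain ⟨ρl, hl⟩ := ihl hs.1 hn.1
      obtain ⟨ρr, hr⟩ := ihr hs.2 hn.2.1
      have hsz : l.size = l'.size := by rw [← size_shape l, hs.1, size_shape]
      refine ⟨fun v => if v ∈ l.leaves then ρl v else ρr v, fun n x x' h h' => ?_⟩
      cases n with
      | zero => simp [nodeAt] at h
      | succ n =>
        simp only [nodeAt, hsz] at h h'
        split_ifs at h h' with hn'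
        · have : x ∈ l.leaves := (leaves_subset_of_nodeAt h).subset (by simp [leaves])
          simp only [this, if_true]; exact hl _ _ _ h h'
        · have : x ∈ r.leaves := (leaves_subset_of_nodeAt h).subset (by simp [leaves])
          have : x ∉ l.leaves := fun hx => hn.2.2 _ hx _ this rfl
          simp only [this, if_false]; exact hr _ _ _ h h'

/-! #### IDs -/

variable {T : VTree V}

theorem idInv_pos {k : ℤ} {t : VTree V} (h : T.idInv k = some t) : 1 ≤ k := by
  unfold idInv at h; split_ifs at h; assumption

theorem idInv_eq {k : ℤ} (h : 1 ≤ k) : T.idInv k = T.nodeAt (k - 1).toNat := by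
  simp [idInv, h]

theorem idInv_one : T.idInv 1 = some T := by
  cases T <;> simp [idInv, nodeAt]

theorem idInv_add {k j : ℤ} {t : VTree V} (h : T.idInv k = some t) (h0 : 0 ≤ j)
    (hj : j < t.size) : T.idInv (k + j) = t.nodeAt j.toNat := by
  have h1 := idInv_pos h
  rw [idInv_eq h1] at h
  rw [idInv_eq (by omega), ← nodeAt_add h (by omega)]
  congr 1; omega

theorem idInv_le {k : ℤ} {t : VTree V} (h : T.idInv k = some t) : k + t.size ≤ 1 + T.size := by
  have h1 := idInv_pos h
  rw [idInv_eq h1] at h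
  have := nodeAt_lt h
  omega

theorem idInv_left {k : ℤ} {l r : VTree V} (h : T.idInv k = some (node l r)) :
    T.idInv (k + 1) = some l := by
  have := size_pos l
  rw [idInv_add h (by omega) (by simp only [size]; omega)]
  cases l <;> simp_all [nodeAt]

theorem idInv_right {k : ℤ} {l r : VTree V} (h : T.idInv k = some (node l r)) :
    T.idInv (k + 1 + l.size) = some r := by
  have := size_pos r
  rw [add_assoc, idInv_add h (by omega) (by simp only [size]; omega),
    show ((1 + (l.size : ℤ)).toNat) = l.size + 1 by omega]
  simp [nodeAt]

/-- The node with ID `k` is the node with ID `u` or a descendant of it. -/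
def Below (T : VTree V) (u k : ℤ) : Prop := ∃ t, T.idInv u = some t ∧ u ≤ k ∧ k < u + t.size

/-- The nodes with IDs `k` and `k'` exist and are isomorphic. -/
def Iso (T : VTree V) (k k' : ℤ) : Prop :=
  ∃ t t', T.idInv k = some t ∧ T.idInv k' = some t' ∧ t.shape = t'.shape

theorem Below.exists {u k : ℤ} (h : T.Below u k) : ∃ t, T.idInv k = some t := by
  obtain ⟨t, ht, h1, h2⟩ := h
  obtain ⟨s, hs⟩ := nodeAt_isSome (t := t) (n := (k - u).toNat) (by omega)
  refine ⟨s, ?_⟩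
  rw [← hs, ← idInv_add ht (by omega) (by omega)]; congr 1; omega

theorem below_self {k : ℤ} {t : VTree V} (h : T.idInv k = some t) : T.Below k k :=
  ⟨t, h, le_rfl, by have := size_pos t; omega⟩

theorem below_one {k : ℤ} {t : VTree V} (h : T.idInv k = some t) : T.Below 1 k :=
  ⟨T, idInv_one, idInv_pos h, by have := idInv_le h; have := size_pos t; omega⟩

theorem Below.nested {u k : ℤ} {t s : VTree V} (h : T.Below u k) (ht : T.idInv u = some t)
    (hs : T.idInv k = some s) : k + s.size ≤ u + t.size := by
  obtain ⟨t', ht', h1, h2⟩ := h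
  obtain rfl : t = t' := by rw [ht] at ht'; exact Option.some.inj ht'
  have h3 := idInv_add ht (j := k - u) (by omega) (by omega)
  rw [show u + (k - u) = k by omega, hs] at h3
  have := nodeAt_lt h3.symm
  omega

theorem Below.trans {u v k : ℤ} (h : T.Below u v) (h' : T.Below v k) : T.Below u k := by
  obtain ⟨s, hs⟩ := h.exists
  have h3 := h
  obtain ⟨t, ht, h1, h2⟩ := h
  have h4 := h3.nested ht hs
  obtain ⟨s', hs', h5, h6⟩ := h'
  obtain rfl : s = s' := by rw [hs] at hs'; exact Option.some.inj hs'
  exact ⟨t, ht, by omega, by omega⟩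

theorem Below.le {u k : ℤ} (h : T.Below u k) : u ≤ k := by obtain ⟨_, _, h, _⟩ := h; exact h

theorem Below.pos {u k : ℤ} (h : T.Below u k) : 1 ≤ u := by
  obtain ⟨_, h, _⟩ := h; exact idInv_pos h

theorem below_left {k j : ℤ} {l r : VTree V} (h : T.idInv k = some (node l r)) :
    T.Below (k + 1) j ↔ k + 1 ≤ j ∧ j < k + 1 + l.size := by
  constructor
  · rintro ⟨t, ht, h1⟩
    rw [idInv_left h] at ht; cases ht; exact h1
  · exact fun h1 => ⟨l, idInv_left h, h1⟩

theorem below_right {k j : ℤ} {l r : VTree V} (h : T.idInv k = some (node l r)) :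
    T.Below (k + 1 + l.size) j ↔ k + 1 + l.size ≤ j ∧ j < k + 1 + l.size + r.size := by
  constructor
  · rintro ⟨t, ht, h1⟩
    rw [idInv_right h] at ht; cases ht; exact h1
  · exact fun h1 => ⟨r, idInv_right h, h1⟩

theorem below_left_self {k : ℤ} {l r : VTree V} (h : T.idInv k = some (node l r)) :
    T.Below k (k + 1) :=
  ⟨_, h, by omega, by have := size_pos l; simp only [size]; omega⟩

theorem below_right_self {k : ℤ} {l r : VTree V} (h : T.idInv k = some (node l r)) :
    T.Below k (k + 1 + l.size) :=
  ⟨_, h, by omega, by have := size_pos r; simp only [size]; omega⟩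

/-- Two nodes on one root path whose subtrees have the same size coincide. -/
theorem Below.eq_of_size {u v k : ℤ} {t s : VTree V} (hu : T.Below u k) (hv : T.Below v k)
    (ht : T.idInv u = some t) (hs : T.idInv v = some s) (h : t.size = s.size) : u = v := by
  have hu' := hu
  have hv' := hv
  obtain ⟨t', ht', h1, h2⟩ := hu
  obtain rfl : t = t' := by rw [ht] at ht'; exact Option.some.inj ht'
  obtain ⟨s', hs', h3, h4⟩ := hv
  obtain rfl : s = s' := by rw [hs] at hs'; exact Option.some.inj hs'
  rcases le_total u v with h5 | h5
  · have := Below.nested (T := T) (u := u) (k := v) ⟨t, ht, h5, by omega⟩ ht hs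
    omega
  · have := Below.nested (T := T) (u := v) (k := u) ⟨s, hs, h5, by omega⟩ hs ht
    omega

/-- Of two nodes on one root path, the one with the larger subtree is above the other. -/
theorem Below.below_of_size {u v k : ℤ} {t s : VTree V} (hu : T.Below u k) (hv : T.Below v k)
    (ht : T.idInv u = some t) (hs : T.idInv v = some s) (h : s.size ≤ t.size) : T.Below u v := by
  have hu' := hu
  have hv' := hv
  obtain ⟨t', ht', h1, h2⟩ := hu
  obtain rfl : t = t' := by rw [ht] at ht'; exact Option.some.inj ht'
  obtain ⟨s', hs', h3, h4⟩ := hv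
  obtain rfl : s = s' := by rw [hs] at hs'; exact Option.some.inj hs'
  rcases le_total u v with h5 | h5
  · exact ⟨t, ht, h5, by omega⟩
  · have := Below.nested (T := T) (u := v) (k := u) ⟨s, hs, h5, by omega⟩ hs ht
    exact ⟨t, ht, by omega, by omega⟩

/-! #### Isomorphic nodes -/

theorem Iso.symm {k k' : ℤ} (h : T.Iso k k') : T.Iso k' k := by
  obtain ⟨t, t', h1, h2, h3⟩ := h; exact ⟨t', t, h2, h1, h3.symm⟩

theorem iso_refl {k : ℤ} {t : VTree V} (h : T.idInv k = some t) : T.Iso k k := ⟨t, t, h, h, rfl⟩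

theorem Iso.below {k k' j : ℤ} (h : T.Iso k k') (hj : T.Below k (k + j)) :
    T.Below k' (k' + j) := by
  obtain ⟨t, t', h1, h2, h3⟩ := h
  obtain ⟨s, hs, h4, h5⟩ := hj
  obtain rfl : t = s := by rw [h1] at hs; exact Option.some.inj hs
  exact ⟨t', h2, by omega, by rw [← size_shape t', ← h3, size_shape]; omega⟩

theorem Iso.add {k k' j : ℤ} (h : T.Iso k k') (hj : T.Below k (k + j)) :
    T.Iso (k + j) (k' + j) := by
  have hj' := h.below hj
  obtain ⟨a, ha⟩ := hj.exists
  obtain ⟨b, hb⟩ := hj'.exists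
  obtain ⟨t, t', h1, h2, h3⟩ := h
  obtain ⟨s, hs, h4, h5⟩ := hj
  obtain rfl : t = s := by rw [h1] at hs; exact Option.some.inj hs
  obtain ⟨s', hs', h4', h5'⟩ := hj'
  obtain rfl : t' = s' := by rw [h2] at hs'; exact Option.some.inj hs'
  refine ⟨a, b, ha, hb, ?_⟩
  have e1 := idInv_add h1 (j := j) (by omega) (by omega)
  have e2 := idInv_add h2 (j := j) (by omega) (by omega)
  have : some a.shape = some b.shape := by
    rw [← Option.map_some, ← ha, e1, ← nodeAt_shape, h3, nodeAt_shape, ← e2, hb]; rfl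
  exact Option.some.inj this

theorem Iso.size_eq {k k' : ℤ} {t t' : VTree V} (h : T.Iso k k') (ht : T.idInv k = some t)
    (ht' : T.idInv k' = some t') : t.size = t'.size := by
  obtain ⟨s, s', h1, h2, h3⟩ := h
  rw [ht] at h1; rw [ht'] at h2; cases h1; cases h2
  rw [← size_shape, h3, size_shape]

theorem Iso.node {k k' : ℤ} {l r : VTree V} (h : T.Iso k k') (hk : T.idInv k = some (node l r)) :
    ∃ l' r', T.idInv k' = some (node l' r') ∧ l'.size = l.size ∧ r'.size = r.size := by
  obtain ⟨s, s', h1, h2, h3⟩ := h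
  rw [hk] at h1; cases h1
  cases s' with
  | leaf x => simp [shape] at h3
  | node l' r' =>
    simp only [shape, node.injEq] at h3
    exact ⟨l', r', h2, by rw [← size_shape, ← h3.1, size_shape],
      by rw [← size_shape, ← h3.2, size_shape]⟩

theorem Iso.leaf {k k' : ℤ} {x : V} (h : T.Iso k k') (hk : T.idInv k = some (leaf x)) :
    ∃ x', T.idInv k' = some (VTree.leaf x') := by
  obtain ⟨s, s', h1, h2, h3⟩ := h
  rw [hk] at h1; cases h1
  cases s' with
  | leaf x' => exact ⟨x', h2⟩
  | node l' r' => simp [shape] at h3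

theorem cls_spec {k : ℤ} {t : VTree V} (h : T.idInv k = some t) :
    (T.idInv (T.cls k : ℕ)).map shape = some t.shape := by
  have hk := idInv_pos h
  have hk' := idInv_le h
  have := size_pos t
  unfold cls
  cases hf : (List.range (T.size + 1)).find? fun (i : ℕ) =>
      decide ((T.idInv (i : ℤ)).map shape = (T.idInv k).map shape) with
  | none =>
    rw [List.find?_eq_none] at hf
    have := hf k.toNat (by simp; omega)
    rw [show ((k.toNat : ℕ) : ℤ) = k by omega] at this
    simp at this
  | some i =>
    have := List.find?_some hf
    simp only [decide_eq_true_eq] at this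
    simp [this, h]

/-- Nodes of the same class are isomorphic. -/
theorem iso_of_cls {k k' : ℤ} {t t' : VTree V} (h : T.idInv k = some t)
    (h' : T.idInv k' = some t') (hc : T.cls k = T.cls k') : T.Iso k k' := by
  refine ⟨t, t', h, h', Option.some.inj ?_⟩
  rw [← cls_spec h, ← cls_spec h', hc]

theorem Iso.cls_eq {k k' : ℤ} (h : T.Iso k k') : T.cls k = T.cls k' := by
  obtain ⟨t, t', h1, h2, h3⟩ := h
  simp [cls, h1, h2, h3]

theorem rightId_eq {k : ℤ} {l r : VTree V} (h : T.idInv k = some (node l r)) :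
    T.rightId k = k + 1 + l.size := by
  simp [rightId, h]

/-! #### Lowest common ancestors -/

theorem lcaFrom_shape (t : VTree V) (b i j c : ℤ) :
    t.shape.lcaFrom (b + c) (i + c) (j + c) = t.lcaFrom b i j + c := by
  induction t generalizing b with
  | leaf x => rfl
  | node l r ihl ihr =>
    simp only [shape, lcaFrom, size_shape]
    have e1 : b + c < i + c ↔ b < i := by omega
    have e2 : b + c < j + c ↔ b < j := by omega
    have e3 : i + c < b + c + 1 + l.size ↔ i < b + 1 + l.size := by omega
    have e4 : j + c < b + c + 1 + l.size ↔ j < b + 1 + l.size := by omega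
    have e5 : b + c + 1 + l.size ≤ i + c ↔ b + 1 + l.size ≤ i := by omega
    have e6 : b + c + 1 + l.size ≤ j + c ↔ b + 1 + l.size ≤ j := by omega
    simp only [e1, e2, e3, e4, e5, e6]
    split_ifs
    · rw [← ihl]; congr 1; omega
    · rw [← ihr]; congr 1; omega
    · rfl

theorem lcaFrom_nodeAt {t s : VTree V} {n : ℕ} {b i j : ℤ} (h : t.nodeAt n = some s)
    (hi : b + n ≤ i ∧ i < b + n + s.size) (hj : b + n ≤ j ∧ j < b + n + s.size) :
    t.lcaFrom b i j = s.lcaFrom (b + n) i j := by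
  induction t generalizing n b with
  | leaf x => cases n <;> simp [nodeAt] at h; subst h; simp
  | node l r ihl ihr =>
    cases n with
    | zero => simp [nodeAt] at h; subst h; simp
    | succ n =>
      simp only [nodeAt] at h
      split_ifs at h with hn
      · have := nodeAt_lt h
        rw [lcaFrom, if_pos (by push_cast at *; omega), ihl h (by push_cast at *; omega)
          (by push_cast at *; omega)]
        congr 1; push_cast; omega
      · have := nodeAt_lt h
        rw [lcaFrom, if_neg (by push_cast at *; omega), if_pos (by push_cast at *; omega),
          ihr h (by push_cast at *; omega) (by push_cast at *; omega)]
        congr 1; push_cast; omega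

theorem lca_eq_lcaFrom {u i j : ℤ} {t : VTree V} (h : T.idInv u = some t)
    (hi : T.Below u i) (hj : T.Below u j) : T.lca i j = t.lcaFrom u i j := by
  have hu := idInv_pos h
  have hi0 := hi.le
  have hj0 := hj.le
  obtain ⟨t1, h1, hi⟩ := hi
  rw [h] at h1; cases h1
  obtain ⟨t1, h1, hj⟩ := hj
  rw [h] at h1; cases h1
  rw [idInv_eq hu] at h
  rw [lca, if_neg (by omega), if_neg (by omega), lcaFrom_nodeAt h (by omega) (by omega)]
  congr 1; omega

theorem lcaFrom_range (t : VTree V) {b i j : ℤ} (hi : b ≤ i ∧ i < b + t.size)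
    (hj : b ≤ j ∧ j < b + t.size) : ∃ (n : ℕ) (s : VTree V), t.nodeAt n = some s ∧
      t.lcaFrom b i j = b + n ∧ (b + n ≤ i ∧ i < b + n + s.size) ∧
        (b + n ≤ j ∧ j < b + n + s.size) := by
  induction t generalizing b with
  | leaf x => exact ⟨0, leaf x, rfl, by simp [lcaFrom], by simpa using hi, by simpa using hj⟩
  | node l r ihl ihr =>
    simp only [size] at hi hj
    push_cast at hi hj
    rw [lcaFrom]
    split_ifs with h1 h2
    · obtain ⟨n, s, h3, h4, h5, h6⟩ := ihl (b := b + 1) (by omega) (by omega)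
      have := nodeAt_lt h3
      have := size_pos s
      refine ⟨n + 1, s, ?_, by rw [h4]; push_cast; omega, by push_cast; omega,
        by push_cast; omega⟩
      simp only [nodeAt]; rw [if_pos (by omega)]; exact h3
    · obtain ⟨n, s, h3, h4, h5, h6⟩ := ihr (b := b + 1 + l.size) (by omega) (by omega)
      refine ⟨n + l.size + 1, s, ?_, by rw [h4]; push_cast; omega, by push_cast; omega,
        by push_cast; omega⟩
      simp only [nodeAt]; rw [if_neg (by omega), ← h3]; congr 1; omega
    · exact ⟨0, node l r, rfl, by simp, by simp only [size]; push_cast; omega,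
        by simp only [size]; push_cast; omega⟩

theorem lca_spec {u i j : ℤ} (hi : T.Below u i) (hj : T.Below u j) :
    T.Below u (T.lca i j) ∧ T.Below (T.lca i j) i ∧ T.Below (T.lca i j) j := by
  have hi' := hi
  have hj' := hj
  obtain ⟨t, h, hi⟩ := hi
  obtain ⟨t1, h1, hj⟩ := hj
  rw [h] at h1; cases h1
  rw [lca_eq_lcaFrom h hi' hj']
  obtain ⟨n, s, h3, h4, h5, h6⟩ := lcaFrom_range t hi hj
  have := nodeAt_lt h3
  have := size_pos s
  have h7 : T.idInv (u + n) = some s := by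
    rw [← h3, idInv_add h (by omega) (by omega)]; simp
  rw [h4]
  exact ⟨⟨t, h, by omega, by omega⟩, ⟨s, h7, h5⟩, ⟨s, h7, h6⟩⟩

/-- Lowest common ancestors are compatible with isomorphisms of subtrees. -/
theorem Iso.lca {u u' i j : ℤ} (h : T.Iso u u') (hi : T.Below u (u + i))
    (hj : T.Below u (u + j)) : T.lca (u + i) (u + j) - u = T.lca (u' + i) (u' + j) - u' := by
  have hi' := h.below hi
  have hj' := h.below hj
  obtain ⟨t, t', h1, h2, h3⟩ := h
  rw [lca_eq_lcaFrom h1 hi hj, lca_eq_lcaFrom h2 hi' hj']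
  have e1 := lcaFrom_shape t u (u + i) (u + j) (u' - u)
  have e2 := lcaFrom_shape t' u' (u' + i) (u' + j) 0
  rw [← h3] at e2
  rw [show u + (u' - u) = u' + 0 by omega, show u + i + (u' - u) = u' + i + 0 by omega,
    show u + j + (u' - u) = u' + j + 0 by omega, e2] at e1
  omega

end VTree

end

/-! ### Structures and the functions that they represent -/

section

namespace Str

theorem sizeOf_prime_lt {c : ℕ} {l : List (Elem Str)} {x : Elem Str} (h : x ∈ l) :
    sizeOf x.prime < sizeOf (dec c l) := by
  have h := List.sizeOf_lt_of_mem h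
  cases x
  simp at h ⊢
  omega

theorem sizeOf_sub_lt {c : ℕ} {l : List (Elem Str)} {x : Elem Str} (h : x ∈ l) :
    sizeOf x.sub < sizeOf (dec c l) := by
  have h := List.sizeOf_lt_of_mem h
  cases x
  simp at h ⊢
  omega

/-- Structural induction, with the induction hypothesis for all primes and subs. -/
theorem decInduction {P : Str → Prop} (term : ∀ α : Str, α.isTerm = true → P α)
    (dec : ∀ c l, (∀ x ∈ l, P x.prime ∧ P x.sub) → P (dec c l)) (α : Str) : P α := by
  induction hn : sizeOf α using Nat.strong_induction_on generalizing α with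
  | _ n ih =>
    subst hn
    cases α with
    | dec c l =>
      exact dec c l fun x hx =>
        ⟨ih _ (sizeOf_prime_lt hx) _ rfl, ih _ (sizeOf_sub_lt hx) _ rfl⟩
    | _ => exact term _ rfl

theorem decs_term {α : Str} (h : α.isTerm = true) : α.decs = [] := by
  cases α <;> first | (simp [isTerm] at h; done) | (unfold decs; rfl)

theorem nodes_term {α : Str} (h : α.isTerm = true) : α.nodes = ∅ := by
  simp [nodes, decs_term h]

theorem mem_nodes_dec {c : ℕ} {l : List (Elem Str)} {t : Str} :
    t ∈ (dec c l).nodes ↔ t = dec c l ∨ ∃ x ∈ l, t ∈ x.prime.nodes ∨ t ∈ x.sub.nodes := by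
  simp only [nodes, List.mem_toFinset]
  rw [decs]
  simp [List.mem_flatMap]

theorem mem_nodes_self {c : ℕ} {l : List (Elem Str)} : dec c l ∈ (dec c l).nodes :=
  mem_nodes_dec.2 (Or.inl rfl)

theorem isTerm_eq_false_iff {α : Str} : α.isTerm = false ↔ ∃ c l, α = dec c l := by
  cases α <;> simp [isTerm]

theorem isTerm_of_isConst {α : Str} (h : α.isConst = true) : α.isTerm = true := by
  cases α <;> simp_all [isTerm, isConst]

theorem nodes_isTerm {α t : Str} (h : t ∈ α.nodes) : ∃ c l, t = dec c l := by
  induction α using decInduction with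
  | term α hα => simp [nodes_term hα] at h
  | dec c l ih =>
    rcases mem_nodes_dec.1 h with rfl | ⟨x, hx, h | h⟩
    · exact ⟨c, l, rfl⟩
    · exact (ih x hx).1 h
    · exact (ih x hx).2 h

theorem nodes_prime_subset {c : ℕ} {l : List (Elem Str)} {x : Elem Str} (h : x ∈ l) :
    x.prime.nodes ⊆ (dec c l).nodes :=
  fun _ hs => mem_nodes_dec.2 (Or.inr ⟨x, h, Or.inl hs⟩)

theorem nodes_sub_subset {c : ℕ} {l : List (Elem Str)} {x : Elem Str} (h : x ∈ l) :
    x.sub.nodes ⊆ (dec c l).nodes :=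
  fun _ hs => mem_nodes_dec.2 (Or.inr ⟨x, h, Or.inr hs⟩)

/-- The result of the consistency test, as a pure function: a decomposition is consistent iff both
prime and sub of some element are. -/
def sat : Str → Bool
  | bot => false
  | top => true
  | pos => true
  | neg => true
  | dec _ l => l.attach.any fun ⟨x, _⟩ => sat x.prime && sat x.sub
termination_by s => sizeOf s
decreasing_by
  all_goals
    have h := List.sizeOf_lt_of_mem (by assumption)
    cases x
    simp at h ⊢
    omega

theorem sat_dec (c : ℕ) (l : List (Elem Str)) :
    sat (dec c l) = l.any fun x => sat x.prime && sat x.sub := by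
  rw [sat]
  rw [Bool.eq_iff_iff]
  simp [List.any_eq_true]

theorem Same.symm {s t : Str} (h : Same s t) : Same t s := by
  cases s <;> cases t <;> simp_all [Same]
  exact h.2.symm

theorem same_dec_iff {c : ℕ} {l : List (Elem Str)} {s : Str} :
    Same (dec c l) s ↔ ∃ l', s = dec c l' ∧ l.Perm l' := by
  cases s <;> simp [Same]
  exact fun _ => eq_comm

end Str

open Str VTree

section Semantics

variable {V : Type u} {T : VTree V}

theorem eval_dec (T : VTree V) (c : ℕ) (l : List (Elem Str)) (k : ℤ) (ρ : V → Bool) :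
    eval T (.dec c l) k ρ =
      l.any fun x => eval T x.prime (k + x.d) ρ && eval T x.sub (k + x.e) ρ := by
  rw [eval]
  rw [Bool.eq_iff_iff]
  simp [List.any_eq_true]

@[simp] theorem eval_top (T : VTree V) (k : ℤ) (ρ : V → Bool) : eval T .top k ρ = true := by
  rw [eval]

@[simp] theorem eval_bot (T : VTree V) (k : ℤ) (ρ : V → Bool) : eval T .bot k ρ = false := by
  rw [eval]

theorem eval_pos {k : ℤ} {x : V} (h : T.idInv k = some (.leaf x)) (ρ : V → Bool) :
    eval T .pos k ρ = ρ x := by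
  rw [eval, h]

theorem eval_neg {k : ℤ} {x : V} (h : T.idInv k = some (.leaf x)) (ρ : V → Bool) :
    eval T .neg k ρ = !ρ x := by
  rw [eval, h]

theorem eval_const {α : Str} (h : α.isConst = true) (k k' : ℤ) (ρ ρ' : V → Bool) :
    eval T α k ρ = eval T α k' ρ' := by
  cases α <;> simp_all [isConst]

theorem isVSSDD_const {α : Str} (h : α.isConst = true) (k : ℤ) : IsVSSDD T α k := by
  cases α
  case top => exact .top k
  case bot => exact .bot k
  all_goals simp [isConst] at h

theorem IsVSSDD.exists_idInv {α : Str} {k : ℤ} (h : IsVSSDD T α k) (hc : α.isConst = false) :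
    ∃ t, T.idInv k = some t := by
  cases h with
  | top => simp [isConst] at hc
  | bot => simp [isConst] at hc
  | pos h => exact ⟨_, h⟩
  | neg h => exact ⟨_, h⟩
  | dec h => exact ⟨_, h⟩

/-- A nonconstant terminal sits at a leaf. -/
theorem IsVSSDD.leaf {α : Str} {k : ℤ} (h : IsVSSDD T α k) (hc : α.isConst = false)
    (ht : α.isTerm = true) : ∃ x, T.idInv k = some (.leaf x) := by
  cases h with
  | top => simp [isConst] at hc
  | bot => simp [isConst] at hc
  | pos h => exact ⟨_, h⟩
  | neg h => exact ⟨_, h⟩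
  | dec h => simp [isTerm] at ht

/-- The assignments `ρ`, `ρ'` give corresponding values to the variables below the nodes with IDs
`k`, `k'`. -/
def Agree (T : VTree V) (k k' : ℤ) (ρ ρ' : V → Bool) : Prop :=
  ∀ j x x', T.Below k (k + j) → T.idInv (k + j) = some (.leaf x) →
    T.idInv (k' + j) = some (.leaf x') → ρ x = ρ' x'

theorem Agree.add {k k' j : ℤ} {ρ ρ' : V → Bool} (h : Agree T k k' ρ ρ')
    (hj : T.Below k (k + j)) : Agree T (k + j) (k' + j) ρ ρ' := by
  intro i x x' h1 h2 h3
  have h1 := hj.trans h1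
  rw [add_assoc] at h1 h2 h3
  exact h _ x x' h1 h2 h3

theorem exists_agree (hn : T.leaves.Nodup) {k k' : ℤ} (h : T.Iso k k') (ρ' : V → Bool) :
    ∃ ρ, Agree T k k' ρ ρ' := by
  obtain ⟨t, t', h1, h2, h3⟩ := h
  have hn' : t.leaves.Nodup := by
    rw [idInv_eq (idInv_pos h1)] at h1
    exact hn.sublist (leaves_subset_of_nodeAt h1)
  obtain ⟨ρ, hρ⟩ := VTree.exists_agree h3 hn' ρ'
  refine ⟨ρ, fun j x x' hj hx hx' => ?_⟩
  obtain ⟨s, hs, h4, h5⟩ := hj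
  rw [h1] at hs; cases hs
  rw [idInv_add h1 (by omega) (by omega)] at hx
  rw [idInv_add h2 (by omega) (by rw [← size_shape t', ← h3, size_shape]; omega)] at hx'
  exact hρ _ _ _ hx hx'

theorem Agree.symm {k k' : ℤ} (hi : T.Iso k k') {ρ ρ' : V → Bool} (h : Agree T k k' ρ ρ') :
    Agree T k' k ρ' ρ :=
  fun j x x' h1 h2 h3 => (h j x' x (hi.symm.below h1) h3 h2).symm

theorem exists_agree' (hn : T.leaves.Nodup) {k k' : ℤ} (h : T.Iso k k') (ρ : V → Bool) :
    ∃ ρ', Agree T k k' ρ ρ' := by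
  obtain ⟨ρ', h'⟩ := exists_agree hn h.symm ρ
  exact ⟨ρ', h'.symm h.symm⟩

theorem IsVSSDD.below_prime {k : ℤ} {l r : VTree V} (hk : T.idInv k = some (.node l r))
    {p : Str} {d : ℤ} (h : if p.isConst then d = 0 else k + 1 ≤ k + d ∧ k + d < k + 1 + l.size)
    (hc : p.isConst = false) : T.Below k (k + d) := by
  rw [if_neg (by simp [hc])] at h
  exact (below_left_self hk).trans ((below_left hk).2 h)

theorem IsVSSDD.below_sub {k : ℤ} {l r : VTree V} (hk : T.idInv k = some (.node l r))
    {p : Str} {d : ℤ} (h : if p.isConst then d = 0 else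
      k + 1 + l.size ≤ k + d ∧ k + d < k + 1 + l.size + r.size)
    (hc : p.isConst = false) : T.Below k (k + d) := by
  rw [if_neg (by simp [hc])] at h
  exact (below_right_self hk).trans ((below_right hk).2 h)

/-- Being a VS-SDD, and the function represented, are invariant under isomorphisms of vtree
nodes. -/
theorem IsVSSDD.transport (hn : T.leaves.Nodup) {α : Str} {k : ℤ} (h : IsVSSDD T α k) :
    ∀ {k' : ℤ}, T.Iso k k' → IsVSSDD T α k' ∧
      ∀ ρ ρ', Agree T k k' ρ ρ' → eval T α k ρ = eval T α k' ρ' := by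
  induction h with
  | top k => exact fun _ => ⟨.top _, by simp⟩
  | bot k => exact fun _ => ⟨.bot _, by simp⟩
  | pos h =>
    intro k' hi
    obtain ⟨x', h'⟩ := hi.leaf h
    refine ⟨.pos h', fun ρ ρ' ha => ?_⟩
    rw [eval_pos h, eval_pos h']
    exact ha 0 _ _ (by simpa using below_self h) (by simpa using h) (by simpa using h')
  | neg h =>
    intro k' hi
    obtain ⟨x', h'⟩ := hi.leaf h
    refine ⟨.neg h', fun ρ ρ' ha => ?_⟩
    rw [eval_neg h, eval_neg h']
    rw [ha 0 _ _ (by simpa using below_self h) (by simpa using h) (by simpa using h')]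
  | @dec k l r c els hk hc hp hs hpl hsr hdis hcov hne ihp ihs =>
    intro k' hi
    obtain ⟨l', r', hk', hl, hr⟩ := hi.node hk
    have P : ∀ x ∈ els, IsVSSDD T x.prime (k' + x.d) ∧ ∀ ρ ρ', Agree T k k' ρ ρ' →
        eval T x.prime (k + x.d) ρ = eval T x.prime (k' + x.d) ρ' := by
      intro x hx
      by_cases hx' : x.prime.isConst = true
      · exact ⟨isVSSDD_const hx' _, fun ρ ρ' _ => eval_const hx' _ _ _ _⟩
      · have hb := IsVSSDD.below_prime hk (hpl x hx) (by simpa using hx')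
        obtain ⟨h1, h2⟩ := ihp x hx (hi.add hb)
        exact ⟨h1, fun ρ ρ' ha => h2 ρ ρ' (ha.add hb)⟩
    have S : ∀ x ∈ els, IsVSSDD T x.sub (k' + x.e) ∧ ∀ ρ ρ', Agree T k k' ρ ρ' →
        eval T x.sub (k + x.e) ρ = eval T x.sub (k' + x.e) ρ' := by
      intro x hx
      by_cases hx' : x.sub.isConst = true
      · exact ⟨isVSSDD_const hx' _, fun ρ ρ' _ => eval_const hx' _ _ _ _⟩
      · have hb := IsVSSDD.below_sub hk (hsr x hx) (by simpa using hx')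
        obtain ⟨h1, h2⟩ := ihs x hx (hi.add hb)
        exact ⟨h1, fun ρ ρ' ha => h2 ρ ρ' (ha.add hb)⟩
    refine ⟨.dec hk' (hc.trans hi.cls_eq) (fun x hx => (P x hx).1) (fun x hx => (S x hx).1)
      (fun x hx => ?_) (fun x hx => ?_) ?_ (fun ρ' => ?_) (fun x hx => ?_), fun ρ ρ' ha => ?_⟩
    · have := hpl x hx
      split_ifs at this ⊢ <;> omega
    · have := hsr x hx
      split_ifs at this ⊢ <;> omega
    · refine hdis.imp_of_mem fun {x y} hx hy h ρ' => ?_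
      obtain ⟨ρ, ha⟩ := exists_agree hn hi ρ'
      rw [← (P x hx).2 ρ ρ' ha, ← (P y hy).2 ρ ρ' ha]
      exact h ρ
    · obtain ⟨ρ, ha⟩ := exists_agree hn hi ρ'
      obtain ⟨x, hx, h⟩ := hcov ρ
      exact ⟨x, hx, by rw [← (P x hx).2 ρ ρ' ha]; exact h⟩
    · obtain ⟨ρ, h⟩ := hne x hx
      obtain ⟨ρ', ha⟩ := exists_agree' hn hi ρ
      exact ⟨ρ', by rw [← (P x hx).2 ρ ρ' ha]; exact h⟩
    · rw [eval_dec, eval_dec, Bool.eq_iff_iff, List.any_eq_true, List.any_eq_true]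
      refine exists_congr fun x => and_congr_right fun hx => ?_
      rw [(P x hx).2 ρ ρ' ha, (S x hx).2 ρ ρ' ha]

/-- A VS-SDD at `k` depends only on the variables below `k`. -/
theorem IsVSSDD.eval_congr (hn : T.leaves.Nodup) {α : Str} {k : ℤ} {t : VTree V}
    (h : IsVSSDD T α k) (hk : T.idInv k = some t) {ρ ρ' : V → Bool}
    (hρ : ∀ x ∈ t.leaves, ρ x = ρ' x) : eval T α k ρ = eval T α k ρ' := by
  refine (h.transport hn (iso_refl hk)).2 ρ ρ' fun j x x' hb h1 h2 => ?_
  rw [h1] at h2; cases h2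
  obtain ⟨s, hs, h4, h5⟩ := hb
  rw [hk] at hs; cases hs
  rw [idInv_add hk (by omega) (by omega)] at h1
  exact hρ _ ((leaves_subset_of_nodeAt h1).subset (by simp [leaves]))

theorem IsVSSDD.eval_congr_below (hn : T.leaves.Nodup) {α : Str} {u k : ℤ} {t : VTree V}
    (h : IsVSSDD T α k) (hk : T.idInv u = some t) (hb : α.isConst = false → T.Below u k)
    {ρ ρ' : V → Bool} (hρ : ∀ x ∈ t.leaves, ρ x = ρ' x) : eval T α k ρ = eval T α k ρ' := by
  by_cases hc : α.isConst = true
  · exact eval_const hc _ _ _ _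
  · obtain ⟨s, hs⟩ := h.exists_idInv (by simpa using hc)
    refine h.eval_congr hn hs fun x hx => hρ x ?_
    obtain ⟨t', ht', h1, h2⟩ := hb (by simpa using hc)
    rw [hk] at ht'; cases ht'
    have := idInv_add hk (j := k - u) (by omega) (by omega)
    rw [show u + (k - u) = k by omega, hs] at this
    exact (leaves_subset_of_nodeAt this.symm).subset hx

/-- The consistency test is correct: primes and subs depend on disjoint sets of variables. -/
theorem IsVSSDD.sat_iff (hn : T.leaves.Nodup) {α : Str} {k : ℤ} (h : IsVSSDD T α k) :
    α.sat = true ↔ ∃ ρ, eval T α k ρ = true := by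
  classical
  induction h with
  | top k => simp [sat]
  | bot k => simp [sat]
  | pos h => simp only [sat, eval_pos h, true_iff]; exact ⟨fun _ => true, rfl⟩
  | neg h => simp only [sat, eval_neg h, true_iff]; exact ⟨fun _ => false, rfl⟩
  | @dec k l r c els hk hc hp hs hpl hsr hdis hcov hne ihp ihs =>
    have hnk : (node l r).leaves.Nodup := by
      have hk' := hk
      rw [idInv_eq (idInv_pos hk)] at hk'
      exact hn.sublist (leaves_subset_of_nodeAt hk')
    simp only [leaves, List.nodup_append] at hnk
    simp only [sat_dec, eval_dec, List.any_eq_true, Bool.and_eq_true]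
    constructor
    · rintro ⟨x, hx, h1, h2⟩
      obtain ⟨ρ1, h1⟩ := (ihp x hx).1 h1
      obtain ⟨ρ2, h2⟩ := (ihs x hx).1 h2
      -- The two assignments can be glued, since no variable occurs in both subtrees.
      refine ⟨fun v => if v ∈ l.leaves then ρ1 v else ρ2 v, x, hx, ?_, ?_⟩
      · rw [← h1]
        refine (hp x hx).eval_congr_below hn (idInv_left hk) (fun hc => ?_) fun v hv => by
          simp [hv]
        have := hpl x hx
        rw [if_neg (by simp [hc])] at this
        exact (below_left hk).2 this
      · rw [← h2]
        refine (hs x hx).eval_congr_below hn (idInv_right hk) (fun hc => ?_) fun v hv => by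
          rw [if_neg fun hv' => hnk.2.2 v hv' v hv rfl]
        have := hsr x hx
        rw [if_neg (by simp [hc])] at this
        exact (below_right hk).2 this
    · rintro ⟨ρ, x, hx, h1, h2⟩
      exact ⟨x, hx, (ihp x hx).2 ⟨ρ, h1⟩, (ihs x hx).2 ⟨ρ, h2⟩⟩

/-- Being normalized is invariant under isomorphisms of vtree nodes. -/
theorem Normalized.transport {α : Str} {k k' : ℤ} (h : Normalized T α k) (hv : IsVSSDD T α k)
    (hi : α.isConst = false → T.Iso k k') : Normalized T α k' := by
  induction h generalizing k' with
  | term k h => exact .term _ h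
  | @dec k c els hpl hsr hp hs ihp ihs =>
    specialize hi rfl
    cases hv with
    | @dec k l r _ _ hk hc vp vs vpl vsr =>
    obtain ⟨l', r', hk', hl, hr⟩ := hi.node hk
    refine .dec (fun x hx => ?_) (fun x hx => ?_) (fun x hx => ?_) (fun x hx => ?_)
    · exact (hpl x hx).imp_right fun h => by omega
    · refine (hsr x hx).imp_right fun h => ?_
      rw [rightId_eq hk] at h
      rw [rightId_eq hk']; omega
    · exact ihp x hx (vp x hx) fun hc => hi.add (IsVSSDD.below_prime hk (vpl x hx) hc)
    · exact ihs x hx (vs x hx) fun hc => hi.add (IsVSSDD.below_sub hk (vsr x hx) hc)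

theorem IsVSSDD.els_ne_nil {c : ℕ} {l : List (Elem Str)} {k : ℤ} (h : IsVSSDD T (.dec c l) k) :
    l ≠ [] := by
  cases h with
  | dec _ _ _ _ _ _ _ hcov =>
    rintro rfl
    obtain ⟨x, hx, _⟩ := hcov fun _ => true
    simp at hx

end Semantics

end

/-! ### Memory, potential, and the consistency test -/

section

open Str VTree

theorem bind_apply_of_eq {A B : Type} {x : Prog A} {f : A → Prog B} {m m' : Mem} {a : A}
    (h : x m = some (a, m')) : (x >>= f) m = f a m' := by
  change (x m).bind (fun p => f p.1 p.2) = _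
  rw [h]; rfl

/-- The memory after `n` more steps. -/
def Mem.wait (m : Mem) (n : ℕ) : Mem := { m with time := m.time + n }

theorem tick_apply (n : ℕ) (m : Mem) : tick n m = some ((), m.wait n) := rfl

/-- Keys of the two caches. -/
abbrev Key := ConvKey ⊕ NormKey

/-- The structure cached under a key. -/
def Mem.look (m : Mem) : Key → Option Str
  | .inl κ => m.conv κ
  | .inr κ => m.norm κ

/-- What the analysis of a run of `Apply` depends on: a finite set of keys that contains all keys
used, a bound `W` for the number of pairs of elements that are combined for a key, a rank that
decreases along recursive calls, and a property of the structures cached under a key. -/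
structure Ctx where
  keys : Finset Key
  W : Key → ℕ
  rank : Key → ℕ
  Good : Key → Str → Prop

/-- The steps that may still be charged to a key: while nothing is cached, the call for that key
is paid from it; later on, it pays for one consistency test of the cached node. For each pair of
elements a call makes `1 + 4 + 2 + 4` steps, adds at most one element to its result, which has to be
looked up in the unique table, and leaves `5` steps for the later consistency test of that element;
the factor `40` also covers the constant overhead. -/
def Ctx.charge (Γ : Ctx) (m : Mem) (κ : Key) : ℕ :=
  match m.look κ with
  | none => 40 * Γ.W κ
  | some s => if (m.cons s).isSome then 0 else 5 * (s.els.length + 1)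

/-- The potential of a memory state. -/
def Ctx.potential (Γ : Ctx) (m : Mem) : ℕ := ∑ κ ∈ Γ.keys, Γ.charge m κ

/-- All nodes of `s` are cached results. -/
def Known (m : Mem) (s : Str) : Prop := ∀ t ∈ s.nodes, ∃ κ, m.look κ = some t

/-- The invariant of the memory. By `known`, every node that a consistency test can reach from a
result has a key of its own that pays for testing it. -/
structure Inv (Γ : Ctx) (m : Mem) : Prop where
  reduced : Reduced m.uniq
  cons_eq : ∀ s b, m.cons s = some b → b = s.sat
  mem_keys : ∀ κ s, m.look κ = some s → κ ∈ Γ.keys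
  good : ∀ κ s, m.look κ = some s → Γ.Good κ s
  known : ∀ κ s, m.look κ = some s → Known m s
  mem_uniq : ∀ κ s, m.look κ = some s → s.isTerm = false → s ∈ m.uniq

/-- A part of a run: it ends in a state with the invariant, does not remove anything from the
unique table or the caches, does not touch keys of rank above `n`, and takes at most `c` steps in
addition to those that are paid for by the potential. The number `c` is negative for parts that
leave steps to spare. -/
structure Step (Γ : Ctx) (n : ℕ) (c : ℤ) (m m' : Mem) : Prop where
  inv : Inv Γ m'
  uniq : ∀ s ∈ m.uniq, s ∈ m'.uniq
  look : ∀ κ s, m.look κ = some s → m'.look κ = some s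
  frame : ∀ κ, n < Γ.rank κ → m'.look κ = m.look κ
  time : (m'.time : ℤ) + Γ.potential m' ≤ m.time + Γ.potential m + c

variable {Γ : Ctx} {n : ℕ} {m m' m'' : Mem}

theorem Step.trans {c c' : ℤ} (h : Step Γ n c m m') (h' : Step Γ n c' m' m'') :
    Step Γ n (c + c') m m'' where
  inv := h'.inv
  uniq s hs := h'.uniq s (h.uniq s hs)
  look κ s hs := h'.look κ s (h.look κ s hs)
  frame κ hκ := (h'.frame κ hκ).trans (h.frame κ hκ)
  time := by have := h.time; have := h'.time; omega

theorem Step.mono {n' : ℕ} {c c' : ℤ} (h : Step Γ n c m m') (hn : n ≤ n') (hc : c ≤ c') :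
    Step Γ n' c' m m' where
  inv := h.inv
  uniq := h.uniq
  look := h.look
  frame κ hκ := h.frame κ (by omega)
  time := by have := h.time; omega

theorem Known.step {c : ℤ} {s : Str} (h : Known m s) (h' : Step Γ n c m m') : Known m' s := by
  intro t ht
  obtain ⟨κ, hκ⟩ := h t ht
  exact ⟨κ, h'.look κ t hκ⟩

theorem known_term {s : Str} (h : s.isTerm = true) : Known m s := by
  intro t ht
  simp [nodes_term h] at ht

theorem Known.mem_uniq {s : Str} (h : Known m s) (hm : Inv Γ m) : ∀ t ∈ s.nodes, t ∈ m.uniq := by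
  intro t ht
  obtain ⟨κ, hκ⟩ := h t ht
  obtain ⟨c, l, rfl⟩ := nodes_isTerm ht
  exact hm.mem_uniq κ _ hκ rfl

theorem potential_congr (h1 : m'.look = m.look) (h2 : m'.cons = m.cons) :
    Γ.potential m' = Γ.potential m := by
  simp only [Ctx.potential, Ctx.charge, h1, h2]

theorem step_wait (h : Inv Γ m) (n c : ℕ) : Step Γ n c m (m.wait c) where
  inv := ⟨h.1, h.2, h.3, h.4, h.5, h.6⟩
  uniq _ hs := hs
  look _ _ hs := hs
  frame _ _ := rfl
  time := by
    rw [potential_congr (m' := m.wait c) (m := m) rfl rfl]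
    simp only [Mem.wait]; push_cast; omega

/-! #### The consistency test -/

/-- The memory after recording the consistency of `s`. -/
def Mem.setCons (m : Mem) (s : Str) (b : Bool) : Mem :=
  { m with time := m.time + 1, cons := Function.update m.cons s (some b) }

theorem consStore_apply (s : Str) (b : Bool) (m : Mem) :
    consStore s b m = some ((), m.setCons s b) := rfl

theorem consLookup_apply (s : Str) (m : Mem) :
    consLookup s m = some (m.cons s, m.wait 1) := rfl

theorem look_setCons (s : Str) (b : Bool) : (m.setCons s b).look = m.look := by
  funext κ; cases κ <;> rfl

theorem look_wait (k : ℕ) : (m.wait k).look = m.look := by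
  funext κ; cases κ <;> rfl

/-- Recording the consistency of a cached result releases potential. -/
theorem step_setCons (h : Inv Γ m) {s : Str} {κ : Key} (hκ : m.look κ = some s)
    (hs : m.cons s = none) (n : ℕ) :
    Step Γ n (1 - 5 * (s.els.length + 1)) m (m.setCons s s.sat) where
  inv := by
    refine ⟨h.1, fun t b ht => ?_, fun κ t ht => h.3 κ t (by rwa [look_setCons] at ht),
      fun κ t ht => h.4 κ t (by rwa [look_setCons] at ht), fun κ t ht t' ht' => ?_,
      fun κ t ht => h.6 κ t (by rwa [look_setCons] at ht)⟩
    · by_cases hts : t = s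
      · subst hts; simp [Mem.setCons] at ht; exact ht.symm
      · simp [Mem.setCons, Function.update_of_ne hts] at ht; exact h.2 t b ht
    · rw [look_setCons] at *; exact h.5 κ t ht t' ht'
  uniq _ hs := hs
  look _ _ hs := by rwa [look_setCons]
  frame _ _ := by rw [look_setCons]
  time := by
    classical
    have h1 : ∀ κ', Γ.charge (m.setCons s s.sat) κ' ≤ Γ.charge m κ' := by
      intro κ'
      simp only [Ctx.charge, look_setCons]
      cases hl : m.look κ' with
      | none => simp
      | some t =>
        by_cases hts : t = s
        · subst hts; simp [Mem.setCons]
        · simp [Mem.setCons, Function.update_of_ne hts]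
    have h2 : Γ.charge (m.setCons s s.sat) κ = 0 := by
      have hc : (m.setCons s s.sat).cons s = some s.sat := by simp [Mem.setCons]
      simp [Ctx.charge, look_setCons, hκ, hc]
    have h3 : Γ.charge m κ = 5 * (s.els.length + 1) := by
      simp [Ctx.charge, hκ, hs]
    have hmem := h.mem_keys κ s hκ
    have h4 := Finset.sum_le_sum fun κ' (_ : κ' ∈ Γ.keys.erase κ) => h1 κ'
    have h5 := Finset.add_sum_erase Γ.keys (Γ.charge m) hmem
    have h6 := Finset.add_sum_erase Γ.keys (Γ.charge (m.setCons s s.sat)) hmem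
    have h7 : (m.setCons s s.sat).time = m.time + 1 := rfl
    have h8 : Γ.potential (m.setCons s s.sat) + 5 * (s.els.length + 1) ≤ Γ.potential m := by
      simp only [Ctx.potential]; omega
    omega

/-- The amortized cost of a consistency test is constant. -/
theorem consistent_step (n : ℕ) (α : Str) : ∀ {m : Mem}, Inv Γ m → Known m α →
    ∃ m', consistent α m = some (α.sat, m') ∧ Step Γ n 2 m m' ∧
      ∀ t, sizeOf α < sizeOf t → m'.cons t = m.cons t := by
  induction α using decInduction with
  | term α hα =>
    intro m hm _
    refine ⟨m.wait 1, ?_, (step_wait hm n 1).mono le_rfl (by norm_num), fun _ _ => rfl⟩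
    rw [consistent.eq_def, bind_apply_of_eq (tick_apply 1 m)]
    cases α with
    | dec c l => simp [isTerm] at hα
    | _ => simp only [sat]; rfl
  | dec c l ih =>
    intro m hm hk
    rw [consistent.eq_def, bind_apply_of_eq (tick_apply 1 m)]
    simp only
    rw [bind_apply_of_eq (consLookup_apply _ _)]
    have hw : Step Γ n 2 m ((m.wait 1).wait 1) :=
      ((step_wait hm n 1).trans (step_wait (step_wait hm n 1).inv n 1)).mono le_rfl (by norm_num)
    cases hc : (m.wait 1).cons (dec c l) with
    | some b =>
      have := hm.cons_eq _ b hc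
      subst this
      exact ⟨_, rfl, hw, fun _ _ => rfl⟩
    | none =>
      -- The frame condition on sizes shows that the test of the elements does not record a value
      -- for the node itself, so that its potential is still there at the end.
      have key : ∀ (l' : List (Elem Str)), (∀ x ∈ l', x ∈ l) → ∀ {m1 : Mem}, Inv Γ m1 →
          Known m1 (dec c l) → ∃ m2, (l'.anyM fun x => (do
            tick 1
            if ← consistent x.prime then consistent x.sub else return false : Prog Bool)) m1 =
              some (l'.any fun x => x.prime.sat && x.sub.sat, m2) ∧
            Step Γ n (5 * l'.length) m1 m2 ∧
            ∀ t, sizeOf (dec c l) ≤ sizeOf t → m2.cons t = m1.cons t := by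
        intro l'
        induction l' with
        | nil => exact fun _ m1 h1 _ =>
            ⟨m1, rfl, (step_wait h1 n 0).mono le_rfl (by simp), fun _ _ => rfl⟩
        | cons x l' ihl =>
          intro hl' m1 h1 hk1
          have hx := hl' x (by simp)
          simp only [List.anyM]
          have s1 := step_wait h1 n 1
          have hkx : Known m1 x.prime := fun t ht => hk1 t (nodes_prime_subset hx ht)
          have hkx' : Known m1 x.sub := fun t ht => hk1 t (nodes_sub_subset hx ht)
          obtain ⟨m2, e2, s2, f2⟩ := (ih x hx).1 s1.inv (hkx.step s1)
          have step12 := s1.trans s2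
          have f2' := fun t (ht : sizeOf (dec c l) ≤ sizeOf t) =>
            f2 t ((sizeOf_prime_lt hx).trans_le ht)
          obtain ⟨m3, e3, s3, f3⟩ : ∃ m3, (do
              tick 1
              if ← consistent x.prime then consistent x.sub else return false : Prog Bool) m1 =
                some (x.prime.sat && x.sub.sat, m3) ∧ Step Γ n 5 m1 m3 ∧
                ∀ t, sizeOf (dec c l) ≤ sizeOf t → m3.cons t = m1.cons t := by
            rw [bind_apply_of_eq (tick_apply 1 m1), bind_apply_of_eq e2]
            cases hp : x.prime.sat with
            | false =>
              exact ⟨m2, rfl, step12.mono le_rfl (by norm_num), f2'⟩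
            | true =>
              obtain ⟨m3, e3, s3, f3⟩ := (ih x hx).2 s2.inv (hkx'.step step12)
              exact ⟨m3, by simpa using e3, (step12.trans s3).mono le_rfl (by norm_num),
                fun t ht => (f3 t ((sizeOf_sub_lt hx).trans_le ht)).trans (f2' t ht)⟩
          rw [bind_apply_of_eq e3]
          cases hb : (x.prime.sat && x.sub.sat) with
          | true =>
            exact ⟨m3, by simp [hb]; rfl, s3.mono le_rfl (by simp), f3⟩
          | false =>
            obtain ⟨m4, e4, s4, f4⟩ := ihl (fun y hy => hl' y (by simp [hy])) s3.inv (hk1.step s3)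
            refine ⟨m4, ?_, (s3.trans s4).mono le_rfl (by simp; omega),
              fun t ht => (f4 t ht).trans (f3 t ht)⟩
            simp only [List.any_cons, hb, Bool.false_or]
            exact e4
      obtain ⟨m2, e2, s2, f2⟩ := key l (fun _ h => h) hw.inv (hk.step hw)
      simp only
      rw [bind_apply_of_eq e2, bind_apply_of_eq (consStore_apply _ _ _)]
      obtain ⟨κ, hκ⟩ := (hk.step hw).step s2 _ mem_nodes_self
      have s3 := step_setCons s2.inv hκ ((f2 _ le_rfl).trans hc) n
      rw [sat_dec] at s3
      refine ⟨_, by rw [sat_dec]; rfl, ((hw.trans s2).trans s3).mono le_rfl ?_, fun t ht => ?_⟩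
      · simp only [els]; omega
      · have : t ≠ dec c l := by rintro rfl; exact lt_irrefl _ ht
        simp only [Mem.setCons, Function.update_of_ne this]
        exact f2 t ht.le

/-! #### The unique table and the caches -/

theorem uniqueNode_step (hm : Inv Γ m) (n c : ℕ) (γ : List (Elem Str)) :
    ∃ l m', uniqueNode c γ m = some (dec c l, m') ∧ γ.Perm l ∧ dec c l ∈ m'.uniq ∧
      Step Γ n (γ.length + 1) m m' ∧ m'.look = m.look := by
  have s1 := step_wait hm n (γ.length + 1)
  rw [uniqueNode, bind_apply_of_eq (tick_apply _ m)]
  change ∃ l m', (match m.uniq.find? fun s => decide (Str.Same (.dec c γ) s) with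
    | some s => (pure s : Prog Str)
    | none => do
      modify fun m : Mem => { m with uniq := .dec c γ :: m.uniq }
      return .dec c γ) (m.wait (γ.length + 1)) = _ ∧ _
  cases hf : m.uniq.find? fun s => decide (Str.Same (.dec c γ) s) with
  | some s =>
    have h1 := List.find?_some hf
    simp only [decide_eq_true_eq] at h1
    obtain ⟨l, rfl, hp⟩ := same_dec_iff.1 h1
    exact ⟨l, _, rfl, hp, List.mem_of_find?_eq_some hf, s1, look_wait _⟩
  | none =>
    rw [List.find?_eq_none] at hf
    simp only [decide_eq_true_eq] at hf
    refine ⟨γ, _, rfl, List.Perm.refl _, by simp, ?_,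
      look_wait (m := m) (γ.length + 1)⟩
    have h1 := s1.inv
    refine ⟨⟨?_, h1.2, h1.3, h1.4, h1.5, fun κ s h h' => ?_⟩, fun s hs => ?_, s1.look, s1.frame, ?_⟩
    · intro s hs t ht hst
      rcases List.mem_cons.1 hs with rfl | hs <;> rcases List.mem_cons.1 ht with rfl | ht
      · rfl
      · exact absurd hst (hf t ht)
      · exact absurd hst.symm (hf s hs)
      · exact h1.reduced s hs t ht hst
    · exact List.mem_cons_of_mem _ (h1.mem_uniq κ s h h')
    · exact List.mem_cons_of_mem _ hs
    · exact_mod_cast s1.time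

/-- Storing a result releases the potential of its key. -/
theorem step_store (hm : Inv Γ m) {κ : Key} {s : Str} (hκ : κ ∈ Γ.keys)
    (hnone : m.look κ = none) (hgood : Γ.Good κ s)
    (hknown : ∀ t ∈ s.nodes, t = s ∨ ∃ κ', m.look κ' = some t)
    (hs : s.isTerm = false → s ∈ m.uniq)
    (htime : m'.time = m.time + 1) (huniq : m'.uniq = m.uniq) (hcons : m'.cons = m.cons)
    (hlook : m'.look = Function.update m.look κ (some s)) (hn : Γ.rank κ ≤ n) :
    Step Γ n (1 + 5 * (s.els.length + 1) - 40 * Γ.W κ) m m' where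
  inv := by
    have hcase : ∀ κ' t, m'.look κ' = some t → (κ' = κ ∧ t = s) ∨ m.look κ' = some t := by
      intro κ' t h
      by_cases hk : κ' = κ
      · subst hk
        rw [hlook, Function.update_self] at h
        exact Or.inl ⟨rfl, (Option.some.inj h).symm⟩
      · rw [hlook, Function.update_of_ne hk] at h; exact Or.inr h
    have hmono : ∀ κ' t, m.look κ' = some t → m'.look κ' = some t := by
      intro κ' t h
      have hk : κ' ≠ κ := by rintro rfl; rw [hnone] at h; cases h
      rw [hlook, Function.update_of_ne hk]; exact h
    refine ⟨by rw [huniq]; exact hm.1, by rw [hcons]; exact hm.2, fun κ' t h => ?_,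
      fun κ' t h => ?_,
      fun κ' t h => ?_, fun κ' t h ht => ?_⟩
    · rcases hcase κ' t h with ⟨rfl, rfl⟩ | h
      exacts [hκ, hm.3 κ' t h]
    · rcases hcase κ' t h with ⟨rfl, rfl⟩ | h
      exacts [hgood, hm.4 κ' t h]
    · intro t' ht'
      rcases hcase κ' t h with ⟨rfl, rfl⟩ | h
      · rcases hknown t' ht' with rfl | ⟨κ'', h''⟩
        exacts [⟨_, h⟩, ⟨κ'', hmono _ _ h''⟩]
      · obtain ⟨κ'', h''⟩ := hm.5 κ' t h t' ht'
        exact ⟨κ'', hmono _ _ h''⟩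
    · rw [huniq]
      rcases hcase κ' t h with ⟨rfl, rfl⟩ | h
      exacts [hs ht, hm.6 κ' t h ht]
  uniq _ h := by rwa [huniq]
  look κ' t h := by
    have hk : κ' ≠ κ := by rintro rfl; rw [hnone] at h; cases h
    rw [hlook, Function.update_of_ne hk]; exact h
  frame κ' h := by
    have hk : κ' ≠ κ := by rintro rfl; omega
    rw [hlook, Function.update_of_ne hk]
  time := by
    classical
    have h1 : ∀ κ' ∈ Γ.keys.erase κ, Γ.charge m' κ' = Γ.charge m κ' := by
      intro κ' hk
      simp only [Ctx.charge, hcons, hlook, Function.update_of_ne (Finset.ne_of_mem_erase hk)]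
    have h2 : Γ.charge m' κ ≤ 5 * (s.els.length + 1) := by
      simp only [Ctx.charge, hcons, hlook, Function.update_self]
      split_ifs <;> omega
    have h3 : Γ.charge m κ = 40 * Γ.W κ := by
      simp only [Ctx.charge, hnone]
    have h4 : (Γ.keys.erase κ).sum (Γ.charge m') = (Γ.keys.erase κ).sum (Γ.charge m) :=
      Finset.sum_congr rfl h1
    have h5 : Γ.charge m κ + (Γ.keys.erase κ).sum (Γ.charge m) = Γ.potential m :=
      Finset.add_sum_erase Γ.keys (Γ.charge m) hκ
    have h6 : Γ.charge m' κ + (Γ.keys.erase κ).sum (Γ.charge m') = Γ.potential m' :=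
      Finset.add_sum_erase Γ.keys (Γ.charge m') hκ
    have h8 : Γ.potential m' + 40 * Γ.W κ ≤ Γ.potential m + 5 * (s.els.length + 1) := by
      omega
    omega

end

/-! ### The loop over all pairs of elements -/

section

open Str VTree

variable {V : Type u} {T : VTree V} {X Y : Type} {Γ : Ctx} {n : ℕ} {m m' : Mem}

/-- One round of the main loop of `Apply`: the primes are combined by `f`, and if the result is
consistent, the subs are combined by `g`; `off` gives the offsets of the new edges. -/
def pairStep (f g : X → Y → Prog (Str × ℤ)) (off : Str → ℤ → ℤ) (γ : List (Elem Str))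
    (x : X) (y : Y) : Prog (List (Elem Str)) := do
  tick 1
  let (p, lp) ← f x y
  if ← consistent p then
    let (s, ls) ← g x y
    return ⟨p, off p lp, s, off s ls⟩ :: γ
  else
    return γ

/-- The main loop of `Apply`, over all pairs of elements. -/
def pairLoop (xs : List X) (ys : List Y) (f g : X → Y → Prog (Str × ℤ)) (off : Str → ℤ → ℤ) :
    Prog (List (Elem Str)) :=
  xs.foldlM (fun γ x => do
    tick 1
    ys.foldlM (fun γ y => pairStep f g off γ x y) γ) []

/-- A recursive call: it runs within the amortized time of `4` steps, and its result satisfies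
`Q`. -/
def Call (Γ : Ctx) (n : ℕ) (f : Prog (Str × ℤ)) (Q : Str → ℤ → Prop) : Prop :=
  ∀ m, Inv Γ m → ∃ p lp m', f m = some ((p, lp), m') ∧ Step Γ n 4 m m' ∧ Known m' p ∧ Q p lp

/-- The functions `P x` are a partition, and `F` agrees with `S x` on the part `P x`; so `F` is
the disjunction of the functions `P x ∧ S x`. -/
structure PartRep (xs : List X) (P S : X → (V → Bool) → Bool) (F : (V → Bool) → Bool) : Prop where
  disj : xs.Pairwise fun x y => ∀ ρ, (P x ρ && P y ρ) = false
  cover : ∀ ρ, ∃ x ∈ xs, P x ρ = true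
  val : ∀ x ∈ xs, ∀ ρ, P x ρ = true → S x ρ = F ρ

/-- The elements `γ` collected from the pairs `qs`, where `PQ q` and `SQ q` are the functions of
the prime and the sub of the element obtained from the pair `q`. -/
structure Collected {Q : Type} (T : VTree V) (w : ℤ) (VP VS : Str → ℤ → Prop)
    (PQ SQ : Q → (V → Bool) → Bool) (qs : List Q) (γ : List (Elem Str)) : Prop where
  prime : ∀ z ∈ γ, VP z.prime z.d
  sub : ∀ z ∈ γ, VS z.sub z.e
  src : ∀ z ∈ γ, ∃ q ∈ qs, ∀ ρ, eval T z.prime (w + z.d) ρ = PQ q ρ ∧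
    eval T z.sub (w + z.e) ρ = SQ q ρ
  hit : ∀ q ∈ qs, ∀ ρ, PQ q ρ = true → ∃ z ∈ γ, eval T z.prime (w + z.d) ρ = true
  disj : γ.Pairwise fun x y => ∀ ρ,
    (eval T x.prime (w + x.d) ρ && eval T y.prime (w + y.d) ρ) = false
  ne_false : ∀ z ∈ γ, ∃ ρ, eval T z.prime (w + z.d) ρ = true
  length : γ.length ≤ qs.length

theorem pairStep_spec (hn : T.leaves.Nodup) {w : ℤ} {VP VS : Str → ℤ → Prop}
    (hVP : ∀ p d, VP p d → IsVSSDD T p (w + d))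
    {PQ SQ : X × Y → (V → Bool) → Bool} {f g : X → Y → Prog (Str × ℤ)} {off : Str → ℤ → ℤ}
    {x : X} {y : Y}
    (hf : Call Γ n (f x y) fun p lp => VP p (off p lp) ∧
      ∀ ρ, eval T p (w + off p lp) ρ = PQ (x, y) ρ)
    (hg : Call Γ n (g x y) fun p lp => VS p (off p lp) ∧
      ∀ ρ, eval T p (w + off p lp) ρ = SQ (x, y) ρ)
    {qs : List (X × Y)} (hdisj : ∀ q ∈ qs, ∀ ρ, (PQ q ρ && PQ (x, y) ρ) = false)
    {γ : List (Elem Str)} (hγ : Collected T w VP VS PQ SQ qs γ) (hm : Inv Γ m)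
    (hk : ∀ z ∈ γ, Known m z.prime ∧ Known m z.sub) :
    ∃ γ' m', pairStep f g off γ x y m = some (γ', m') ∧ Step Γ n 11 m m' ∧
      (∀ z ∈ γ', Known m' z.prime ∧ Known m' z.sub) ∧
      Collected T w VP VS PQ SQ (qs ++ [(x, y)]) γ' := by
  have s1 := step_wait hm n 1
  obtain ⟨p, lp, m2, e2, s2, k2, v2, h2⟩ := hf _ s1.inv
  obtain ⟨m3, e3, s3, -⟩ := consistent_step n p s2.inv k2
  have s123 := (s1.trans s2).trans s3
  have hsat := (hVP _ _ v2).sat_iff hn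
  rw [pairStep, bind_apply_of_eq (tick_apply 1 m), bind_apply_of_eq e2]
  simp only
  rw [bind_apply_of_eq e3]
  cases hp : p.sat with
  | false =>
    have hzero : ∀ ρ, PQ (x, y) ρ = false := fun ρ => by
      rw [← h2]
      by_contra h
      rw [hsat.2 ⟨ρ, by simpa using h⟩] at hp
      cases hp
    refine ⟨γ, m3, rfl, s123.mono le_rfl (by norm_num),
      fun z hz => ⟨(hk z hz).1.step s123, (hk z hz).2.step s123⟩, hγ.prime, hγ.sub,
      fun z hz => ?_, fun q hq ρ hρ => ?_, hγ.disj, hγ.ne_false, ?_⟩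
    · obtain ⟨q, hq, h⟩ := hγ.src z hz
      exact ⟨q, by simp [hq], h⟩
    · rcases List.mem_append.1 hq with hq | hq
      · exact hγ.hit q hq ρ hρ
      · simp only [List.mem_singleton] at hq
        subst hq; rw [hzero] at hρ; cases hρ
    · have := hγ.length; simp; omega
  | true =>
    obtain ⟨s, ls, m4, e4, s4, k4, v4, h4⟩ := hg _ s3.inv
    have s1234 := s123.trans s4
    simp only [if_true]
    rw [bind_apply_of_eq e4]
    refine ⟨⟨p, off p lp, s, off s ls⟩ :: γ, m4, rfl, s1234.mono le_rfl (by norm_num),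
      fun z hz => ?_, fun z hz => ?_, fun z hz => ?_,
      fun z hz => ?_, fun q hq ρ hρ => ?_, List.pairwise_cons.2 ⟨fun z hz ρ => ?_, hγ.disj⟩,
      fun z hz => ?_, ?_⟩
    · rcases List.mem_cons.1 hz with rfl | hz
      · exact ⟨k2.step (s3.trans s4), k4⟩
      · exact ⟨(hk z hz).1.step s1234, (hk z hz).2.step s1234⟩
    · rcases List.mem_cons.1 hz with rfl | hz
      exacts [v2, hγ.prime z hz]
    · rcases List.mem_cons.1 hz with rfl | hz
      exacts [v4, hγ.sub z hz]
    · rcases List.mem_cons.1 hz with rfl | hz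
      · exact ⟨(x, y), by simp, fun ρ => ⟨h2 ρ, h4 ρ⟩⟩
      · obtain ⟨q, hq, h⟩ := hγ.src z hz
        exact ⟨q, by simp [hq], h⟩
    · rcases List.mem_append.1 hq with hq | hq
      · obtain ⟨z, hz, h⟩ := hγ.hit q hq ρ hρ
        exact ⟨z, by simp [hz], h⟩
      · simp only [List.mem_singleton] at hq
        subst hq
        exact ⟨_, List.mem_cons_self, by rw [← hρ]; exact h2 ρ⟩
    · obtain ⟨q, hq, h⟩ := hγ.src z hz
      simp only
      rw [h2, (h ρ).1, Bool.and_comm]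
      exact hdisj q hq ρ
    · rcases List.mem_cons.1 hz with rfl | hz
      · exact hsat.1 hp
      · exact hγ.ne_false z hz
    · have := hγ.length; simp; omega

theorem pairLoop_inner (hn : T.leaves.Nodup) {w : ℤ} {VP VS : Str → ℤ → Prop}
    (hVP : ∀ p d, VP p d → IsVSSDD T p (w + d))
    {PQ SQ : X × Y → (V → Bool) → Bool} {f g : X → Y → Prog (Str × ℤ)} {off : Str → ℤ → ℤ}
    {x : X} {ys : List Y}
    (hf : ∀ y ∈ ys, Call Γ n (f x y) fun p lp => VP p (off p lp) ∧
      ∀ ρ, eval T p (w + off p lp) ρ = PQ (x, y) ρ)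
    (hg : ∀ y ∈ ys, Call Γ n (g x y) fun p lp => VS p (off p lp) ∧
      ∀ ρ, eval T p (w + off p lp) ρ = SQ (x, y) ρ)
    {qs : List (X × Y)}
    (hdisj : (qs ++ ys.map fun y => (x, y)).Pairwise fun q q' => ∀ ρ, (PQ q ρ && PQ q' ρ) = false)
    {γ : List (Elem Str)} (hγ : Collected T w VP VS PQ SQ qs γ) (hm : Inv Γ m)
    (hk : ∀ z ∈ γ, Known m z.prime ∧ Known m z.sub) :
    ∃ γ' m', ys.foldlM (fun γ y => pairStep f g off γ x y) γ m = some (γ', m') ∧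
      Step Γ n (11 * ys.length) m m' ∧
      (∀ z ∈ γ', Known m' z.prime ∧ Known m' z.sub) ∧
      Collected T w VP VS PQ SQ (qs ++ ys.map fun y => (x, y)) γ' := by
  induction ys generalizing qs γ m with
  | nil => exact ⟨γ, m, rfl, (step_wait hm n 0).mono le_rfl (by simp), hk, by simpa using hγ⟩
  | cons y ys ih =>
    obtain ⟨γ1, m1, e1, s1, k1, h1⟩ := pairStep_spec hn hVP (hf y (by simp)) (hg y (by simp))
      (fun q hq => (List.pairwise_append.1 hdisj).2.2 q hq _ (by simp)) hγ hm hk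
    obtain ⟨γ2, m2, e2, s2, k2, h2⟩ := ih (fun y hy => hf y (by simp [hy]))
      (fun y hy => hg y (by simp [hy])) (by simpa using hdisj) h1 s1.inv k1
    refine ⟨γ2, m2, ?_, (s1.trans s2).mono le_rfl (by simp; omega), k2, by simpa using h2⟩
    rw [List.foldlM_cons, bind_apply_of_eq e1, e2]

theorem pairLoop_outer (hn : T.leaves.Nodup) {w : ℤ} {VP VS : Str → ℤ → Prop}
    (hVP : ∀ p d, VP p d → IsVSSDD T p (w + d))
    {PQ SQ : X × Y → (V → Bool) → Bool} {f g : X → Y → Prog (Str × ℤ)} {off : Str → ℤ → ℤ}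
    {xs : List X} {ys : List Y}
    (hf : ∀ x ∈ xs, ∀ y ∈ ys, Call Γ n (f x y) fun p lp => VP p (off p lp) ∧
      ∀ ρ, eval T p (w + off p lp) ρ = PQ (x, y) ρ)
    (hg : ∀ x ∈ xs, ∀ y ∈ ys, Call Γ n (g x y) fun p lp => VS p (off p lp) ∧
      ∀ ρ, eval T p (w + off p lp) ρ = SQ (x, y) ρ)
    {qs : List (X × Y)}
    (hdisj : (qs ++ xs.product ys).Pairwise fun q q' => ∀ ρ, (PQ q ρ && PQ q' ρ) = false)
    {γ : List (Elem Str)} (hγ : Collected T w VP VS PQ SQ qs γ) (hm : Inv Γ m)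
    (hk : ∀ z ∈ γ, Known m z.prime ∧ Known m z.sub) :
    ∃ γ' m', (xs.foldlM (fun γ x => do
        tick 1
        ys.foldlM (fun γ y => pairStep f g off γ x y) γ) γ : Prog (List (Elem Str))) m =
          some (γ', m') ∧
      Step Γ n (xs.length * (1 + 11 * ys.length)) m m' ∧
      (∀ z ∈ γ', Known m' z.prime ∧ Known m' z.sub) ∧
      Collected T w VP VS PQ SQ (qs ++ xs.product ys) γ' := by
  induction xs generalizing qs γ m with
  | nil => exact ⟨γ, m, rfl, (step_wait hm n 0).mono le_rfl (by simp), hk,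
      by simpa [List.product] using hγ⟩
  | cons x xs ih =>
    have hprod : (x :: xs).product ys = (ys.map fun y => (x, y)) ++ xs.product ys := by
      simp [List.product]
    rw [hprod, ← List.append_assoc] at hdisj ⊢
    have s0 := step_wait hm n 1
    obtain ⟨γ1, m1, e1, s1, k1, h1⟩ := pairLoop_inner hn hVP (hf x (by simp)) (hg x (by simp))
      (List.pairwise_append.1 hdisj).1 hγ s0.inv
      fun z hz => ⟨(hk z hz).1.step s0, (hk z hz).2.step s0⟩
    obtain ⟨γ2, m2, e2, s2, k2, h2⟩ := ih (fun x hx => hf x (by simp [hx]))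
      (fun x hx => hg x (by simp [hx])) hdisj h1 s1.inv k1
    refine ⟨γ2, m2, ?_, ((s0.trans s1).trans s2).mono le_rfl ?_, k2, h2⟩
    · have e01 : (do
          tick 1
          ys.foldlM (fun γ y => pairStep f g off γ x y) γ : Prog _) m = some (γ1, m1) := by
        rw [bind_apply_of_eq (tick_apply 1 m), e1]
      rw [List.foldlM_cons, bind_apply_of_eq e01, e2]
    · simp only [List.length_cons]; push_cast; linarith

theorem pairwise_product {P : X → (V → Bool) → Bool} {P' : Y → (V → Bool) → Bool}
    {xs : List X} {ys : List Y}
    (hx : xs.Pairwise fun x y => ∀ ρ, (P x ρ && P y ρ) = false)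
    (hy : ys.Pairwise fun x y => ∀ ρ, (P' x ρ && P' y ρ) = false) :
    (xs.product ys).Pairwise fun q q' => ∀ ρ,
      ((P q.1 ρ && P' q.2 ρ) && (P q'.1 ρ && P' q'.2 ρ)) = false := by
  induction xs with
  | nil => simp [List.product]
  | cons x xs ih =>
    have hprod : (x :: xs).product ys = (ys.map fun y => (x, y)) ++ xs.product ys := by
      simp [List.product]
    rw [hprod, List.pairwise_append]
    rw [List.pairwise_cons] at hx
    refine ⟨?_, ih hx.2, ?_⟩
    · rw [List.pairwise_map]
      refine hy.imp fun {a b} h ρ => ?_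
      have := h ρ
      simp only
      revert this
      cases P x ρ <;> cases P' a ρ <;> cases P' b ρ <;> simp
    · intro q hq q' hq' ρ
      obtain ⟨y, -, rfl⟩ := List.mem_map.1 hq
      have := hx.1 q'.1 (List.pair_mem_product.1 hq').1 ρ
      simp only
      revert this
      cases P x ρ <;> cases P' y ρ <;> cases P q'.1 ρ <;> simp

/-- The main loop of `Apply`: it needs a number of steps proportional to the number of pairs, and
the elements that it collects represent `F ∘ F'`. -/
theorem pairLoop_spec (hn : T.leaves.Nodup) {w : ℤ} {VP VS : Str → ℤ → Prop}
    (hVP : ∀ p d, VP p d → IsVSSDD T p (w + d)) {op : BoolOp}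
    {xs : List X} {ys : List Y} {P S : X → (V → Bool) → Bool} {P' S' : Y → (V → Bool) → Bool}
    {F F' : (V → Bool) → Bool} (hx : PartRep xs P S F) (hy : PartRep ys P' S' F')
    {f g : X → Y → Prog (Str × ℤ)} {off : Str → ℤ → ℤ}
    (hf : ∀ x ∈ xs, ∀ y ∈ ys, Call Γ n (f x y) fun p lp => VP p (off p lp) ∧
      ∀ ρ, eval T p (w + off p lp) ρ = (P x ρ && P' y ρ))
    (hg : ∀ x ∈ xs, ∀ y ∈ ys, Call Γ n (g x y) fun p lp => VS p (off p lp) ∧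
      ∀ ρ, eval T p (w + off p lp) ρ = op (S x ρ) (S' y ρ))
    (hm : Inv Γ m) :
    ∃ γ m', pairLoop xs ys f g off m = some (γ, m') ∧
      Step Γ n (xs.length * (1 + 11 * ys.length)) m m' ∧
      (∀ z ∈ γ, Known m' z.prime ∧ Known m' z.sub) ∧
      γ.length ≤ xs.length * ys.length ∧
      (∀ z ∈ γ, VP z.prime z.d ∧ VS z.sub z.e ∧
        ∃ ρ, eval T z.prime (w + z.d) ρ = true) ∧
      PartRep γ (fun z => eval T z.prime (w + z.d)) (fun z => eval T z.sub (w + z.e))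
        (fun ρ => op (F ρ) (F' ρ)) := by
  obtain ⟨γ, m', e, s, k, h⟩ := pairLoop_outer (T := T) (Γ := Γ) (n := n) (m := m) hn hVP
    (PQ := fun q ρ => P q.1 ρ && P' q.2 ρ) (SQ := fun q ρ => op (S q.1 ρ) (S' q.2 ρ))
    (xs := xs) (ys := ys) (f := f) (g := g) (off := off) (qs := []) (γ := []) hf hg
    (by simpa using pairwise_product hx.disj hy.disj)
    ⟨by simp, by simp, by simp, by simp, by simp, by simp, by simp⟩ hm (by simp)
  refine ⟨γ, m', e, s, k, ?_, fun z hz => ⟨h.prime z hz, h.sub z hz, h.ne_false z hz⟩, h.disj,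
    fun ρ => ?_, fun z hz ρ hρ => ?_⟩
  · have := h.length
    rw [List.nil_append] at this
    rwa [show (xs.product ys).length = xs.length * ys.length from List.length_product _ _] at this
  · obtain ⟨x, hx1, hx2⟩ := hx.cover ρ
    obtain ⟨y, hy1, hy2⟩ := hy.cover ρ
    exact h.hit (x, y) (by simpa using List.pair_mem_product.2 ⟨hx1, hy1⟩) ρ (by simp [hx2, hy2])
  · obtain ⟨q, hq, h1⟩ := h.src z hz
    rw [List.nil_append] at hq
    have hq' := List.pair_mem_product.1 (show (q.1, q.2) ∈ xs.product ys from hq)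
    have h2 := h1 ρ
    rw [hρ] at h2
    have h3 := h2.1.symm
    rw [Bool.and_eq_true] at h3
    rw [h2.2, hx.val _ hq'.1 ρ h3.1, hy.val _ hq'.2 ρ h3.2]

theorem PartRep.perm {xs ys : List X} {P S : X → (V → Bool) → Bool} {F : (V → Bool) → Bool}
    (h : PartRep xs P S F) (hp : xs.Perm ys) : PartRep ys P S F where
  disj := hp.pairwise h.disj fun {x y} h ρ => by rw [Bool.and_comm]; exact h ρ
  cover ρ := by
    obtain ⟨x, hx, h'⟩ := h.cover ρ
    exact ⟨x, hp.mem_iff.1 hx, h'⟩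
  val x hx := h.val x (hp.mem_iff.2 hx)

theorem PartRep.eval_dec {w : ℤ} {γ : List (Elem Str)} {F : (V → Bool) → Bool} (c : ℕ)
    (h : PartRep γ (fun z => eval T z.prime (w + z.d)) (fun z => eval T z.sub (w + z.e)) F)
    (ρ : V → Bool) : eval T (.dec c γ) w ρ = F ρ := by
  rw [VSSDD.eval_dec, Bool.eq_iff_iff, List.any_eq_true]
  constructor
  · rintro ⟨z, hz, h'⟩
    rw [Bool.and_eq_true] at h'
    rw [← h.val z hz ρ h'.1, h'.2]
  · intro h'
    obtain ⟨z, hz, hz'⟩ := h.cover ρ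
    have h3 := h.val z hz ρ hz'
    exact ⟨z, hz, by rw [hz', h3, h']; rfl⟩

/-- The elements of a decomposition form a partition that represents its function. -/
theorem IsVSSDD.partRep {c : ℕ} {els : List (Elem Str)} {k : ℤ} (h : IsVSSDD T (.dec c els) k) :
    PartRep els (fun z => eval T z.prime (k + z.d)) (fun z => eval T z.sub (k + z.e))
      (eval T (.dec c els) k) := by
  cases h with
  | dec hk hc hp hs hpl hsr hdis hcov hne =>
    refine ⟨hdis, hcov, fun x hx ρ hρ => ?_⟩
    rw [VSSDD.eval_dec, Bool.eq_iff_iff, List.any_eq_true]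
    constructor
    · exact fun h => ⟨x, hx, by simp [hρ, h]⟩
    · rintro ⟨y, hy, h'⟩
      rw [Bool.and_eq_true] at h'
      by_cases hxy : x = y
      · rw [hxy]; exact h'.2
      · have : (eval T x.prime (k + x.d) ρ && eval T y.prime (k + y.d) ρ) = false :=
          List.Pairwise.forall_of_forall_of_flip (R := fun x y => x ≠ y → ∀ ρ : V → Bool,
              (eval T x.prime (k + x.d) ρ && eval T y.prime (k + y.d) ρ) = false)
            (fun x _ h => absurd rfl h) (hdis.imp fun {a b} h (_ : a ≠ b) ρ => h ρ)
            (hdis.imp fun {a b} h (_ : b ≠ a) ρ => by rw [Bool.and_comm]; exact h ρ) hx hy hxy ρ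
        simp [hρ, h'.1] at this

/-- Elements that partition, placed below the two children of a node, make a decomposition. -/
theorem PartRep.isVSSDD {w : ℤ} {l r : VTree V} {γ : List (Elem Str)} {F : (V → Bool) → Bool}
    (h : PartRep γ (fun z => eval T z.prime (w + z.d)) (fun z => eval T z.sub (w + z.e)) F)
    (hw : T.idInv w = some (.node l r))
    (hp : ∀ z ∈ γ, IsVSSDD T z.prime (w + z.d) ∧ if z.prime.isConst then z.d = 0 else
        w + 1 ≤ w + z.d ∧ w + z.d < w + 1 + l.size)
    (hs : ∀ z ∈ γ, IsVSSDD T z.sub (w + z.e) ∧ if z.sub.isConst then z.e = 0 else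
        w + 1 + l.size ≤ w + z.e ∧ w + z.e < w + 1 + l.size + r.size)
    (hne : ∀ z ∈ γ, ∃ ρ, eval T z.prime (w + z.d) ρ = true) :
    IsVSSDD T (.dec (T.cls w) γ) w :=
  .dec hw rfl (fun z hz => (hp z hz).1) (fun z hz => (hs z hz).1) (fun z hz => (hp z hz).2)
    (fun z hz => (hs z hz).2) h.disj h.cover hne

theorem Call.mono {n' : ℕ} {f : Prog (Str × ℤ)} {Q Q' : Str → ℤ → Prop} (h : Call Γ n f Q)
    (hn : n ≤ n') (hQ : ∀ p lp, Q p lp → Q' p lp) : Call Γ n' f Q' := by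
  intro m hm
  obtain ⟨p, lp, m', h1, h2, h3, h4⟩ := h m hm
  exact ⟨p, lp, m', h1, h2.mono hn le_rfl, h3, hQ _ _ h4⟩

/-! #### Terminals -/

theorem eval_termVal {α : Str} {k : ℤ} {x : V} (h : T.idInv k = some (.leaf x))
    (hα : α.isTerm = true) (ρ : V → Bool) : eval T α k ρ = termVal α (ρ x) := by
  cases α with
  | top => simp [termVal]
  | bot => simp [termVal]
  | pos => simp [termVal, eval_pos h]
  | neg => simp [termVal, eval_neg h]
  | dec => simp [isTerm] at hα

theorem ofVals_isTerm (a b : Bool) : (ofVals a b).isTerm = true := by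
  cases a <;> cases b <;> rfl

theorem termVal_ofVals (a b c : Bool) : termVal (ofVals a b) c = if c then a else b := by
  cases a <;> cases b <;> cases c <;> rfl

theorem isVSSDD_term {α : Str} {k : ℤ} {x : V} (h : T.idInv k = some (.leaf x))
    (hα : α.isTerm = true) : IsVSSDD T α k := by
  cases α with
  | top => exact .top k
  | bot => exact .bot k
  | pos => exact .pos h
  | neg => exact .neg h
  | dec => simp [isTerm] at hα

theorem termOp_const {α β : Str} (op : BoolOp) (hα : α.isConst = true) (hβ : β.isConst = true) :
    (termOp op α β).isConst = true := by
  cases α <;> cases β <;> simp_all [isConst, termOp, termVal] <;>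
    (generalize op _ _ = b; cases b <;> rfl)

theorem termOp_spec {α β : Str} (op : BoolOp) {k : ℤ} (hα : α.isTerm = true)
    (hβ : β.isTerm = true) (vα : IsVSSDD T α k) (vβ : IsVSSDD T β k) :
    IsVSSDD T (termOp op α β) k ∧
      ∀ ρ, eval T (termOp op α β) k ρ = op (eval T α k ρ) (eval T β k ρ) := by
  by_cases hx : ∃ x, T.idInv k = some (.leaf x)
  · obtain ⟨x, hx⟩ := hx
    refine ⟨isVSSDD_term hx (ofVals_isTerm _ _), fun ρ => ?_⟩
    rw [eval_termVal hx hα, eval_termVal hx hβ, termOp, eval_termVal hx (ofVals_isTerm _ _),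
      termVal_ofVals]
    cases ρ x <;> rfl
  · have cα : α.isConst = true := by
      by_contra h
      exact hx (vα.leaf (by simpa using h) hα)
    have cβ : β.isConst = true := by
      by_contra h
      exact hx (vβ.leaf (by simpa using h) hβ)
    refine ⟨isVSSDD_const (termOp_const op cα cβ) k, fun ρ => ?_⟩
    cases α <;> cases β <;> simp_all [isConst, termOp, termVal] <;>
      (generalize op _ _ = b; cases b <;> simp [ofVals])

end

/-! ### The algorithm for normalized VS-SDDs -/

section

open Str VTree

variable {V : Type u} {T : VTree V} {m m' : Mem}

/-- The property of the structures in the cache of the algorithm for normalized VS-SDDs. The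
offset is not part of the key: by transport, it does not matter which one is used. -/
def NormGood (T : VTree V) (κ : NormKey) (s : Str) : Prop :=
  ∃ k, IsVSSDD T κ.α k ∧ IsVSSDD T κ.β k ∧ IsVSSDD T s k ∧ Normalized T s k ∧
    ∀ ρ, eval T s k ρ = κ.op (eval T κ.α k ρ) (eval T κ.β k ρ)

/-- The decomposition nodes of `α` and the two constants. -/
def nodesConst (α : Str) : Finset Str := insert .top (insert .bot α.nodes)

/-- The context for the algorithm for normalized VS-SDDs: its keys are made of nodes of the two
arguments, or constants, and its recursion is on the sizes of the structures as trees. -/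
noncomputable def normCtx (T : VTree V) (A B : Str) (op : BoolOp) : Ctx where
  keys := (nodesConst A ×ˢ nodesConst B ×ˢ ({op, and} : Finset BoolOp)).image
    fun q => .inr ⟨q.1, q.2.1, q.2.2⟩
  W
    | .inl _ => 0
    | .inr κ => max 1 κ.α.els.length * max 1 κ.β.els.length
  rank
    | .inl _ => 0
    | .inr κ => sizeOf κ.α + sizeOf κ.β
  Good
    | .inl _ => fun _ => False
    | .inr κ => NormGood T κ

theorem mem_nodesConst {A α : Str} (h : α.nodes ⊆ A.nodes)
    (h' : α.isConst = true ∨ α.isTerm = false) : α ∈ nodesConst A := by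
  rcases h' with h' | h'
  · cases α <;> simp_all [isConst, nodesConst]
  · obtain ⟨c, l, rfl⟩ := isTerm_eq_false_iff.1 h'
    simp [nodesConst, h mem_nodes_self]

/-- The properties of the elements of `Expand(α)` at the node with ID `k`. -/
structure NormElems (T : VTree V) (α : Str) (k : ℤ) (xs : List (Elem Str)) : Prop where
  part : PartRep xs (fun x => eval T x.prime (k + x.d)) (fun x => eval T x.sub (k + x.e))
    (eval T α k)
  prime : ∀ x ∈ xs, IsVSSDD T x.prime (k + x.d) ∧ Normalized T x.prime (k + x.d) ∧
    (x.prime.isConst = true ∨ k + x.d = k + 1)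
  sub : ∀ x ∈ xs, IsVSSDD T x.sub (k + x.e) ∧ Normalized T x.sub (k + x.e) ∧
    (x.sub.isConst = true ∨ k + x.e = T.rightId k)
  nodes_prime : ∀ x ∈ xs, x.prime.nodes ⊆ α.nodes
  nodes_sub : ∀ x ∈ xs, x.sub.nodes ⊆ α.nodes
  sizeOf_prime : ∀ x ∈ xs, sizeOf x.prime ≤ sizeOf α
  sizeOf_sub : ∀ x ∈ xs, sizeOf x.sub ≤ sizeOf α
  sizeOf_lt : α.isTerm = false → ∀ x ∈ xs, sizeOf x.prime < sizeOf α ∧ sizeOf x.sub < sizeOf α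
  length : xs.length ≤ max 1 α.els.length

theorem normElems_expandNorm {α : Str} {k : ℤ} (hv : IsVSSDD T α k) (hn : Normalized T α k)
    (h : α.isConst = true ∨ α.isTerm = false) : NormElems T α k (expandNorm α) := by
  rcases h with h | h
  · have ht := isTerm_of_isConst h
    have he : expandNorm α = [⟨.top, 0, α, 0⟩] := by cases α <;> simp_all [isConst, expandNorm]
    rw [he]
    refine ⟨⟨by simp, by simp, by simp⟩, ?_, ?_, ?_, ?_, ?_, ?_, ?_, by simp⟩ <;>
      simp only [List.mem_singleton, forall_eq]
    · exact ⟨.top _, .term _ rfl, Or.inl rfl⟩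
    · exact ⟨isVSSDD_const h _, .term _ ht, Or.inl h⟩
    · rw [nodes_term rfl]; exact Finset.empty_subset _
    · exact subset_rfl
    · cases α <;> simp_all [isConst]
    · exact le_rfl
    · rw [ht]; simp
  · obtain ⟨c, l, rfl⟩ := isTerm_eq_false_iff.1 h
    have hp := hv.partRep
    cases hn with
    | term _ h' => simp [isTerm] at h'
    | dec npl nsr np ns =>
    cases hv with
    | dec hk hc vp vs =>
    exact ⟨hp, fun x hx => ⟨vp x hx, np x hx, npl x hx⟩, fun x hx => ⟨vs x hx, ns x hx, nsr x hx⟩,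
      fun x hx => nodes_prime_subset hx, fun x hx => nodes_sub_subset hx,
      fun x hx => (sizeOf_prime_lt hx).le, fun x hx => (sizeOf_sub_lt hx).le,
      fun _ x hx => ⟨sizeOf_prime_lt hx, sizeOf_sub_lt hx⟩, le_max_right _ _⟩

/-- What a call for normalized VS-SDDs at `k` returns. -/
def NormResult (T : VTree V) (α β : Str) (k : ℤ) (op : BoolOp) (p : Str) (lp : ℤ) : Prop :=
  lp = k ∧ IsVSSDD T p k ∧ Normalized T p k ∧
    (∀ ρ, eval T p k ρ = op (eval T α k ρ) (eval T β k ρ)) ∧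
    (α.isConst = true → β.isConst = true → p.isConst = true)

theorem applyNormalized_eq (T : VTree V) (α β : Str) (k : ℤ) (op : BoolOp) :
    applyNormalized T α β k op = (do
      tick 1
      if α.isTerm && β.isTerm then
        return (termOp op α β, k)
      else
        match ← normLookup ⟨α, β, op⟩ with
        | some s => return (s, k)
        | none =>
          let γ ← pairLoop (expandNorm α) (expandNorm β)
            (fun x y => applyNormalized T x.prime y.prime
              (if x.prime.isConst then k + y.d else k + x.d) and)
            (fun x y => applyNormalized T x.sub y.sub
              (if x.sub.isConst then k + y.e else k + x.e) op)
            (fun p lp => edgeOffset p lp k)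
          let s ← uniqueD (← clsQuery T k) γ
          normStore ⟨α, β, op⟩ s
          return (s, k)) := by
  rw [applyNormalized.eq_def]
  rfl

/-- The common offset `t` of two primes (or subs), one of which may be a constant. -/
theorem common_offset {p q : Str} {k d d' t : ℤ} (hp : p.isConst = true ∨ k + d = t)
    (hq : q.isConst = true ∨ k + d' = t) {j : ℤ} (hj : j = if p.isConst then k + d' else k + d) :
    (p.isConst = true ∨ j = k + d) ∧ (q.isConst = true ∨ j = k + d') ∧
      ((p.isConst = true ∧ q.isConst = true) ∨ j = t) := by
  subst hj
  by_cases h1 : p.isConst = true <;> by_cases h2 : q.isConst = true <;> simp_all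

theorem eval_offset {p : Str} {j k : ℤ} (h : p.isConst = true ∨ j = k) (ρ : V → Bool) :
    eval T p j ρ = eval T p k ρ := by
  rcases h with h | rfl
  exacts [eval_const h _ _ _ _, rfl]

theorem IsVSSDD.offset {p : Str} {j k : ℤ} (hv : IsVSSDD T p k)
    (h : p.isConst = true ∨ j = k) : IsVSSDD T p j := by
  rcases h with h | rfl
  exacts [isVSSDD_const h _, hv]

theorem Normalized.offset {p : Str} {j k : ℤ} (hv : Normalized T p k)
    (h : p.isConst = true ∨ j = k) : Normalized T p j := by
  rcases h with h | rfl
  exacts [.term _ (isTerm_of_isConst h), hv]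

/-- The edge to the result of a recursive call for two primes or two subs. -/
theorem NormResult.edge {p q s : Str} {k d d' t j ls : ℤ} {op : BoolOp}
    (hp : p.isConst = true ∨ k + d = t) (hq : q.isConst = true ∨ k + d' = t)
    (hj : j = if p.isConst then k + d' else k + d) (h : NormResult T p q j op s ls) :
    (IsVSSDD T s (k + edgeOffset s ls k) ∧ Normalized T s (k + edgeOffset s ls k) ∧
      if s.isConst then edgeOffset s ls k = 0 else k + edgeOffset s ls k = t) ∧
    ∀ ρ, eval T s (k + edgeOffset s ls k) ρ =
      op (eval T p (k + d) ρ) (eval T q (k + d') ρ) := by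
  obtain ⟨h1, h2, h3⟩ := common_offset hp hq hj
  obtain ⟨rfl, r1, r2, r3, r4⟩ := h
  have hoff : s.isConst = true ∨ k + edgeOffset s ls k = ls := by
    by_cases hs : s.isConst = true
    · exact Or.inl hs
    · right; rw [edgeOffset, if_neg hs]; omega
  refine ⟨⟨r1.offset hoff, r2.offset hoff, ?_⟩, fun ρ => ?_⟩
  · split_ifs with hs
    · rw [edgeOffset, if_pos hs]
    · rcases h3 with h3 | h3
      · exact absurd (r4 h3.1 h3.2) hs
      · rw [← h3]; exact hoff.resolve_left hs
  · rw [eval_offset hoff, r3, eval_offset h1, eval_offset h2]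

/-- `UniqueD` returns a node, or a constant, that represents the function of the elements. -/
theorem uniqueD_step {Γ : Ctx} (hm : Inv Γ m) (n : ℕ) {k : ℤ} {l r : VTree V}
    (hk : T.idInv k = some (.node l r)) {γ : List (Elem Str)} {F : (V → Bool) → Bool}
    (h : PartRep γ (fun z => eval T z.prime (k + z.d)) (fun z => eval T z.sub (k + z.e)) F)
    (hp : ∀ z ∈ γ, IsVSSDD T z.prime (k + z.d) ∧ Normalized T z.prime (k + z.d) ∧
      if z.prime.isConst then z.d = 0 else k + z.d = k + 1)
    (hs : ∀ z ∈ γ, IsVSSDD T z.sub (k + z.e) ∧ Normalized T z.sub (k + z.e) ∧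
      if z.sub.isConst then z.e = 0 else k + z.e = T.rightId k)
    (hne : ∀ z ∈ γ, ∃ ρ, eval T z.prime (k + z.d) ρ = true)
    (hknown : ∀ z ∈ γ, Known m z.prime ∧ Known m z.sub) :
    ∃ s m', uniqueD (T.cls k) γ m = some (s, m') ∧ Step Γ n (γ.length + 2) m m' ∧
      m'.look = m.look ∧ (s.isTerm = false → s ∈ m'.uniq) ∧
      (∀ t ∈ s.nodes, t = s ∨ ∃ κ', m'.look κ' = some t) ∧ s.els.length ≤ γ.length ∧
      IsVSSDD T s k ∧ Normalized T s k ∧ ∀ ρ, eval T s k ρ = F ρ := by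
  have s1 := step_wait hm n 1
  rw [uniqueD.eq_def, bind_apply_of_eq (tick_apply 1 m)]
  have hterm : ∀ s : Str, s.isConst = true → (∀ ρ, eval T s k ρ = F ρ) →
      ∃ s' m', (pure s : Prog Str) (m.wait 1) = some (s', m') ∧ Step Γ n (γ.length + 2) m m' ∧
      m'.look = m.look ∧ (s'.isTerm = false → s' ∈ m'.uniq) ∧
      (∀ t ∈ s'.nodes, t = s' ∨ ∃ κ', m'.look κ' = some t) ∧ s'.els.length ≤ γ.length ∧
      IsVSSDD T s' k ∧ Normalized T s' k ∧ ∀ ρ, eval T s' k ρ = F ρ := by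
    intro s hs hF
    have ht := isTerm_of_isConst hs
    refine ⟨s, _, rfl, s1.mono le_rfl (by push_cast; omega), look_wait 1, by simp [ht], ?_, ?_,
      isVSSDD_const hs k, .term k ht, hF⟩
    · simp [nodes_term ht]
    · cases s <;> simp_all [isConst, els]
  split
  · refine hterm .top rfl fun ρ => ?_
    rw [← h.eval_dec 0, eval_dec]; simp
  · refine hterm .bot rfl fun ρ => ?_
    rw [← h.eval_dec 0, eval_dec]; simp
  · obtain ⟨γ', m', e, hperm, hmem, s2, hl⟩ := uniqueNode_step s1.inv n (T.cls k) γ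
    have h' := h.perm hperm
    have hp' : ∀ z ∈ γ', _ := fun z hz => hp z (hperm.mem_iff.2 hz)
    have hs' : ∀ z ∈ γ', _ := fun z hz => hs z (hperm.mem_iff.2 hz)
    refine ⟨_, m', e, (s1.trans s2).mono le_rfl (by push_cast; omega), by rw [hl, look_wait],
      fun _ => hmem, fun t ht => ?_, hperm.length_eq.ge,
      h'.isVSSDD hk (fun z hz => ⟨(hp' z hz).1, ?_⟩) (fun z hz => ⟨(hs' z hz).1, ?_⟩)
        (fun z hz => hne z (hperm.mem_iff.2 hz)),
      .dec (fun z hz => ?_) (fun z hz => ?_) (fun z hz => (hp' z hz).2.1)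
        (fun z hz => (hs' z hz).2.1), h'.eval_dec _⟩
    · rcases mem_nodes_dec.1 ht with rfl | ⟨z, hz, ht⟩
      · exact Or.inl rfl
      · right
        rw [hl, look_wait]
        have := hknown z (hperm.mem_iff.2 hz)
        exact ht.elim (this.1 t) (this.2 t)
    · have := (hp' z hz).2.2
      have := size_pos l
      split_ifs at * <;> omega
    · have := (hs' z hz).2.2
      have := size_pos r
      rw [rightId_eq hk] at *
      split_ifs at * <;> omega
    · have := (hp' z hz).2.2
      by_cases hc : z.prime.isConst = true
      · exact Or.inl hc
      · rw [if_neg hc] at this; exact Or.inr this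
    · have := (hs' z hz).2.2
      by_cases hc : z.sub.isConst = true
      · exact Or.inl hc
      · rw [if_neg hc] at this; exact Or.inr this

/-- A cached result may be used at every offset at which the arguments may be used. -/
theorem NormGood.transport (hn : T.leaves.Nodup) {κ : NormKey} {s : Str} (h : NormGood T κ s)
    {k : ℤ} (vα : IsVSSDD T κ.α k) (vβ : IsVSSDD T κ.β k)
    (ht : κ.α.isTerm = false ∨ κ.β.isTerm = false) :
    IsVSSDD T s k ∧ Normalized T s k ∧
      ∀ ρ, eval T s k ρ = κ.op (eval T κ.α k ρ) (eval T κ.β k ρ) := by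
  obtain ⟨k', vα', vβ', vs, ns, hs⟩ := h
  have hi : T.Iso k' k := by
    have key : ∀ α : Str, α.isTerm = false → IsVSSDD T α k → IsVSSDD T α k' → T.Iso k' k := by
      intro α h v v'
      obtain ⟨c, l, rfl⟩ := isTerm_eq_false_iff.1 h
      cases v with
      | dec hk hc =>
        cases v' with
        | dec hk' hc' => exact iso_of_cls hk' hk (hc'.symm.trans hc)
    exact ht.elim (fun h => key _ h vα vα') (fun h => key _ h vβ vβ')
  obtain ⟨vs1, es⟩ := vs.transport hn hi
  refine ⟨vs1, ns.transport vs fun _ => hi, fun ρ => ?_⟩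
  obtain ⟨ρ', ha⟩ := exists_agree hn hi ρ
  rw [← es ρ' ρ ha, ← (vα'.transport hn hi).2 ρ' ρ ha, ← (vβ'.transport hn hi).2 ρ' ρ ha, hs]

/-- Every recursive call of the algorithm for normalized VS-SDDs terminates, returns a correct
result, and runs within constant amortized time. -/
theorem applyNormalized_call (hn : T.leaves.Nodup) (A B : Str) (op₀ : BoolOp) (N : ℕ) :
    ∀ (α β : Str) (k : ℤ) (op : BoolOp), sizeOf α + sizeOf β = N → op = op₀ ∨ op = and →
      α.nodes ⊆ A.nodes → β.nodes ⊆ B.nodes → IsVSSDD T α k → IsVSSDD T β k →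
      Normalized T α k → Normalized T β k →
      Call (normCtx T A B op₀) N (applyNormalized T α β k op) (NormResult T α β k op) := by
  induction N using Nat.strong_induction_on with
  | _ N ih =>
  intro α β k op hN hop hA hB vα vβ nα nβ m hm
  rw [applyNormalized_eq, bind_apply_of_eq (tick_apply 1 m)]
  have s1 := step_wait hm N 1
  by_cases ht : (α.isTerm && β.isTerm) = true
  · rw [if_pos ht]
    rw [Bool.and_eq_true] at ht
    obtain ⟨h1, h2⟩ := termOp_spec op ht.1 ht.2 vα vβ
    exact ⟨_, _, _, rfl, s1.mono le_rfl (by norm_num), known_term (ofVals_isTerm _ _), rfl, h1,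
      .term _ (ofVals_isTerm _ _), h2, termOp_const op⟩
  rw [if_neg ht]
  have s2 := s1.trans (step_wait s1.inv N 1)
  have ht' : α.isTerm = false ∨ β.isTerm = false := by
    revert ht; cases α.isTerm <;> cases β.isTerm <;> simp
  have hconst : α.isConst = true → β.isConst = true → False := fun h1 h2 => by
    simp [isTerm_of_isConst h1, isTerm_of_isConst h2] at ht
  rw [bind_apply_of_eq (show normLookup ⟨α, β, op⟩ (m.wait 1) =
    some (m.look (.inr ⟨α, β, op⟩), (m.wait 1).wait 1) from rfl)]
  cases hl : m.look (.inr ⟨α, β, op⟩) with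
  | some s =>
    obtain ⟨h1, h2, h3⟩ := NormGood.transport (T := T) hn (hm.good _ s hl) vα vβ ht'
    exact ⟨s, k, _, rfl, s2.mono le_rfl (by norm_num), (hm.known _ s hl).step s2, rfl, h1, h2, h3,
      fun h1 h2 => (hconst h1 h2).elim⟩
  | none =>
    obtain ⟨l, r, hk⟩ : ∃ l r, T.idInv k = some (.node l r) := by
      rcases ht' with h | h
      · obtain ⟨c, l, rfl⟩ := isTerm_eq_false_iff.1 h
        cases vα with | dec hk => exact ⟨_, _, hk⟩
      · obtain ⟨c, l, rfl⟩ := isTerm_eq_false_iff.1 h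
        cases vβ with | dec hk => exact ⟨_, _, hk⟩
    have hcd : ∀ α : Str, IsVSSDD T α k → α.isConst = true ∨ α.isTerm = false := by
      intro α v
      cases v with
      | top => exact Or.inl rfl
      | bot => exact Or.inl rfl
      | pos h => rw [hk] at h; cases h
      | neg h => rw [hk] at h; cases h
      | dec => exact Or.inr rfl
    have eα := normElems_expandNorm vα nα (hcd α vα)
    have eβ := normElems_expandNorm vβ nβ (hcd β vβ)
    have hlt : ∀ x ∈ expandNorm α, ∀ y ∈ expandNorm β,
        sizeOf x.prime + sizeOf y.prime < N ∧ sizeOf x.sub + sizeOf y.sub < N := by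
      intro x hx y hy
      have h1 := eα.sizeOf_prime x hx
      have h2 := eα.sizeOf_sub x hx
      have h3 := eβ.sizeOf_prime y hy
      have h4 := eβ.sizeOf_sub y hy
      rcases ht' with h | h
      · have := eα.sizeOf_lt h x hx; omega
      · have := eβ.sizeOf_lt h y hy; omega
    obtain ⟨γ, m3, e3, s3, k3, len3, v3, p3⟩ := pairLoop_spec (T := T) (n := N - 1) (w := k) hn
      (VP := fun p d => IsVSSDD T p (k + d) ∧ Normalized T p (k + d) ∧
        if p.isConst then d = 0 else k + d = k + 1)
      (VS := fun p d => IsVSSDD T p (k + d) ∧ Normalized T p (k + d) ∧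
        if p.isConst then d = 0 else k + d = T.rightId k)
      (fun p d h => h.1) (op := op) eα.part eβ.part
      (f := fun x y => applyNormalized T x.prime y.prime
              (if x.prime.isConst then k + y.d else k + x.d) and)
      (g := fun x y => applyNormalized T x.sub y.sub
              (if x.sub.isConst then k + y.e else k + x.e) op)
      (off := fun p lp => edgeOffset p lp k)
      (fun x hx y hy => by
        obtain ⟨x1, x2, x3⟩ := eα.prime x hx
        obtain ⟨y1, y2, y3⟩ := eβ.prime y hy
        obtain ⟨h1, h2, -⟩ := common_offset x3 y3 rfl
        have := (hlt x hx y hy).1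
        exact Call.mono (ih _ this x.prime y.prime _ and rfl (Or.inr rfl)
          ((eα.nodes_prime x hx).trans hA) ((eβ.nodes_prime y hy).trans hB) (x1.offset h1) (y1.offset h2)
          (x2.offset h1) (y2.offset h2)) (by omega) fun p lp h => h.edge x3 y3 rfl)
      (fun x hx y hy => by
        obtain ⟨x1, x2, x3⟩ := eα.sub x hx
        obtain ⟨y1, y2, y3⟩ := eβ.sub y hy
        obtain ⟨h1, h2, -⟩ := common_offset x3 y3 rfl
        have := (hlt x hx y hy).2
        exact Call.mono (ih _ this x.sub y.sub _ op rfl hop ((eα.nodes_sub x hx).trans hA)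
          ((eβ.nodes_sub y hy).trans hB) (x1.offset h1) (y1.offset h2)
          (x2.offset h1) (y2.offset h2)) (by omega) fun p lp h => h.edge x3 y3 rfl)
      s2.inv
    simp only
    rw [bind_apply_of_eq e3, bind_apply_of_eq (show clsQuery T k m3 =
      some (T.cls k, m3.wait 1) from rfl)]
    have s4 := step_wait s3.inv N 1
    obtain ⟨s, m5, e5, s5, l5, u5, k5, len5, v5, n5, f5⟩ := uniqueD_step s4.inv N hk p3
      (fun z hz => (v3 z hz).1) (fun z hz => (v3 z hz).2.1) (fun z hz => (v3 z hz).2.2)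
      (fun z hz => ⟨(k3 z hz).1.step s4, (k3 z hz).2.step s4⟩)
    rw [bind_apply_of_eq e5]
    set m6 : Mem := { m5 with
      time := m5.time + 1
      norm := Function.update m5.norm ⟨α, β, op⟩ (some s) } with hm6
    rw [bind_apply_of_eq (show normStore ⟨α, β, op⟩ s m5 = some ((), m6) from rfl)]
    -- The recursive calls only store results under keys of smaller rank.
    have hnone : m5.look (.inr ⟨α, β, op⟩) = none := by
      rw [l5, look_wait, s3.frame _ ?_, look_wait, look_wait, hl]
      simp only [normCtx]
      have : 0 < sizeOf α := by cases α <;> simp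
      omega
    have s6 := step_store (m' := m6) (n := N) s5.inv (κ := .inr ⟨α, β, op⟩) (s := s)
      (by
        simp only [normCtx, Finset.mem_image]
        have h1 := mem_nodesConst hA (hcd α vα)
        have h2 := mem_nodesConst hB (hcd β vβ)
        exact ⟨(α, β, op), by simpa [h1, h2] using hop, rfl⟩)
      hnone ⟨k, vα, vβ, v5, n5, f5⟩ k5 u5 rfl rfl rfl
      (by
        funext κ
        cases κ with
        | inl κ => rw [Function.update_of_ne (by simp)]; rfl
        | inr κ =>
          by_cases h : κ = ⟨α, β, op⟩
          · subst h; simp [hm6, Mem.look]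
          · rw [Function.update_of_ne (by simpa using h)]
            simp [hm6, Mem.look, Function.update_of_ne h])
      (by simp only [normCtx]; omega)
    refine ⟨s, k, m6, rfl, ((((s2.trans (s3.mono (by omega) le_rfl)).trans s4).trans s5).trans
      s6).mono le_rfl ?_, ?_, rfl, v5, n5, f5, fun h1 h2 => (hconst h1 h2).elim⟩
    · have h1 := eα.length
      have h2 := eβ.length
      simp only [normCtx]
      set a := max 1 α.els.length
      set b := max 1 β.els.length
      have ha : 1 ≤ a := le_max_left _ _
      have hb : 1 ≤ b := le_max_left _ _
      have h3 : (expandNorm α).length * (expandNorm β).length ≤ a * b := Nat.mul_le_mul h1 h2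
      have h4 : (expandNorm α).length ≤ a * b := h1.trans (Nat.le_mul_of_pos_right _ hb)
      have h5 : 1 ≤ a * b := Nat.one_le_iff_ne_zero.2 (by positivity)
      zify at *
      linarith
    · refine s6.inv.known (.inr ⟨α, β, op⟩) s ?_
      simp [hm6, Mem.look]

end

section

open Str VTree

variable {V : Type u} {T : VTree V} {m m' : Mem}

/-! ### The keys of the general algorithm -/

/-- Exchanges the two literals. -/
def flip : Str → Str
  | .pos => .neg
  | .neg => .pos
  | s => s

theorem flip_flip (α : Str) : flip (flip α) = α := by cases α <;> rfl

/-- The class of a decomposition node. -/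
def Str.nodeCls : Str → ℕ
  | .dec c _ => c
  | _ => 0

/-- A bound for the number of elements of an argument after it has been brought to a node that is
`e` above it: it has its own elements if `e = 0`, and at most two otherwise. -/
def lenAt (α : Str) (e : ℤ) : ℕ := if e = 0 then max 1 α.els.length else 2

/-- A triple `(α, c, d)` describes an occurrence of `α` at a distance `d` from a node of class `c`.
For an argument `A` with offset `k`, such triples come from the constants, the root, the nodes
(which are at distance `0` from themselves), and the edges. -/
def baseTokens (T : VTree V) (A : Str) (k : ℤ) : Finset (Str × ℕ × ℤ) :=
  insert (.top, 0, 0) (insert (.bot, 0, 0) (insert (A, T.cls 1, k - 1)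
    (A.nodes.biUnion fun s => insert (s, s.nodeCls, 0)
      ((s.els.map fun x => (x.prime, s.nodeCls, x.d)).toFinset ∪
        (s.els.map fun x => (x.sub, s.nodeCls, x.e)).toFinset))))

/-- The triples for `A`, closed under negation of literals. -/
def tokens (T : VTree V) (A : Str) (k : ℤ) : Finset (Str × ℕ × ℤ) :=
  baseTokens T A k ∪ (baseTokens T A k).image fun t => (flip t.1, t.2)

theorem flip_mem_tokens {A : Str} {k : ℤ} {t : Str × ℕ × ℤ} (h : t ∈ tokens T A k) :
    (flip t.1, t.2) ∈ tokens T A k := by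
  rcases Finset.mem_union.1 h with h | h
  · exact Finset.mem_union_right _ (Finset.mem_image_of_mem _ h)
  · obtain ⟨t', ht', rfl⟩ := Finset.mem_image.1 h
    refine Finset.mem_union_left _ ?_
    simpa [flip_flip] using ht'

theorem const_mem_tokens {A α : Str} {k : ℤ} (h : α.isConst = true) :
    (α, 0, 0) ∈ tokens T A k := by
  refine Finset.mem_union_left _ ?_
  cases α <;> simp_all [isConst, baseTokens]

theorem root_mem_tokens {A : Str} {k : ℤ} : (A, T.cls 1, k - 1) ∈ tokens T A k := by
  refine Finset.mem_union_left _ ?_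
  simp [baseTokens]

theorem mem_tokens_of_mem {A s : Str} {k : ℤ} {t : Str × ℕ × ℤ} (hs : s ∈ A.nodes)
    (ht : t ∈ insert (s, s.nodeCls, 0)
      ((s.els.map fun x => (x.prime, s.nodeCls, x.d)).toFinset ∪
        (s.els.map fun x => (x.sub, s.nodeCls, x.e)).toFinset)) : t ∈ tokens T A k := by
  refine Finset.mem_union_left _ ?_
  simp only [baseTokens]
  refine Finset.mem_insert_of_mem (Finset.mem_insert_of_mem (Finset.mem_insert_of_mem ?_))
  exact Finset.mem_biUnion.2 ⟨s, hs, ht⟩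

/-- The structure of the triple `t` occurs at a distance `e` below the node with ID `w`, and the
node that `t` refers to is `w` or above it. -/
def Placed (T : VTree V) (t : Str × ℕ × ℤ) (w e : ℤ) : Prop :=
  (t.1.isConst = true ∧ e = 0) ∨ (t.1.isConst = false ∧
    ∃ p, T.Below p w ∧ T.cls p = t.2.1 ∧ p + t.2.2 = w + e ∧ T.Below w (w + e))

/-- The key `κ` is that of a call for arguments that occur as described by `tα` and `tβ`. The
descriptions are chosen such that they bound the numbers of elements that the arguments contribute:
an argument that sits at the lowest common ancestor must not be described by an edge. -/
structure KeyFrom (T : VTree V) (tα tβ : Str × ℕ × ℤ) (fα fβ : Bool) (op : BoolOp)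
    (κ : ConvKey) : Prop where
  α_eq : κ.α = tα.1
  β_eq : κ.β = tβ.1
  fα_eq : κ.fα = fα
  fβ_eq : κ.fβ = fβ
  op_eq : κ.op = op
  not_const : tα.1.isConst = false ∨ tβ.1.isConst = false
  lenα : lenAt κ.α κ.eα ≤ lenAt tα.1 tα.2.2
  lenβ : lenAt κ.β κ.eβ ≤ lenAt tβ.1 tβ.2.2
  placed : ∃ w, κ.c = T.cls w ∧ Placed T tα w κ.eα ∧ Placed T tβ w κ.eβ ∧
    (tα.1.isConst = true → κ.eβ = 0) ∧ (tβ.1.isConst = true → κ.eα = 0) ∧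
    (tα.1.isConst = false → tβ.1.isConst = false → w = T.lca (w + κ.eα) (w + κ.eβ))

theorem lcaFrom_comm (t : VTree V) (b i j : ℤ) : t.lcaFrom b i j = t.lcaFrom b j i := by
  induction t generalizing b with
  | leaf x => rfl
  | node l r ihl ihr =>
    simp only [lcaFrom, ihl, ihr]
    split_ifs <;> first | rfl | omega

theorem lca_comm {i j : ℤ} : T.lca i j = T.lca j i := by
  simp only [lca, lcaFrom_comm T 1 i j]
  split_ifs <;> simp_all

/-- If the node `p` is above the node `q`, and both are above the lowest common ancestor `w` of
nodes at distance `d` from `p` and at distance `d'` from `q`, then the position of these nodes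
relative to `w`, and the class of `w`, only depend on the distances and on the classes of `p` and
`q`: a node of the class of `q` above a given node is unique. -/
theorem lca_unique {p q w p' q' w' d d' : ℤ} (hpq : T.Below p q) (hqw : T.Below q w)
    (hp : T.Below w (p + d)) (hq : T.Below w (q + d')) (hw : w = T.lca (p + d) (q + d'))
    (hqw' : T.Below q' w')
    (hp' : T.Below w' (p' + d)) (hw' : w' = T.lca (p' + d) (q' + d'))
    (hip : T.Iso p p') (hiq : T.Iso q q') :
    p + d - w = p' + d - w' ∧ q + d' - w = q' + d' - w' ∧ T.cls w = T.cls w' := by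
  have h1 := hip.add (j := q - p) (by simpa using hpq)
  have h2 := h1.below (j := d - (q - p)) (by
    rw [show p + (q - p) + (d - (q - p)) = p + d by ring, show p + (q - p) = q by ring]
    exact hqw.trans hp)
  rw [show p' + (q - p) + (d - (q - p)) = p' + d by ring] at h2
  rw [show p + (q - p) = q by ring] at h1
  -- Both `p' + (q - p)` and `q'` are above `p' + d`, and both are isomorphic to `q`.
  have hqq : p' + (q - p) = q' := by
    obtain ⟨s, hs⟩ := hqw.trans hp |>.exists
    have hx := h1
    have hy := hiq
    obtain ⟨t1, t2, e1, e2, e3⟩ := hx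
    obtain ⟨t3, t4, e4, e5, e6⟩ := hy
    refine h2.eq_of_size (hqw'.trans hp') e2 e5 ?_
    rw [← h1.size_eq e1 e2, hiq.size_eq e1 e5]
  have hd : p + d = q + (d - (q - p)) := by ring
  have hd' : p' + d = q' + (d - (q - p)) := by rw [← hqq]; ring
  rw [hd] at hp hw ⊢
  rw [hd'] at hp' hw' ⊢
  have h3 := hiq.lca (hqw.trans hp) (hqw.trans hq)
  rw [← hw, ← hw'] at h3
  refine ⟨by omega, by omega, ?_⟩
  have h4 := hiq.add (j := w - q) (by simpa using hqw)
  rw [show q + (w - q) = w by ring, show q' + (w - q) = w' by omega] at h4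
  exact h4.cls_eq

theorem iso_of_below {p w p' w' : ℤ} (h : T.Below p w) (h' : T.Below p' w')
    (hc : T.cls p = T.cls p') : T.Iso p p' := by
  obtain ⟨t, ht, _⟩ := h
  obtain ⟨t', ht', _⟩ := h'
  exact iso_of_cls ht ht' hc

/-- A key is determined by the triples that describe the occurrences of its two arguments. -/
theorem KeyFrom.unique {tα tβ : Str × ℕ × ℤ} {fα fβ : Bool} {op : BoolOp} {κ κ' : ConvKey}
    (h : KeyFrom T tα tβ fα fβ op κ) (h' : KeyFrom T tα tβ fα fβ op κ') : κ = κ' := by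
  obtain ⟨h1, h2, h3, h4, h5, hnc, -, -, w, hc, pα, pβ, cα, cβ, hl⟩ := h
  obtain ⟨h1', h2', h3', h4', h5', -, -, -, w', hc', pα', pβ', cα', cβ', hl'⟩ := h'
  suffices hmain : κ.eα = κ'.eα ∧ κ.eβ = κ'.eβ ∧ κ.c = κ'.c by
    cases κ; cases κ'; simp_all
  have hone : ∀ {p d p' : ℤ}, T.Below p w → T.Below p' w' → T.cls p = T.cls p' → p + d = w →
      p' + d = w' → T.cls w = T.cls w' := by
    rintro p d p' hb hb' hcl rfl rfl
    exact ((iso_of_below hb hb' hcl).add hb).cls_eq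
  rcases pα with ⟨aα, e1⟩ | ⟨aα, p, b1, b2, b3, b4⟩
  · rcases pα' with ⟨-, e1'⟩ | ⟨aα', -⟩
    · rcases pβ with ⟨aβ, -⟩ | ⟨aβ, q, b1, b2, b3, b4⟩
      · simp [aα, aβ] at hnc
      · rcases pβ' with ⟨aβ', -⟩ | ⟨-, q', b1', b2', b3', b4'⟩
        · simp [aβ] at aβ'
        · refine ⟨by rw [e1, e1'], by rw [cα aα, cα' aα], ?_⟩
          rw [hc, hc']
          exact hone b1 b1' (b2.trans b2'.symm) (by rw [b3, cα aα]; ring)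
            (by rw [b3', cα' aα]; ring)
    · simp [aα] at aα'
  · rcases pα' with ⟨aα', -⟩ | ⟨-, p', b1', b2', b3', b4'⟩
    · simp [aα] at aα'
    rcases pβ with ⟨aβ, e1⟩ | ⟨aβ, q, c1, c2, c3, c4⟩
    · rcases pβ' with ⟨-, e1'⟩ | ⟨aβ', -⟩
      · refine ⟨by rw [cβ aβ, cβ' aβ], by rw [e1, e1'], ?_⟩
        rw [hc, hc']
        exact hone b1 b1' (b2.trans b2'.symm) (by rw [b3, cβ aβ]; ring)
          (by rw [b3', cβ' aβ]; ring)
      · simp [aβ] at aβ'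
    · rcases pβ' with ⟨aβ', -⟩ | ⟨-, q', c1', c2', c3', c4'⟩
      · simp [aβ] at aβ'
      have hw := hl aα aβ
      have hw' := hl' aα aβ
      rw [hc, hc']
      rw [← b3] at b4 hw
      rw [← c3] at c4 hw
      rw [← b3'] at b4' hw'
      rw [← c3'] at c4' hw'
      have ip := iso_of_below b1 b1' (b2.trans b2'.symm)
      have iq := iso_of_below c1 c1' (c2.trans c2'.symm)
      have hp := b1
      obtain ⟨t, ht, -⟩ := hp
      have hq := c1
      obtain ⟨s, hs, -⟩ := hq
      rcases le_total s.size t.size with hts | hts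
      · obtain ⟨r1, r2, r3⟩ := lca_unique (b1.below_of_size c1 ht hs hts) c1 b4 c4 hw c1' b4' hw'
          ip iq
        exact ⟨by omega, by omega, r3⟩
      · rw [lca_comm] at hw hw'
        obtain ⟨r1, r2, r3⟩ := lca_unique (c1.below_of_size b1 hs ht hts) b1 c4 b4 hw b1' c4' hw'
          iq ip
        exact ⟨by omega, by omega, r3⟩

/-- What the keys of the general algorithm are computed from: the occurrences of the two
arguments, their flags, and the operator. -/
noncomputable def genSources (T : VTree V) (A B : Str) (kA kB : ℤ) (op : BoolOp) :
    Finset ((Str × ℕ × ℤ) × (Str × ℕ × ℤ) × Bool × Bool × BoolOp) :=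
  tokens T A kA ×ˢ tokens T B kB ×ˢ Finset.univ ×ˢ Finset.univ ×ˢ {op, and}

open Classical in
/-- The keys that may be used by the general algorithm. -/
noncomputable def genKeys (T : VTree V) (A B : Str) (kA kB : ℤ) (op : BoolOp) : Finset Key :=
  ((genSources T A B kA kB op).filter fun q =>
    ∃ κ, KeyFrom T q.1 q.2.1 q.2.2.1 q.2.2.2.1 q.2.2.2.2 κ).image fun q =>
      if h : ∃ κ, KeyFrom T q.1 q.2.1 q.2.2.1 q.2.2.2.1 q.2.2.2.2 κ then .inl h.choose
      else .inr ⟨.top, .top, and⟩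

theorem KeyFrom.mem_genKeys {A B : Str} {kA kB : ℤ} {op₀ op : BoolOp} {tα tβ : Str × ℕ × ℤ}
    {fα fβ : Bool} {κ : ConvKey} (h : KeyFrom T tα tβ fα fβ op κ) (hα : tα ∈ tokens T A kA)
    (hβ : tβ ∈ tokens T B kB) (hop : op = op₀ ∨ op = and) :
    .inl κ ∈ genKeys T A B kA kB op₀ := by
  classical
  have hex : ∃ κ, KeyFrom T tα tβ fα fβ op κ := ⟨κ, h⟩
  refine Finset.mem_image.2 ⟨(tα, tβ, fα, fβ, op), Finset.mem_filter.2 ⟨?_, hex⟩, ?_⟩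
  · simp only [genSources, Finset.mem_product]
    exact ⟨hα, hβ, Finset.mem_univ _, Finset.mem_univ _, by simpa using hop⟩
  · rw [dif_pos hex]
    rw [hex.choose_spec.unique h]

/-- `α` is a constant, or it is a VS-SDD at a distance `e` below the node with ID `w`. -/
def Near (T : VTree V) (α : Str) (w e : ℤ) : Prop :=
  α.isConst = true ∨ (IsVSSDD T α (w + e) ∧ T.Below w (w + e))

/-- The property of the structures in the cache of the general algorithm. By transport, it does
not matter which node of the class is used. -/
def GenGood (T : VTree V) (κ : ConvKey) (s : Str) : Prop :=
  s.isTerm = false ∧ ∃ w t, T.idInv w = some t ∧ T.cls w = κ.c ∧ Near T κ.α w κ.eα ∧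
    Near T κ.β w κ.eβ ∧ IsVSSDD T s w ∧
    ∀ ρ, eval T s w ρ = κ.op (κ.fα ^^ eval T κ.α (w + κ.eα) ρ) (κ.fβ ^^ eval T κ.β (w + κ.eβ) ρ)

/-- The context for the general algorithm: its recursion is on the size of the subtree at the lowest
common ancestor, which is determined by the class in the key. -/
noncomputable def genCtx (T : VTree V) (A B : Str) (kA kB : ℤ) (op : BoolOp) : Ctx where
  keys := genKeys T A B kA kB op
  W
    | .inl κ => lenAt κ.α κ.eα * lenAt κ.β κ.eβ
    | .inr _ => 0
  rank
    | .inl κ => (T.idInv κ.c).elim 0 VTree.size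
    | .inr _ => 0
  Good
    | .inl κ => GenGood T κ
    | .inr _ => fun _ => False

/-- The node with the ID `e(w)` has a subtree of the same size as the node `w`. -/
theorem rank_cls {w : ℤ} {t : VTree V} (h : T.idInv w = some t) :
    (T.idInv (T.cls w : ℕ)).elim 0 VTree.size = t.size := by
  have := cls_spec h
  cases h' : T.idInv (T.cls w : ℕ) with
  | none => simp [h'] at this
  | some s =>
    simp [h'] at this
    rw [Option.elim_some, ← size_shape, this, size_shape]

theorem GenGood.transport (hn : T.leaves.Nodup) {κ : ConvKey} {s : Str} (h : GenGood T κ s)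
    {w : ℤ} {t : VTree V} (hw : T.idInv w = some t) (hc : T.cls w = κ.c) :
    s.isTerm = false ∧ IsVSSDD T s w ∧ ∀ ρ, eval T s w ρ =
      κ.op (κ.fα ^^ eval T κ.α (w + κ.eα) ρ) (κ.fβ ^^ eval T κ.β (w + κ.eβ) ρ) := by
  obtain ⟨h0, w', t', hw', hc', hα, hβ, hs, he⟩ := h
  have hi := iso_of_cls hw' hw (hc'.trans hc.symm)
  have near : ∀ {α : Str} {e : ℤ}, Near T α w' e → ∀ ρ ρ', Agree T w' w ρ ρ' →
      eval T α (w' + e) ρ = eval T α (w + e) ρ' := by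
    rintro α e (h | ⟨h1, h2⟩) ρ ρ' ha
    · exact eval_const h _ _ _ _
    · exact (h1.transport hn (hi.add h2)).2 ρ ρ' (ha.add h2)
  obtain ⟨hs', es⟩ := hs.transport hn hi
  refine ⟨h0, hs', fun ρ => ?_⟩
  obtain ⟨ρ', ha⟩ := exists_agree hn hi ρ
  rw [← es ρ' ρ ha, he, near hα ρ' ρ ha, near hβ ρ' ρ ha]

end

section

open Str VTree

variable {V : Type u} {T : VTree V} {m m' : Mem}

/-! ### The general algorithm -/

/-- What is known about an argument `(α, k)` of a recursive call on nodes below `u`, when the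
argument at the top level is `(A, kA)`: it sits below `u`, and it occurs at a known distance from
some node above `u`. -/
structure Side (T : VTree V) (A : Str) (kA u : ℤ) (α : Str) (k : ℤ) : Prop where
  valid : IsVSSDD T α k
  nodes : α.nodes ⊆ A.nodes
  below : α.isConst = false → T.Below u k
  token : α.isConst = false → ∃ t ∈ tokens T A kA, t.1 = α ∧
    ∃ p, T.Below p u ∧ T.cls p = t.2.1 ∧ p + t.2.2 = k

theorem side_const {A α : Str} {kA u k : ℤ} (h : α.isConst = true) : Side T A kA u α k where
  valid := isVSSDD_const h k
  nodes := by rw [nodes_term (isTerm_of_isConst h)]; exact Finset.empty_subset _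
  below h' := by simp [h] at h'
  token h' := by simp [h] at h'

theorem side_root {A : Str} {k : ℤ} (h : IsVSSDD T A k) : Side T A k 1 A k where
  valid := h
  nodes := subset_rfl
  below hc := by
    obtain ⟨t, ht⟩ := h.exists_idInv hc
    exact below_one ht
  token _ := ⟨_, root_mem_tokens, rfl, 1, below_self idInv_one, rfl, by ring⟩

theorem Side.mono {A α : Str} {kA u u' k : ℤ} (h : Side T A kA u α k) (hu : T.Below u u')
    (hk : α.isConst = false → T.Below u' k) : Side T A kA u' α k where
  valid := h.valid
  nodes := h.nodes
  below := hk
  token hc := by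
    obtain ⟨t, h1, h2, p, h3, h4⟩ := h.token hc
    exact ⟨t, h1, h2, p, h3.trans hu, h4⟩

theorem Side.pos {A α : Str} {kA u k : ℤ} (h : Side T A kA u α k) (hc : α.isConst = false) :
    1 ≤ k := by
  have := (h.below hc).le
  have := (h.below hc).pos
  omega

theorem negTerm_isTerm (α : Str) : (negTerm α).isTerm = true := ofVals_isTerm _ _

theorem negTerm_spec {α : Str} {k : ℤ} (h : α.isTerm = true) (hv : IsVSSDD T α k) :
    IsVSSDD T (negTerm α) k ∧ ∀ ρ, eval T (negTerm α) k ρ = !eval T α k ρ :=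
  termOp_spec (fun a _ => !a) h h hv hv

theorem Side.negTerm {A α : Str} {kA u k : ℤ} (h : Side T A kA u α k) (ht : α.isTerm = true) :
    Side T A kA u (negTerm α) k where
  valid := (negTerm_spec ht h.valid).1
  nodes := by rw [nodes_term (negTerm_isTerm α)]; exact Finset.empty_subset _
  below hc := h.below (by cases α <;> simp_all [isConst, VSSDD.negTerm, ofVals, termVal, isTerm])
  token hc := by
    obtain ⟨t, h1, h2, h3⟩ := h.token (by
      cases α <;> simp_all [isConst, VSSDD.negTerm, ofVals, termVal, isTerm])
    refine ⟨_, flip_mem_tokens h1, ?_, h3⟩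
    simp only [h2]
    cases α <;> simp_all [isConst, VSSDD.negTerm, ofVals, termVal, isTerm, flip]

/-- An argument whose negation, if it is a terminal, has been carried out, and whose offset is `0`
if it is a constant. -/
structure Prepared (α : Str) (k : ℤ) (f : Bool) : Prop where
  flag : α.isTerm = true → f = false
  offset : α.isConst = true → k = 0

/-- The occurrence of an argument relative to the lowest common ancestor `w`, an internal node. -/
theorem Side.exists_token {A α : Str} {kA u k w : ℤ} {l r : VTree V} (h : Side T A kA u α k)
    (hu : T.Below u w) (hw : T.idInv w = some (.node l r)) (h0 : α.isConst = true → k = 0)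
    (hk : α.isConst = false → T.Below w k) :
    ∃ t ∈ tokens T A kA, t.1 = α ∧ Placed T t w (max (k - w) 0) ∧
      lenAt α (max (k - w) 0) ≤ lenAt t.1 t.2.2 := by
  have hw1 := idInv_pos hw
  by_cases hc : α.isConst = true
  · have he : max (k - w) 0 = 0 := by have := h0 hc; omega
    refine ⟨(α, 0, 0), const_mem_tokens hc, rfl, Or.inl ⟨hc, he⟩, by rw [he]⟩
  · have hc : α.isConst = false := by simpa using hc
    have hb := hk hc
    have he : max (k - w) 0 = k - w := by have := hb.le; omega
    rw [he]
    by_cases hkw : k = w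
    · have hv := h.valid
      have hn := h.nodes
      cases hv with
      | top => simp [isConst] at hc
      | bot => simp [isConst] at hc
      | pos h => rw [hkw, hw] at h; cases h
      | neg h => rw [hkw, hw] at h; cases h
      | @dec _ _ _ c els hk' hcls =>
        refine ⟨(.dec c els, c, 0), mem_tokens_of_mem (hn mem_nodes_self)
          (Finset.mem_insert_self _ _), rfl, Or.inr ⟨rfl, w, below_self hw, ?_, by
            simp only; omega, by rw [show w + (k - w) = k by ring]; exact hb⟩, ?_⟩
        · rw [hcls, hkw]
        · rw [show k - w = 0 by omega]
    · obtain ⟨t, h1, h2, p, h3, h4, h5⟩ := h.token hc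
      refine ⟨t, h1, h2, Or.inr ⟨by rw [h2]; exact hc, p, h3.trans hu, h4, by omega, by
        rw [show w + (k - w) = k by ring]; exact hb⟩, ?_⟩
      have := h3.le
      have := hu.le
      have := hb.le
      rw [lenAt, lenAt, if_neg (by omega), if_neg (by omega)]

/-- What `Expand` at the node `w` yields. -/
structure GenElems (T : VTree V) (A : Str) (kA : ℤ) (α : Str) (k w r : ℤ) (f : Bool)
    (xs : List FlaggedElem) : Prop where
  part : PartRep xs (fun x ρ => x.fp ^^ eval T x.el.prime (k + x.el.d) ρ)
    (fun x ρ => x.fs ^^ eval T x.el.sub (k + x.el.e) ρ) (fun ρ => f ^^ eval T α k ρ)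
  prime : ∀ x ∈ xs, Side T A kA (w + 1) x.el.prime (k + x.el.d)
  sub : ∀ x ∈ xs, Side T A kA r x.el.sub (k + x.el.e)
  length : xs.length ≤ lenAt α (max (k - w) 0)

theorem expand_step {Γ : Ctx} (hm : Inv Γ m) (n : ℕ) {A α : Str} {kA u k w : ℤ} {f : Bool}
    {l r : VTree V} (h : Side T A kA u α k) (hu : T.Below u w)
    (hw : T.idInv w = some (.node l r)) (h0 : α.isConst = true → k = 0)
    (hk : α.isConst = false → T.Below w k) :
    ∃ xs m', expand T α f k w m = some (xs, m') ∧ m'.look = m.look ∧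
      Step Γ n (1 + xs.length) m m' ∧ GenElems T A kA α k w (w + 1 + l.size) f xs := by
  have hw1 := idInv_pos hw
  have s1 := step_wait hm n 1
  have bl := below_left_self hw
  have br := below_right_self hw
  rw [expand, bind_apply_of_eq (show rightQuery T w m = some (T.rightId w, m.wait 1) from rfl),
    rightId_eq hw]
  by_cases hkw : k = w
  · subst hkw
    rw [if_pos rfl]
    have hc : α.isConst = false := by
      by_contra hc
      have := h0 (by simpa using hc)
      omega
    have hn := h.nodes
    have hv := h.valid
    have hp := fun c els (e : α = .dec c els) => (e ▸ hv : IsVSSDD T (.dec c els) k).partRep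
    cases hv with
    | top => simp [isConst] at hc
    | bot => simp [isConst] at hc
    | pos h => rw [hw] at h; cases h
    | neg h => rw [hw] at h; cases h
    | @dec _ _ _ c els hk' hcls vp vs hpl hsr =>
      rw [hw] at hk'; cases hk'
      have hp := hp c els rfl
      have s2 := s1.trans (step_wait s1.inv n els.length)
      refine ⟨_, _, rfl, by funext κ; cases κ <;> rfl, s2.mono le_rfl (by
        simp only [Str.els, List.length_map]; push_cast; omega),
        ⟨?_, fun ρ => ?_, fun x hx ρ hρ => ?_⟩, fun x hx => ?_, fun x hx => ?_, ?_⟩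
      · simp only [Str.els]
        rw [List.pairwise_map]
        exact hp.disj.imp fun {a b} h ρ => by simpa using h ρ
      · obtain ⟨x, hx, h⟩ := hp.cover ρ
        exact ⟨_, List.mem_map_of_mem hx, by simpa using h⟩
      · obtain ⟨z, hz, rfl⟩ := List.mem_map.1 hx
        have := hp.val z hz ρ (by simpa using hρ)
        simp only at this ⊢
        rw [this]
      · obtain ⟨z, hz, rfl⟩ := List.mem_map.1 hx
        simp only
        by_cases hcz : z.prime.isConst = true
        · exact side_const hcz
        · refine ⟨vp z hz, (nodes_prime_subset hz).trans hn, fun _ => ?_, fun _ => ?_⟩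
          · have := hpl z hz
            rw [if_neg hcz] at this
            exact (below_left hw).2 this
          · refine ⟨(z.prime, c, z.d), mem_tokens_of_mem (hn mem_nodes_self) ?_, rfl, k, bl,
              hcls.symm, rfl⟩
            refine Finset.mem_insert_of_mem (Finset.mem_union_left _ ?_)
            exact List.mem_toFinset.2 (List.mem_map_of_mem (f := fun x : Elem Str =>
              (x.prime, (Str.dec c els).nodeCls, x.d)) hz)
      · obtain ⟨z, hz, rfl⟩ := List.mem_map.1 hx
        simp only
        by_cases hcz : z.sub.isConst = true
        · exact side_const hcz
        · refine ⟨vs z hz, (nodes_sub_subset hz).trans hn, fun _ => ?_, fun _ => ?_⟩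
          · have := hsr z hz
            rw [if_neg hcz] at this
            exact (below_right hw).2 this
          · refine ⟨(z.sub, c, z.e), mem_tokens_of_mem (hn mem_nodes_self) ?_, rfl, k, br,
              hcls.symm, rfl⟩
            refine Finset.mem_insert_of_mem (Finset.mem_union_right _ ?_)
            exact List.mem_toFinset.2 (List.mem_map_of_mem (f := fun x : Elem Str =>
              (x.sub, (Str.dec c els).nodeCls, x.e)) hz)
      · simp [lenAt]
  rw [if_neg hkw]
  by_cases hlt : k < w + 1 + l.size ∧ k ≠ 0
  · rw [if_pos hlt]
    have hc : α.isConst = false := by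
      by_contra hc
      exact hlt.2 (h0 (by simpa using hc))
    have hb := hk hc
    have hb' : T.Below (w + 1) k := (below_left hw).2 ⟨by have := hb.le; omega, hlt.1⟩
    have hside : Side T A kA (w + 1) α (k + 0) := by
      rw [add_zero]; exact h.mono (hu.trans bl) fun _ => hb'
    refine ⟨_, _, rfl, look_wait _, s1.mono le_rfl (by simp), ⟨?_, fun ρ => ?_, ?_⟩, ?_, ?_, ?_⟩
    · simp only [List.pairwise_cons, List.mem_singleton, forall_eq]
      refine ⟨fun ρ => ?_, by simp⟩
      simp only [add_zero]
      cases f <;> cases eval T α k ρ <;> rfl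
    · cases hv : (f ^^ eval T α k ρ) with
      | true => exact ⟨_, List.mem_cons_self, by simpa using hv⟩
      | false =>
        refine ⟨_, List.mem_cons_of_mem _ List.mem_cons_self, ?_⟩
        simp only [add_zero]
        revert hv
        cases f <;> cases eval T α k ρ <;> simp
    · simp only [List.mem_cons, List.not_mem_nil, or_false, forall_eq_or_imp, forall_eq, add_zero,
        eval_top, eval_bot]
      refine ⟨fun ρ => ?_, fun ρ => ?_⟩ <;> cases f <;> cases eval T α k ρ <;> simp
    · simp only [List.mem_cons, List.not_mem_nil, or_false, forall_eq_or_imp, forall_eq]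
      exact ⟨hside, hside⟩
    · simp only [List.mem_cons, List.not_mem_nil, or_false, forall_eq_or_imp, forall_eq]
      exact ⟨side_const rfl, side_const rfl⟩
    · have := hb.le
      rw [lenAt, if_neg (by omega)]; simp
  · rw [if_neg hlt]
    refine ⟨_, _, rfl, look_wait _, s1.mono le_rfl (by simp), ⟨by simp, by simp, by simp⟩, ?_, ?_,
      ?_⟩
    · simp only [List.mem_singleton, forall_eq]
      exact side_const rfl
    · simp only [List.mem_singleton, forall_eq, add_zero]
      by_cases hc : α.isConst = true
      · exact side_const hc
      · refine h.mono (hu.trans br) fun hc => ?_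
        have hpos := h.pos hc
        obtain ⟨t, ht, h1, h2⟩ := hk hc
        rw [hw] at ht; cases ht
        simp only [VTree.size] at h2
        push_cast at h2
        exact (below_right hw).2 ⟨by omega, by omega⟩
    · simp only [lenAt]
      split_ifs <;> simp

/-- `Apply` after the negations of terminals have been carried out. -/
def applyPrepared (T : VTree V) (α β : Str) (kα kβ : ℤ) (fα fβ : Bool) (op : BoolOp) :
    Prog (Str × ℤ) := do
  let w ← lcaQuery T kα kβ
  if α.isTerm = true ∧ β.isTerm = true ∧ (kα = 0 ∨ kβ = 0 ∨ kα = kβ) then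
    return (termOp op α β, if (termOp op α β).isConst then 0 else max kα kβ)
  else
    let c ← clsQuery T w
    match ← convLookup ⟨α, β, fα, fβ, max (kα - w) 0, max (kβ - w) 0, c, op⟩ with
    | some s => return (s, w)
    | none =>
      let α' ← expand T α fα kα w
      let β' ← expand T β fβ kβ w
      let γ ← pairLoop α' β'
        (fun x y => applyFlagged T x.el.prime y.el.prime (kα + x.el.d) (kβ + y.el.d)
            x.fp y.fp and)
        (fun x y => applyFlagged T x.el.sub y.el.sub (kα + x.el.e) (kβ + y.el.e)
              x.fs y.fs op)
        (fun _ l => max (l - w) 0)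
      let s ← uniqueNode c γ
      convStore ⟨α, β, fα, fβ, max (kα - w) 0, max (kβ - w) 0, c, op⟩ s
      return (s, w)

/-- Carries out the negation of a terminal. -/
def prepare (α : Str) (f : Bool) : Str × Bool :=
  if α.isTerm && f then (negTerm α, false) else (α, f)

theorem applyFlagged_eq (T : VTree V) (α β : Str) (kα kβ : ℤ) (fα fβ : Bool) (op : BoolOp) :
    applyFlagged T α β kα kβ fα fβ op = (do
      tick 1
      applyPrepared T (prepare α fα).1 (prepare β fβ).1
        (if (prepare α fα).1.isConst then 0 else kα) (if (prepare β fβ).1.isConst then 0 else kβ)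
        (prepare α fα).2 (prepare β fβ).2 op) := by
  rw [applyFlagged.eq_def]
  rfl

theorem Side.prepare {A α : Str} {kA u k : ℤ} {f : Bool} (h : Side T A kA u α k) :
    Side T A kA u (prepare α f).1 (if (prepare α f).1.isConst then 0 else k) ∧
    Prepared (prepare α f).1 (if (prepare α f).1.isConst then 0 else k) (prepare α f).2 ∧
    ∀ ρ, ((prepare α f).2 ^^
      eval T (prepare α f).1 (if (prepare α f).1.isConst then 0 else k) ρ) =
        (f ^^ eval T α k ρ) := by
  have key : ∀ {β : Str} {g : Bool}, Side T A kA u β k → (β.isTerm = true → g = false) →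
      Side T A kA u β (if β.isConst then 0 else k) ∧
      Prepared β (if β.isConst then 0 else k) g ∧
      ∀ ρ, (g ^^ eval T β (if β.isConst then 0 else k) ρ) = (g ^^ eval T β k ρ) := by
    intro β g hs hf
    by_cases hc : β.isConst = true
    · rw [if_pos hc]
      exact ⟨side_const hc, ⟨hf, fun _ => rfl⟩, fun ρ => by rw [eval_const hc 0 k ρ ρ]⟩
    · rw [if_neg hc]
      exact ⟨hs, ⟨hf, fun h => absurd h hc⟩, fun ρ => rfl⟩
  by_cases ht : (α.isTerm && f) = true
  · rw [VSSDD.prepare, if_pos ht]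
    rw [Bool.and_eq_true] at ht
    obtain ⟨h1, h2, h3⟩ := key (g := false) (h.negTerm ht.1) fun _ => rfl
    refine ⟨h1, h2, fun ρ => ?_⟩
    rw [h3, (negTerm_spec ht.1 h.valid).2, ht.2]
    simp
  · rw [VSSDD.prepare, if_neg ht]
    exact key h fun h' => by simpa [h'] using ht

/-- What a call of the general algorithm on nodes below `u` returns. -/
def GenResult (T : VTree V) (u : ℤ) (F F' : (V → Bool) → Bool) (op : BoolOp) (p : Str) (l : ℤ) :
    Prop :=
  IsVSSDD T p l ∧ (p.isConst = true → l = 0) ∧ (p.isConst = false → T.Below u l) ∧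
    ∀ ρ, eval T p l ρ = op (F ρ) (F' ρ)

/-- The edge to the result of a recursive call. -/
theorem GenResult.edge {u w : ℤ} {F F' : (V → Bool) → Bool} {op : BoolOp} {p : Str} {l : ℤ}
    (h : GenResult T u F F' op p l) (hw : 1 ≤ w) (hu : w < u) :
    (IsVSSDD T p (w + max (l - w) 0) ∧
      if p.isConst then max (l - w) 0 = 0 else T.Below u (w + max (l - w) 0)) ∧
    ∀ ρ, eval T p (w + max (l - w) 0) ρ = op (F ρ) (F' ρ) := by
  obtain ⟨h1, h2, h3, h4⟩ := h
  by_cases hc : p.isConst = true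
  · have := h2 hc
    rw [if_pos hc]
    exact ⟨⟨isVSSDD_const hc _, by omega⟩, fun ρ => by
      rw [← h4]; exact eval_const hc _ _ _ _⟩
  · have hb := h3 (by simpa using hc)
    have := hb.le
    rw [if_neg hc, show w + max (l - w) 0 = l by omega]
    exact ⟨⟨h1, hb⟩, h4⟩

/-- The lowest common ancestor of two arguments below `u`. -/
theorem lca_sides {A B α β : Str} {kA kB u kα kβ : ℤ} {fα fβ : Bool} (hα : Side T A kA u α kα)
    (hβ : Side T B kB u β kβ) (pα : Prepared α kα fα) (pβ : Prepared β kβ fβ)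
    (hc : α.isConst = false ∨ β.isConst = false) :
    T.Below u (T.lca kα kβ) ∧ (α.isConst = false → T.Below (T.lca kα kβ) kα) ∧
      (β.isConst = false → T.Below (T.lca kα kβ) kβ) ∧
      (α.isConst = true → T.lca kα kβ = kβ) ∧ (β.isConst = true → T.lca kα kβ = kα) := by
  by_cases cα : α.isConst = true
  · have cβ : β.isConst = false := by simpa [cα] using hc
    have hl : T.lca kα kβ = kβ := by rw [pα.offset cα, lca, if_pos rfl]
    obtain ⟨t, ht⟩ := (hβ.below cβ).exists
    rw [hl]
    exact ⟨hβ.below cβ, fun h => by simp [cα] at h, fun _ => below_self ht, fun _ => rfl,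
      fun h => by simp [cβ] at h⟩
  · have cα : α.isConst = false := by simpa using cα
    have h1 := hα.pos cα
    by_cases cβ : β.isConst = true
    · have hl : T.lca kα kβ = kα := by rw [pβ.offset cβ, lca, if_neg (by omega), if_pos rfl]
      obtain ⟨t, ht⟩ := (hα.below cα).exists
      rw [hl]
      exact ⟨hα.below cα, fun _ => below_self ht, fun h => by simp [cβ] at h,
        fun h => by simp [cα] at h, fun _ => rfl⟩
    · have cβ : β.isConst = false := by simpa using cβ
      obtain ⟨h2, h3, h4⟩ := lca_spec (hα.below cα) (hβ.below cβ)
      exact ⟨h2, fun _ => h3, fun _ => h4, fun h => by simp [cα] at h,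
        fun h => by simp [cβ] at h⟩

/-- Unless the call returns a terminal at once, the lowest common ancestor is not a leaf. -/
theorem lca_node {A B α β : Str} {kA kB u kα kβ w : ℤ} {fα fβ : Bool} (hα : Side T A kA u α kα)
    (hβ : Side T B kB u β kβ) (pα : Prepared α kα fα) (pβ : Prepared β kβ fβ)
    (hu : T.Below u w) (bα : α.isConst = false → T.Below w kα)
    (bβ : β.isConst = false → T.Below w kβ)
    (ht : ¬(α.isTerm = true ∧ β.isTerm = true ∧ (kα = 0 ∨ kβ = 0 ∨ kα = kβ))) :
    ∃ l r, T.idInv w = some (.node l r) := by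
  obtain ⟨t, hw⟩ := hu.exists
  cases t with
  | node l r => exact ⟨l, r, hw⟩
  | leaf x =>
    exfalso
    have key : ∀ {α : Str} {k : ℤ}, IsVSSDD T α k → (α.isConst = false → T.Below w k) →
        (α.isConst = true → k = 0) → α.isTerm = true ∧ (k = 0 ∨ k = w) := by
      intro α k hv hb h0
      by_cases hc : α.isConst = true
      · exact ⟨isTerm_of_isConst hc, Or.inl (h0 hc)⟩
      · obtain ⟨t, ht, h1, h2⟩ := hb (by simpa using hc)
        rw [hw] at ht; cases ht
        simp only [VTree.size] at h2
        have hk : k = w := by push_cast at h2; omega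
        refine ⟨?_, Or.inr hk⟩
        cases hv with
        | top => rfl
        | bot => rfl
        | pos => rfl
        | neg => rfl
        | dec h => rw [hk, hw] at h; cases h
    obtain ⟨h1, h2⟩ := key hα.valid bα pα.offset
    obtain ⟨h3, h4⟩ := key hβ.valid bβ pβ.offset
    exact ht ⟨h1, h3, by omega⟩

/-- The induction step for the general algorithm. -/
theorem applyPrepared_call (hn : T.leaves.Nodup) {A B : Str} {kA kB : ℤ} {op₀ : BoolOp} {N : ℕ}
    (ih : ∀ N' < N, ∀ (u : ℤ) (t : VTree V), T.idInv u = some t → t.size = N' →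
      ∀ (α β : Str) (kα kβ : ℤ) (fα fβ : Bool) (op : BoolOp), op = op₀ ∨ op = and →
      Side T A kA u α kα → Side T B kB u β kβ →
      Call (genCtx T A B kA kB op₀) N' (applyFlagged T α β kα kβ fα fβ op)
        (GenResult T u (fun ρ => fα ^^ eval T α kα ρ) (fun ρ => fβ ^^ eval T β kβ ρ) op))
    {u : ℤ} {t : VTree V} (hut : T.idInv u = some t) (hN : t.size = N)
    {α β : Str} {kα kβ : ℤ} {fα fβ : Bool} {op : BoolOp} (hop : op = op₀ ∨ op = and)
    (hα : Side T A kA u α kα) (hβ : Side T B kB u β kβ) (pα : Prepared α kα fα)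
    (pβ : Prepared β kβ fβ) (hm : Inv (genCtx T A B kA kB op₀) m) :
    ∃ p lp m', applyPrepared T α β kα kβ fα fβ op m = some ((p, lp), m') ∧
      Step (genCtx T A B kA kB op₀) N 3 m m' ∧ Known m' p ∧
      GenResult T u (fun ρ => fα ^^ eval T α kα ρ) (fun ρ => fβ ^^ eval T β kβ ρ) op p lp := by
  rw [applyPrepared, bind_apply_of_eq (show lcaQuery T kα kβ m =
    some (T.lca kα kβ, m.wait 1) from rfl)]
  have s1 := step_wait hm N 1
  by_cases ht : α.isTerm = true ∧ β.isTerm = true ∧ (kα = 0 ∨ kβ = 0 ∨ kα = kβ)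
  · rw [if_pos ht]
    obtain ⟨t1, t2, t3⟩ := ht
    have fα0 := pα.flag t1
    have fβ0 := pβ.flag t2
    subst fα0 fβ0
    have hz : ∀ {α : Str} {k : ℤ}, (α.isConst = false → 1 ≤ k) → (α.isConst = true → k = 0) →
        0 ≤ k ∧ (α.isConst = true ∨ 1 ≤ k) := by
      intro α k h1 h2
      by_cases hc : α.isConst = true
      · exact ⟨(h2 hc).ge, Or.inl hc⟩
      · have := h1 (by simpa using hc)
        exact ⟨by omega, Or.inr this⟩
    obtain ⟨z1, z2⟩ := hz hα.pos pα.offset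
    obtain ⟨z3, z4⟩ := hz hβ.pos pβ.offset
    have oα : α.isConst = true ∨ max kα kβ = kα := z2.imp_right fun h => by omega
    have oβ : β.isConst = true ∨ max kα kβ = kβ := z4.imp_right fun h => by omega
    obtain ⟨r1, r2⟩ := termOp_spec op t1 t2 (hα.valid.offset oα) (hβ.valid.offset oβ)
    have r2' : ∀ ρ, eval T (termOp op α β) (max kα kβ) ρ =
        op (false ^^ eval T α kα ρ) (false ^^ eval T β kβ ρ) := fun ρ => by
      rw [r2, eval_offset oα, eval_offset oβ]; simp
    refine ⟨_, _, _, rfl, s1.mono le_rfl (by norm_num), known_term (ofVals_isTerm _ _), ?_⟩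
    by_cases hc : (termOp op α β).isConst = true
    · rw [if_pos hc]
      exact ⟨isVSSDD_const hc _, fun _ => rfl, fun h => by simp [hc] at h,
        fun ρ => by rw [← r2']; exact eval_const hc _ _ _ _⟩
    · rw [if_neg hc]
      refine ⟨r1, fun h => absurd h hc, fun _ => ?_, r2'⟩
      by_cases cα : α.isConst = true
      · by_cases cβ : β.isConst = true
        · exact absurd (termOp_const op cα cβ) hc
        · rw [oβ.resolve_left cβ]; exact hβ.below (by simpa using cβ)
      · rw [oα.resolve_left cα]; exact hα.below (by simpa using cα)
  rw [if_neg ht]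
  have hnc : α.isConst = false ∨ β.isConst = false := by
    by_contra h
    simp only [not_or, Bool.not_eq_false] at h
    exact ht ⟨isTerm_of_isConst h.1, isTerm_of_isConst h.2, Or.inl (pα.offset h.1)⟩
  obtain ⟨hu, bα, bβ, lα, lβ⟩ := lca_sides hα hβ pα pβ hnc
  generalize hwdef : T.lca kα kβ = w at *
  obtain ⟨l, r, hw⟩ := lca_node hα hβ pα pβ hu bα bβ ht
  have hw1 := idInv_pos hw
  have s2 := s1.trans (step_wait s1.inv N 1)
  have s3 := s2.trans (step_wait s2.inv N 1)
  rw [bind_apply_of_eq (show clsQuery T w (m.wait 1) =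
    some (T.cls w, (m.wait 1).wait 1) from rfl)]
  set κ : ConvKey := ⟨α, β, fα, fβ, max (kα - w) 0, max (kβ - w) 0, T.cls w, op⟩ with hκ
  rw [bind_apply_of_eq (show convLookup κ ((m.wait 1).wait 1) =
    some (m.look (.inl κ), ((m.wait 1).wait 1).wait 1) from rfl)]
  -- The offsets that can be read off the key represent the same functions.
  have key : ∀ {α : Str} {k : ℤ}, (α.isConst = false → T.Below w k) → IsVSSDD T α k →
      Near T α w (max (k - w) 0) ∧ ∀ ρ, eval T α (w + max (k - w) 0) ρ = eval T α k ρ := by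
    intro α k hb hv
    by_cases hc : α.isConst = true
    · exact ⟨Or.inl hc, fun ρ => eval_const hc _ _ _ _⟩
    · have hb := hb (by simpa using hc)
      have := hb.le
      have e : w + max (k - w) 0 = k := by omega
      refine ⟨Or.inr ?_, fun ρ => by rw [e]⟩
      rw [e]
      exact ⟨hv, hb⟩
  obtain ⟨nearα, evα⟩ := key bα hα.valid
  obtain ⟨nearβ, evβ⟩ := key bβ hβ.valid
  cases hl : m.look (.inl κ) with
  | some s =>
    obtain ⟨h0, h1, h2⟩ := GenGood.transport (T := T) hn (hm.good _ s hl) hw rfl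
    refine ⟨s, w, _, rfl, s3.mono le_rfl (by norm_num), (hm.known _ s hl).step s3, h1,
      fun h => by simp [isTerm_of_isConst h] at h0, fun _ => hu, fun ρ => ?_⟩
    rw [h2]
    simp only [hκ]
    rw [evα, evβ]
  | none =>
    obtain ⟨xs, m4, e4, l4, s4, eα⟩ := expand_step s3.inv N (f := fα) hα hu hw pα.offset bα
    obtain ⟨ys, m5, e5, l5, s5, eβ⟩ := expand_step s4.inv N (f := fβ) hβ hu hw pβ.offset bβ
    simp only
    rw [bind_apply_of_eq e4, bind_apply_of_eq e5]
    have hsize : (VTree.node l r).size ≤ N := by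
      have := hu.nested hut hw
      have := hu.le
      omega
    simp only [VTree.size] at hsize
    obtain ⟨γ, m6, e6, s6, k6, len6, v6, p6⟩ := pairLoop_spec (T := T) (n := l.size + r.size)
      (w := w) hn
      (VP := fun p d => IsVSSDD T p (w + d) ∧
        if p.isConst then d = 0 else T.Below (w + 1) (w + d))
      (VS := fun p d => IsVSSDD T p (w + d) ∧
        if p.isConst then d = 0 else T.Below (w + 1 + l.size) (w + d))
      (fun p d h => h.1) (op := op) eα.part eβ.part
      (f := fun x y => applyFlagged T x.el.prime y.el.prime (kα + x.el.d) (kβ + y.el.d)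
            x.fp y.fp and)
      (g := fun x y => applyFlagged T x.el.sub y.el.sub (kα + x.el.e) (kβ + y.el.e)
              x.fs y.fs op)
      (off := fun _ l => max (l - w) 0)
      (fun x hx y hy => Call.mono (ih l.size (by omega) (w + 1) l (idInv_left hw) rfl _ _ _ _ _ _
        and (Or.inr rfl) (eα.prime x hx) (eβ.prime y hy)) (by omega)
        fun p lp h => h.edge hw1 (by omega))
      (fun x hx y hy => Call.mono (ih r.size (by omega) (w + 1 + l.size) r (idInv_right hw) rfl
        _ _ _ _ _ _ op hop (eα.sub x hx) (eβ.sub y hy)) (by omega)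
        fun p lp h => h.edge hw1 (by omega))
      s5.inv
    rw [bind_apply_of_eq e6]
    obtain ⟨γ', m7, e7, hperm, hmem, s7, l7⟩ := uniqueNode_step s6.inv N (T.cls w) γ
    rw [bind_apply_of_eq e7]
    have p7 := p6.perm hperm
    have v7 : ∀ z ∈ γ', _ := fun z hz => v6 z (hperm.mem_iff.2 hz)
    have vs7 : IsVSSDD T (.dec (T.cls w) γ') w := by
      refine p7.isVSSDD hw (fun z hz => ⟨(v7 z hz).1.1, ?_⟩) (fun z hz => ⟨(v7 z hz).2.1.1, ?_⟩)
        fun z hz => (v7 z hz).2.2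
      · have := (v7 z hz).1.2
        rwa [below_left hw] at this
      · have := (v7 z hz).2.1.2
        rwa [below_right hw] at this
    have f7 := p7.eval_dec (T.cls w)
    set s : Str := .dec (T.cls w) γ' with hs
    set m8 : Mem := { m7 with
      time := m7.time + 1
      conv := Function.update m7.conv κ (some s) } with hm8
    rw [bind_apply_of_eq (show convStore κ s m7 = some ((), m8) from rfl)]
    have hrank : (genCtx T A B kA kB op₀).rank (.inl κ) = 1 + l.size + r.size := by
      simp only [genCtx, hκ]
      rw [rank_cls hw]; rfl
    -- The recursive calls only store results under keys of smaller rank.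
    have hnone : m7.look (.inl κ) = none := by
      rw [l7, s6.frame _ (by rw [hrank]; omega), l5, l4, look_wait, look_wait, look_wait, hl]
    obtain ⟨tα, mα, eqα, plα, lenα⟩ := hα.exists_token hu hw pα.offset bα
    obtain ⟨tβ, mβ, eqβ, plβ, lenβ⟩ := hβ.exists_token hu hw pβ.offset bβ
    have hfrom : KeyFrom T tα tβ fα fβ op κ := by
      refine ⟨eqα.symm, eqβ.symm, rfl, rfl, rfl, by rwa [eqα, eqβ], lenα, lenβ, w, rfl, plα, plβ,
        fun h => ?_, fun h => ?_, fun h1 h2 => ?_⟩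
      · rw [eqα] at h; simp only [hκ]; rw [← lα h]; simp
      · rw [eqβ] at h; simp only [hκ]; rw [← lβ h]; simp
      · rw [eqα] at h1
        rw [eqβ] at h2
        have := (bα h1).le
        have := (bβ h2).le
        simp only [hκ]
        rw [show w + max (kα - w) 0 = kα by omega, show w + max (kβ - w) 0 = kβ by omega, hwdef]
    have s8 := step_store (m' := m8) (n := N) s7.inv (κ := .inl κ) (s := s)
      (hfrom.mem_genKeys mα mβ hop) hnone
      ⟨rfl, w, _, hw, rfl, nearα, nearβ, vs7, fun ρ => by
        rw [f7]; simp only [hκ]; rw [evα, evβ]⟩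
      (fun t ht => by
        rcases mem_nodes_dec.1 ht with rfl | ⟨z, hz, ht⟩
        · exact Or.inl rfl
        · right
          rw [l7]
          have := k6 z (hperm.mem_iff.2 hz)
          exact ht.elim (this.1 t) (this.2 t))
      (fun _ => hmem) rfl rfl rfl
      (by
        funext κ'
        cases κ' with
        | inr κ' => rw [Function.update_of_ne (by simp)]; rfl
        | inl κ' =>
          by_cases h : κ' = κ
          · subst h; simp [hm8, Mem.look]
          · rw [Function.update_of_ne (by simpa using h)]
            simp [hm8, Mem.look, Function.update_of_ne h])
      (by rw [hrank]; omega)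
    refine ⟨s, w, m8, rfl, (((((s3.trans s4).trans s5).trans (s6.mono (by omega) le_rfl)).trans
      s7).trans s8).mono le_rfl ?_, ?_, vs7, fun h => by simp [hs, isConst] at h, fun _ => hu, f7⟩
    · have h1 := eα.length
      have h2 := eβ.length
      have hlen : s.els.length = γ.length := hperm.length_eq.symm
      rw [hlen]
      simp only [genCtx, hκ]
      have hpos : ∀ α e, 1 ≤ lenAt α e := fun α e => by
        simp only [lenAt]; split_ifs <;> simp
      have ha := hpos α (max (kα - w) 0)
      have hb := hpos β (max (kβ - w) 0)
      set a := lenAt α (max (kα - w) 0)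
      set b := lenAt β (max (kβ - w) 0)
      have h3 : xs.length * ys.length ≤ a * b := Nat.mul_le_mul h1 h2
      have h4 : xs.length ≤ a * b := h1.trans (Nat.le_mul_of_pos_right _ hb)
      have h4' : ys.length ≤ a * b := h2.trans (Nat.le_mul_of_pos_left _ ha)
      have h5 : 1 ≤ a * b := Nat.one_le_iff_ne_zero.2 (by positivity)
      zify at *
      linarith
    · refine s8.inv.known (.inl κ) s ?_
      simp [hm8, Mem.look]

/-- Every recursive call of the general algorithm terminates, returns a correct result, and runs
within constant amortized time. -/
theorem applyFlagged_call (hn : T.leaves.Nodup) (A B : Str) (kA kB : ℤ) (op₀ : BoolOp) (N : ℕ) :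
    ∀ (u : ℤ) (t : VTree V), T.idInv u = some t → t.size = N →
      ∀ (α β : Str) (kα kβ : ℤ) (fα fβ : Bool) (op : BoolOp), op = op₀ ∨ op = and →
      Side T A kA u α kα → Side T B kB u β kβ →
      Call (genCtx T A B kA kB op₀) N (applyFlagged T α β kα kβ fα fβ op)
        (GenResult T u (fun ρ => fα ^^ eval T α kα ρ) (fun ρ => fβ ^^ eval T β kβ ρ) op) := by
  induction N using Nat.strong_induction_on with
  | _ N ih =>
  intro u t hut hN α β kα kβ fα fβ op hop hα hβ m hm
  obtain ⟨hα', pα, eα⟩ := hα.prepare (f := fα)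
  obtain ⟨hβ', pβ, eβ⟩ := hβ.prepare (f := fβ)
  have s1 := step_wait hm N 1
  obtain ⟨p, lp, m', e, s, k, r1, r2, r3, r4⟩ :=
    applyPrepared_call hn ih hut hN hop hα' hβ' pα pβ s1.inv
  refine ⟨p, lp, m', ?_, (s1.trans s).mono le_rfl (by norm_num), k, r1, r2, r3, fun ρ => ?_⟩
  · rw [applyFlagged_eq, bind_apply_of_eq (tick_apply 1 m), e]
  · simp only [r4, eα, eβ]

end

section

open Str VTree

variable {V : Type u} {T : VTree V}

/-! ### The sum of the weights of all keys -/

theorem sum_insert_le {ι : Type*} [DecidableEq ι] (a : ι) (s : Finset ι) (f : ι → ℕ) :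
    ∑ x ∈ insert a s, f x ≤ f a + ∑ x ∈ s, f x := by
  by_cases h : a ∈ s
  · rw [Finset.insert_eq_of_mem h]; omega
  · rw [Finset.sum_insert h]

theorem sum_union_le {ι : Type*} [DecidableEq ι] (s t : Finset ι) (f : ι → ℕ) :
    ∑ x ∈ s ∪ t, f x ≤ ∑ x ∈ s, f x + ∑ x ∈ t, f x := by
  rw [← Finset.sum_union_inter]; omega

theorem sum_biUnion_le {ι κ : Type*} [DecidableEq ι] [DecidableEq κ] (s : Finset κ)
    (t : κ → Finset ι) (f : ι → ℕ) :
    ∑ x ∈ s.biUnion t, f x ≤ ∑ k ∈ s, ∑ x ∈ t k, f x := by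
  induction s using Finset.induction_on with
  | empty => simp
  | insert a s ha ih =>
    rw [Finset.biUnion_insert, Finset.sum_insert ha]
    exact (sum_union_le _ _ _).trans (by omega)

theorem sum_toFinset_le {ι : Type*} [DecidableEq ι] (l : List ι) (f : ι → ℕ) {c : ℕ}
    (h : ∀ x ∈ l, f x ≤ c) : ∑ x ∈ l.toFinset, f x ≤ l.length * c := by
  refine (Finset.sum_le_card_nsmul _ _ c fun x hx => h x (List.mem_toFinset.1 hx)).trans ?_
  rw [smul_eq_mul]
  exact Nat.mul_le_mul_right _ (List.toFinset_card_le l)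

/-- Every node of a VS-SDD is itself a VS-SDD at some offset. -/
theorem IsVSSDD.of_mem_nodes {A : Str} {k : ℤ} (h : IsVSSDD T A k) {s : Str} (hs : s ∈ A.nodes) :
    ∃ k', IsVSSDD T s k' := by
  induction A using decInduction generalizing k with
  | term α hα => simp [nodes_term hα] at hs
  | dec c l ih =>
    rcases mem_nodes_dec.1 hs with rfl | ⟨x, hx, hs⟩
    · exact ⟨k, h⟩
    · cases h with
      | dec _ _ vp vs =>
        exact hs.elim (fun hs => (ih x hx).1 (vp x hx) hs) (fun hs => (ih x hx).2 (vs x hx) hs)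

theorem IsVSSDD.one_le_length {A : Str} {k : ℤ} (h : IsVSSDD T A k) {s : Str}
    (hs : s ∈ A.nodes) : 1 ≤ s.els.length := by
  obtain ⟨c, l, rfl⟩ := nodes_isTerm hs
  obtain ⟨k', h'⟩ := h.of_mem_nodes hs
  exact List.length_pos_iff.2 h'.els_ne_nil

theorem length_els_le_size (A : Str) : A.els.length ≤ A.size := by
  cases A with
  | dec c l =>
    unfold Str.size
    exact Finset.single_le_sum (f := fun s : Str => s.els.length)
      (fun _ _ => Nat.zero_le _) mem_nodes_self
  | _ => exact Nat.zero_le _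

theorem sum_nodesConst_le {A : Str} {k : ℤ} (h : IsVSSDD T A k) :
    ∑ s ∈ nodesConst A, max 1 s.els.length ≤ 3 * max 1 A.size := by
  have h1 := sum_insert_le Str.top (insert .bot A.nodes) fun s => max 1 s.els.length
  have h2 := sum_insert_le Str.bot A.nodes fun s => max 1 s.els.length
  have h3 : ∑ s ∈ A.nodes, max 1 s.els.length = A.size :=
    Finset.sum_congr rfl fun s hs => max_eq_right (h.one_le_length hs)
  have e1 : (max 1 (Str.els Str.top).length) = 1 := rfl
  have e2 : (max 1 (Str.els Str.bot).length) = 1 := rfl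
  simp only [nodesConst] at *
  omega

theorem lenAt_le_two {α : Str} (h : α.isConst = true) (e : ℤ) : lenAt α e ≤ 2 := by
  rw [lenAt]
  cases α <;> simp_all [isConst, Str.els] <;> split_ifs <;> simp

theorem sum_baseTokens_le {A : Str} {k : ℤ} (h : IsVSSDD T A k) :
    ∑ t ∈ baseTokens T A k, lenAt t.1 t.2.2 ≤ 10 * max 1 A.size := by
  rw [baseTokens]
  refine (sum_insert_le _ _ _).trans ?_
  have h1 := sum_insert_le (Str.bot, 0, 0) (insert (A, T.cls 1, k - 1)
    (A.nodes.biUnion fun s => insert (s, s.nodeCls, (0 : ℤ))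
      ((s.els.map fun x => (x.prime, s.nodeCls, x.d)).toFinset ∪
        (s.els.map fun x => (x.sub, s.nodeCls, x.e)).toFinset))) fun t => lenAt t.1 t.2.2
  have h2 := sum_insert_le (A, T.cls 1, k - 1)
    (A.nodes.biUnion fun s => insert (s, s.nodeCls, (0 : ℤ))
      ((s.els.map fun x => (x.prime, s.nodeCls, x.d)).toFinset ∪
        (s.els.map fun x => (x.sub, s.nodeCls, x.e)).toFinset)) fun t => lenAt t.1 t.2.2
  have h3 : ∑ t ∈ A.nodes.biUnion fun s => insert (s, s.nodeCls, (0 : ℤ))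
      ((s.els.map fun x => (x.prime, s.nodeCls, x.d)).toFinset ∪
        (s.els.map fun x => (x.sub, s.nodeCls, x.e)).toFinset), lenAt t.1 t.2.2 ≤
        5 * A.size := by
    refine (sum_biUnion_le _ _ _).trans ?_
    rw [Str.size, Finset.mul_sum]
    refine Finset.sum_le_sum fun s hs => ?_
    have hlen := h.one_le_length hs
    obtain ⟨c, l, rfl⟩ := nodes_isTerm hs
    obtain ⟨k', h'⟩ := h.of_mem_nodes hs
    refine (sum_insert_le _ _ _).trans ?_
    have e1 : lenAt (Str.dec c l) 0 = l.length := by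
      rw [lenAt, if_pos rfl]; exact max_eq_right hlen
    have h4 := sum_union_le ((l.map fun x => (x.prime, c, x.d)).toFinset)
      ((l.map fun x => (x.sub, c, x.e)).toFinset) fun t => lenAt t.1 t.2.2
    have hnc : ∀ {α : Str} {e : ℤ}, (if α.isConst then e = 0 else 0 < e) → lenAt α e ≤ 2 := by
      intro α e he
      by_cases hc : α.isConst = true
      · exact lenAt_le_two hc e
      · rw [if_neg hc] at he
        rw [lenAt, if_neg (by omega)]
    cases h' with
    | dec _ _ _ _ hpl hsr =>
    have h5 := sum_toFinset_le (l.map fun x => (x.prime, c, x.d)) (fun t => lenAt t.1 t.2.2)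
      (c := 2) (by
        intro t ht
        obtain ⟨x, hx, rfl⟩ := List.mem_map.1 ht
        refine hnc ?_
        simp only
        have := hpl x hx
        split_ifs at this ⊢ <;> omega)
    have h6 := sum_toFinset_le (l.map fun x => (x.sub, c, x.e)) (fun t => lenAt t.1 t.2.2)
      (c := 2) (by
        intro t ht
        obtain ⟨x, hx, rfl⟩ := List.mem_map.1 ht
        refine hnc ?_
        simp only
        have := hsr x hx
        split_ifs at this ⊢ <;> omega)
    rw [List.length_map] at h5 h6
    simp only [Str.nodeCls, Str.els, e1] at *
    omega
  have e1 : lenAt Str.top 0 = 1 := rfl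
  have e2 : lenAt Str.bot 0 = 1 := rfl
  have e3 : lenAt A (k - 1) ≤ 2 + A.size := by
    have := length_els_le_size A
    rw [lenAt]
    split_ifs <;> omega
  simp only [e1, e2] at *
  omega

theorem lenAt_flip (α : Str) (e : ℤ) : lenAt (flip α) e = lenAt α e := by
  cases α <;> rfl

theorem sum_tokens_le {A : Str} {k : ℤ} (h : IsVSSDD T A k) :
    ∑ t ∈ tokens T A k, lenAt t.1 t.2.2 ≤ 20 * max 1 A.size := by
  have h1 := sum_baseTokens_le h
  have h2 := sum_union_le (baseTokens T A k)
    ((baseTokens T A k).image fun t => (flip t.1, t.2)) fun t => lenAt t.1 t.2.2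
  have h3 : ∑ t ∈ (baseTokens T A k).image fun t => (flip t.1, t.2), lenAt t.1 t.2.2 ≤
      ∑ t ∈ baseTokens T A k, lenAt t.1 t.2.2 := by
    refine (Finset.sum_image_le_of_nonneg fun _ _ => Nat.zero_le _).trans ?_
    simp only [lenAt_flip, le_refl]
  rw [tokens]
  omega

theorem sum_product_mul {ι κ : Type*} (s : Finset ι) (t : Finset κ) (f : ι → ℕ) (g : κ → ℕ) :
    ∑ q ∈ s ×ˢ t, f q.1 * g q.2 = (∑ x ∈ s, f x) * ∑ y ∈ t, g y := by
  rw [Finset.sum_product, Finset.sum_mul_sum]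

theorem sum_product_fst {ι κ : Type*} (s : Finset ι) (t : Finset κ) (f : ι → ℕ) :
    ∑ q ∈ s ×ˢ t, f q.1 = (∑ x ∈ s, f x) * t.card := by
  rw [Finset.sum_product, Finset.sum_mul]
  exact Finset.sum_congr rfl fun x _ => by
    simp only [Finset.sum_const, smul_eq_mul, mul_comm]

theorem card_ops_le (op : BoolOp) : ({op, and} : Finset BoolOp).card ≤ 2 := Finset.card_le_two

theorem sum_normCtx_le {A B : Str} {k l : ℤ} {op : BoolOp} (hA : IsVSSDD T A k)
    (hB : IsVSSDD T B l) : ∑ κ ∈ (normCtx T A B op).keys, (normCtx T A B op).W κ ≤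
      18 * (max 1 A.size * max 1 B.size) := by
  simp only [normCtx]
  refine (Finset.sum_image_le_of_nonneg fun _ _ => Nat.zero_le _).trans ?_
  rw [sum_product_mul (nodesConst A) (nodesConst B ×ˢ ({op, and} : Finset BoolOp))
    (fun s => max 1 s.els.length) (fun q => max 1 q.1.els.length),
    sum_product_fst _ _ fun s : Str => max 1 s.els.length]
  calc _ ≤ (3 * max 1 A.size) * ((3 * max 1 B.size) * 2) := by
        refine Nat.mul_le_mul (sum_nodesConst_le hA) (Nat.mul_le_mul (sum_nodesConst_le hB)
          (card_ops_le op))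
    _ = _ := by ring

theorem sum_genCtx_le {A B : Str} {k l : ℤ} {op : BoolOp} (hA : IsVSSDD T A k)
    (hB : IsVSSDD T B l) : ∑ κ ∈ (genCtx T A B k l op).keys, (genCtx T A B k l op).W κ ≤
      3200 * (max 1 A.size * max 1 B.size) := by
  classical
  calc _ ≤ ∑ q ∈ genSources T A B k l op, lenAt q.1.1 q.1.2.2 * lenAt q.2.1.1 q.2.1.2.2 := by
        simp only [genCtx, genKeys]
        refine (Finset.sum_image_le_of_nonneg fun _ _ => Nat.zero_le _).trans ?_
        refine (Finset.sum_le_sum fun q hq => ?_).trans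
          (Finset.sum_le_sum_of_subset (Finset.filter_subset _ _))
        have hex := (Finset.mem_filter.1 hq).2
        rw [dif_pos hex]
        exact Nat.mul_le_mul hex.choose_spec.lenα hex.choose_spec.lenβ
    _ = (∑ t ∈ tokens T A k, lenAt t.1 t.2.2) * ((∑ t ∈ tokens T B l, lenAt t.1 t.2.2) *
          ((Finset.univ : Finset Bool) ×ˢ (Finset.univ : Finset Bool) ×ˢ
            ({op, and} : Finset BoolOp)).card) := by
        rw [genSources, sum_product_mul (tokens T A k) (tokens T B l ×ˢ _)
          (fun t => lenAt t.1 t.2.2) (fun q => lenAt q.1.1 q.1.2.2),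
          sum_product_fst _ _ fun t : Str × ℕ × ℤ => lenAt t.1 t.2.2]
    _ ≤ (20 * max 1 A.size) * ((20 * max 1 B.size) * (2 * (2 * 2))) := by
        refine Nat.mul_le_mul (sum_tokens_le hA) (Nat.mul_le_mul (sum_tokens_le hB) ?_)
        rw [Finset.card_product, Finset.card_product, Finset.card_univ, Fintype.card_bool]
        have := card_ops_le op
        omega
    _ = _ := by ring

/-! ### The initial memory, and the conclusion -/

theorem inv_init {Γ : Ctx} {U : List Str} (hU : Reduced U) : Inv Γ (Mem.init U) where
  reduced := hU
  cons_eq _ _ h := by simp [Mem.init] at h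
  mem_keys κ _ h := by cases κ <;> simp [Mem.init, Mem.look] at h
  good κ _ h := by cases κ <;> simp [Mem.init, Mem.look] at h
  known κ _ h := by cases κ <;> simp [Mem.init, Mem.look] at h
  mem_uniq κ _ h := by cases κ <;> simp [Mem.init, Mem.look] at h

theorem potential_init (Γ : Ctx) (U : List Str) :
    Γ.potential (Mem.init U) = 40 * ∑ κ ∈ Γ.keys, Γ.W κ := by
  rw [Ctx.potential, Finset.mul_sum]
  refine Finset.sum_congr rfl fun κ _ => ?_
  cases κ <;> simp [Ctx.charge, Mem.init, Mem.look]

/-- The time of a top-level call is bounded by the initial potential. -/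
theorem Step.time_le {Γ : Ctx} {n c : ℕ} {U : List Str} {M : Mem} (h : Step Γ n 4 (Mem.init U) M)
    {b : ℕ} (hW : ∑ κ ∈ Γ.keys, Γ.W κ ≤ c * b) (hb : 1 ≤ b) : M.time ≤ (40 * c + 4) * b := by
  have h1 := h.time
  rw [potential_init] at h1
  have h2 : (Mem.init U).time = 0 := rfl
  have h3 : (40 * c + 4) * b = 40 * (c * b) + 4 * b := by ring
  omega

end

end VSSDD

theorem mainTheorem4 : ∃ C : ℕ, ∀ (V : Type u) (T : VSSDD.VTree V), T.leaves.Nodup →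
    ∀ (U : List VSSDD.Str), VSSDD.Reduced U → ∀ (op : Bool → Bool → Bool) (α β : VSSDD.Str),
      (∀ k : ℤ, VSSDD.IsVSSDD T α k → VSSDD.IsVSSDD T β k →
        VSSDD.Normalized T α k → VSSDD.Normalized T β k →
        ∃ (γ : VSSDD.Str) (M : VSSDD.Mem),
          VSSDD.applyNormalized T α β k op (VSSDD.Mem.init U) = some ((γ, k), M) ∧
          VSSDD.IsVSSDD T γ k ∧ VSSDD.Normalized T γ k ∧
          (∀ ρ : V → Bool,
            VSSDD.eval T γ k ρ = op (VSSDD.eval T α k ρ) (VSSDD.eval T β k ρ)) ∧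
          (∀ s ∈ γ.nodes, s ∈ M.uniq) ∧ (∀ s ∈ U, s ∈ M.uniq) ∧ VSSDD.Reduced M.uniq ∧
          M.time ≤ C * (max 1 α.size * max 1 β.size)) ∧
      (∀ k l : ℤ, VSSDD.IsVSSDD T α k → VSSDD.IsVSSDD T β l →
        ∃ (γ : VSSDD.Str) (m : ℤ) (M : VSSDD.Mem),
          VSSDD.applyGeneral T α β k l op (VSSDD.Mem.init U) = some ((γ, m), M) ∧
          VSSDD.IsVSSDD T γ m ∧
          (∀ ρ : V → Bool,
            VSSDD.eval T γ m ρ = op (VSSDD.eval T α k ρ) (VSSDD.eval T β l ρ)) ∧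
          (∀ s ∈ γ.nodes, s ∈ M.uniq) ∧ (∀ s ∈ U, s ∈ M.uniq) ∧ VSSDD.Reduced M.uniq ∧
          M.time ≤ C * (max 1 α.size * max 1 β.size)) := by
  -- `40` is the potential per unit of weight, `3200` bounds the weight of all keys, and `4` is the
  -- amortized cost of a call.
  refine ⟨40 * 3200 + 4, fun V T hn U hU op α β => ?_⟩
  have hb : 1 ≤ max 1 α.size * max 1 β.size :=
    Nat.mul_le_mul (le_max_left 1 α.size) (le_max_left 1 β.size)
  constructor
  · intro k hα hβ nα nβ
    obtain ⟨γ, k', M, e, s, hk, rfl, v, n, f, -⟩ := VSSDD.applyNormalized_call hn α β op _ α β k op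
      rfl (Or.inl rfl) subset_rfl subset_rfl hα hβ nα nβ _ (VSSDD.inv_init hU)
    exact ⟨γ, M, e, v, n, f, hk.mem_uniq s.inv, s.uniq, s.inv.reduced,
      s.time_le ((VSSDD.sum_normCtx_le hα hβ).trans (Nat.mul_le_mul_right _ (by norm_num))) hb⟩
  · intro k l hα hβ
    obtain ⟨γ, m, M, e, s, hk, v, -, -, f⟩ := VSSDD.applyFlagged_call hn α β k l op _ 1 T
      VSSDD.VTree.idInv_one rfl α β k l false false op (Or.inl rfl) (VSSDD.side_root hα)
      (VSSDD.side_root hβ) _ (VSSDD.inv_init hU)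
    refine ⟨γ, m, M, e, v, fun ρ => ?_, hk.mem_uniq s.inv, s.uniq, s.inv.reduced,
      s.time_le (VSSDD.sum_genCtx_le hα hβ) hb⟩
    rw [f]
    simp
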